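/- **Data.** Let the index $\alpha$ run over a finite set, repeated upper and lower indices being summed. (For a defect, $\alpha=(\xi,i)$ with $\xi=\pm$, $i=1,\dots,N$.) Let $\mathcal S(\chi_1,\chi_2)$, $\chi_i\in\mathbb R$, be matrices with bounded measurable entries $\mathcal S_{\alpha_1\alpha_2}^{\beta_1\beta_2}$ (lower indices label rows) satisfying $$\mathcal S(\chi_1,\chi_2)\mathcal S(\chi_2,\chi_1)=1,\qquad \mathcal S(\chi_1,\chi_2)^\dagger=\mathcal S(\chi_2,\chi_1),$$ $$\mathcal S_{12}(\chi_1,\chi_2)\mathcal S_{23}(\chi_1,\chi_3)\mathcal S_{12}(\chi_2,\chi_3)=\mathcal S_{23}(\chi_2,\chi_3)\mathcal S_{12}(\chi_1,\chi_3)\mathcal S_{23}(\chi_1,\chi_2).$$ Let $\{\mathcal R,\mathcal T\}$ be an admissible pair: matrices $\mathcal R(\chi)$, $\mathcal T(\chi)$ with bounded measurable entries $\mathcal R_\alpha^\beta,\mathcal T_\alpha^\beta$ such that $\mathcal R(\chi)^\dagger=\mathcal R(-\chi)$, $\mathcal T(\chi)^\dagger=\mathcal T(\chi)$, $$\mathcal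 S_{12}(\chi_1,\chi_2)\mathcal R_2(\chi_1)\mathcal S_{12}(\chi_2,-\chi_1)\mathcal R_2(\chi_2)=\mathcal R_2(\chi_2)\mathcal S_{12}(\chi_1,-\chi_2)\mathcal R_2(\chi_1)\mathcal S_{12}(-\chi_2,-\chi_1),$$ $$\mathcal S_{12}(\chi_1,\chi_2)\mathcal T_2(\chi_1)\mathcal S_{12}(\chi_2,\chi_1)\mathcal T_2(\chi_2)=\mathcal T_2(\chi_2)\mathcal S_{12}(\chi_1,\chi_2)\mathcal T_2(\chi_1)\mathcal S_{12}(\chi_2,\chi_1),$$ $$\mathcal S_{12}(\chi_1,\chi_2)\mathcal T_2(\chi_1)\mathcal S_{12}(\chi_2,\chi_1)\mathcal R_2(\chi_2)=\mathcal R_2(\chi_2)\mathcal S_{12}(\chi_1,-\chi_2)\mathcal T_2(\chi_1)\mathcal S_{12}(-\chi_2,\chi_1),$$ $$\mathcal T(\chi)\mathcal T(\chi)+\mathcal R(\chi)\mathcal R(-\chi)=1,\qquad \mathcal T(\chi)\mathcal R(\chi)+\mathcal R(\chi)\mathcal T(-\chi)=0 .$$ **Fock space.** Let $\mathcal L=\bigoplus_\alpha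 L^2(\mathbb R)$. The elements of $\mathcal L^{\otimes n}$ are square integrable columns $\varphi_{\alpha_1\cdots\alpha_n}(\chi_1,\dots,\chi_n)$. Let $\mathcal W_n$ be the Weyl group of the root system $B_n$, with standard generators $\sigma_1,\dots,\sigma_{n-1},\tau$. Then there is a (unique) representation $\phi_n$ of $\mathcal W_n$ on $\mathcal L^{\otimes n}$ with $$[\phi_n(\sigma_i)\varphi](\dots,\chi_i,\chi_{i+1},\dots)=\mathcal S_{i\,i+1}(\chi_i,\chi_{i+1})\,\varphi(\dots,\chi_{i+1},\chi_i,\dots),$$ $$[\phi_n(\tau)\varphi](\chi_1,\dots,\chi_n)=\mathcal T_n(\chi_n)\varphi(\chi_1,\dots,\chi_n)+\mathcal R_n(\chi_n)\varphi(\chi_1,\dots,\chi_{n-1},-\chi_n),$$ and $P^{(n)}=\frac1{2^nn!}\sum_{\nu\in\mathcal W_n}\phi_n(\nu)$ is an orthogonal projection. Put $\mathcal H^{(n)}=P^{(n)}\mathcal L^{\otimes n}$ (so $\mathcal H^{(0)}=\mathbb C$) and $\mathcal H=\bigoplus_{n\ge0}\mathcal H^{(n)}$, let $\mathcal D\subset\mathcal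 H$ be the subspace of sequences $(\varphi^{(n)})$ with finitely many non-zero terms, and let $\Omega=(1,0,0,\dots)$. **Operators.** The following formulas ($f\in\mathcal L$, $\chi\in\mathbb R$) define linear operators $a(f)$, $a^*(f)$, $r_\alpha^\beta(\chi)$, $t_\alpha^\beta(\chi)$ from $\mathcal D$ to $\mathcal D$: $$[a(f)\varphi]^{(n)}_{\alpha_1\cdots\alpha_n}(\chi_1,\dots,\chi_n)=\sqrt{n+1}\int d\chi\,\overline{f_{\alpha_0}(\chi)}\,\varphi^{(n+1)}_{\alpha_0\alpha_1\cdots\alpha_n}(\chi,\chi_1,\dots,\chi_n),$$ $$[a^*(f)\varphi]^{(n)}=\sqrt n\,P^{(n)}\bigl(f\otimes\varphi^{(n-1)}\bigr)\ (n\ge1),\qquad [a^*(f)\varphi]^{(0)}=0,$$ $$[r_\alpha^\beta(\chi)\varphi]^{(n)}_{\gamma_1\cdots\gamma_n}=\bigl[\mathcal S_{01}(\chi,\chi_1)\cdots\mathcal S_{(n-1)n}(\chi,\chi_n)\,\mathcal R_n(\chi)\,\mathcal S_{(n-1)n}(\chi_n,-\chi)\cdots\mathcal S_{01}(\chi_1,-\chi)\bigr]_{\alpha\gamma_1\cdots\gamma_n}^{\beta\delta_1\cdots\delta_n}\varphi^{(n)}_{\delta_1\cdots\delta_n},$$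 $$[t_\alpha^\beta(\chi)\varphi]^{(n)}_{\gamma_1\cdots\gamma_n}=\bigl[\mathcal S_{01}(\chi,\chi_1)\cdots\mathcal S_{(n-1)n}(\chi,\chi_n)\,\mathcal T_n(\chi)\,\mathcal S_{(n-1)n}(\chi_n,\chi)\cdots\mathcal S_{01}(\chi_1,\chi)\bigr]_{\alpha\gamma_1\cdots\gamma_n}^{\beta\delta_1\cdots\delta_n}\varphi^{(n)}_{\delta_1\cdots\delta_n},$$ all functions in the last two lines being taken at $(\chi_1,\dots,\chi_n)$; for $n=0$ they mean $r_\alpha^\beta(\chi)\Omega=\mathcal R_\alpha^\beta(\chi)\Omega$, $t_\alpha^\beta(\chi)\Omega=\mathcal T_\alpha^\beta(\chi)\Omega$. Define the operator-valued distributions $a_\alpha(\chi)$, $a^{*\alpha}(\chi)$ by $a(f)=\int d\chi\,\overline{f_\alpha(\chi)}\,a_\alpha(\chi)$ and $a^*(f)=\int d\chi\,f_\alpha(\chi)\,a^{*\alpha}(\chi)$. **Proposition 3.5.** On $\mathcal D$, in the sense of distributions in the spectral parameters of the bulk generators $a,a^*$ and for all values of those of the defect generators $r,t$, with $\kappa=\tfrac12$: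 * (bulk) $$a_{\alpha_1}(\chi_1)a_{\alpha_2}(\chi_2)=\mathcal S_{\alpha_2\alpha_1}^{\beta_1\beta_2}(\chi_2,\chi_1)\,a_{\beta_2}(\chi_2)a_{\beta_1}(\chi_1),$$ $$a^{*\alpha_1}(\chi_1)a^{*\alpha_2}(\chi_2)=a^{*\beta_2}(\chi_2)a^{*\beta_1}(\chi_1)\,\mathcal S_{\beta_2\beta_1}^{\alpha_1\alpha_2}(\chi_2,\chi_1),$$ $$a_{\alpha_1}(\chi_1)a^{*\alpha_2}(\chi_2)-a^{*\beta_2}(\chi_2)\mathcal S_{\alpha_1\beta_2}^{\alpha_2\beta_1}(\chi_1,\chi_2)a_{\beta_1}(\chi_1)=\kappa\,\delta(\chi_1-\chi_2)\bigl[\delta_{\alpha_1}^{\alpha_2}+t_{\alpha_1}^{\alpha_2}(\chi_1)\bigr]+\kappa\,\delta(\chi_1+\chi_2)\,r_{\alpha_1}^{\alpha_2}(\chi_1);$$ * (defect) $$\mathcal S_{\alpha_1\alpha_2}^{\gamma_2\gamma_1}(\chi_1,\chi_2)r_{\gamma_1}^{\delta_1}(\chi_1)\mathcal S_{\gamma_2\delta_1}^{\beta_1\delta_2}(\chi_2,-\chi_1)r_{\delta_2}^{\beta_2}(\chi_2)=r_{\alpha_2}^{\gamma_2}(\chi_2)\mathcal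 S_{\alpha_1\gamma_2}^{\delta_2\delta_1}(\chi_1,-\chi_2)r_{\delta_1}^{\gamma_1}(\chi_1)\mathcal S_{\delta_2\gamma_1}^{\beta_1\beta_2}(-\chi_2,-\chi_1),$$ $$\mathcal S_{\alpha_1\alpha_2}^{\gamma_2\gamma_1}(\chi_1,\chi_2)t_{\gamma_1}^{\delta_1}(\chi_1)\mathcal S_{\gamma_2\delta_1}^{\beta_1\delta_2}(\chi_2,\chi_1)t_{\delta_2}^{\beta_2}(\chi_2)=t_{\alpha_2}^{\gamma_2}(\chi_2)\mathcal S_{\alpha_1\gamma_2}^{\delta_2\delta_1}(\chi_1,\chi_2)t_{\delta_1}^{\gamma_1}(\chi_1)\mathcal S_{\delta_2\gamma_1}^{\beta_1\beta_2}(\chi_2,\chi_1),$$ $$\mathcal S_{\alpha_1\alpha_2}^{\gamma_2\gamma_1}(\chi_1,\chi_2)t_{\gamma_1}^{\delta_1}(\chi_1)\mathcal S_{\gamma_2\delta_1}^{\beta_1\delta_2}(\chi_2,\chi_1)r_{\delta_2}^{\beta_2}(\chi_2)=r_{\alpha_2}^{\gamma_2}(\chi_2)\mathcal S_{\alpha_1\gamma_2}^{\delta_2\delta_1}(\chi_1,-\chi_2)t_{\delta_1}^{\gamma_1}(\chi_1)\mathcal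 S_{\delta_2\gamma_1}^{\beta_1\beta_2}(-\chi_2,\chi_1);$$ * (mixed) $$a_{\alpha_1}(\chi_1)r_{\alpha_2}^{\beta_2}(\chi_2)=\mathcal S_{\alpha_2\alpha_1}^{\gamma_1\gamma_2}(\chi_2,\chi_1)r_{\gamma_2}^{\delta_2}(\chi_2)\mathcal S_{\gamma_1\delta_2}^{\beta_2\delta_1}(\chi_1,-\chi_2)a_{\delta_1}(\chi_1),$$ $$r_{\alpha_1}^{\beta_1}(\chi_1)a^{*\alpha_2}(\chi_2)=a^{*\delta_2}(\chi_2)\mathcal S_{\alpha_1\delta_2}^{\gamma_2\delta_1}(\chi_1,\chi_2)r_{\delta_1}^{\gamma_1}(\chi_1)\mathcal S_{\gamma_2\gamma_1}^{\beta_1\alpha_2}(\chi_2,-\chi_1),$$ $$a_{\alpha_1}(\chi_1)t_{\alpha_2}^{\beta_2}(\chi_2)=\mathcal S_{\alpha_2\alpha_1}^{\gamma_1\gamma_2}(\chi_2,\chi_1)t_{\gamma_2}^{\delta_2}(\chi_2)\mathcal S_{\gamma_1\delta_2}^{\beta_2\delta_1}(\chi_1,\chi_2)a_{\delta_1}(\chi_1),$$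 $$t_{\alpha_1}^{\beta_1}(\chi_1)a^{*\alpha_2}(\chi_2)=a^{*\delta_2}(\chi_2)\mathcal S_{\alpha_1\delta_2}^{\gamma_2\delta_1}(\chi_1,\chi_2)t_{\delta_1}^{\gamma_1}(\chi_1)\mathcal S_{\gamma_2\gamma_1}^{\beta_1\alpha_2}(\chi_2,\chi_1);$$ * (unitarity) $$t_{\alpha_1}^\beta(\chi)t_\beta^{\alpha_2}(\chi)+r_{\alpha_1}^\beta(\chi)r_\beta^{\alpha_2}(-\chi)=\delta_{\alpha_1}^{\alpha_2},\qquad t_{\alpha_1}^\beta(\chi)r_\beta^{\alpha_2}(\chi)+r_{\alpha_1}^\beta(\chi)t_\beta^{\alpha_2}(-\chi)=0 .$$ The involution $a_\alpha(\chi)\leftrightarrow a^{*\alpha}(\chi)$, $r_\alpha^\beta(\chi)\mapsto r_\beta^\alpha(-\chi)$, $t_\alpha^\beta(\chi)\mapsto t_\beta^\alpha(\chi)$ is Hermitian conjugation: for $\varphi,\psi\in\mathcal D$, $(a(f)\varphi,\psi)=(\varphi,a^*(f)\psi)$, $(r_\alpha^\beta(\chi)\varphi,\psi)=(\varphi,r_\beta^\alpha(-\chi)\psi)$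 and $(t_\alpha^\beta(\chi)\varphi,\psi)=(\varphi,t_\beta^\alpha(\chi)\psi)$. Moreover this is a Fock representation: $\mathcal H$ is a Hilbert space, $\mathcal D$ is dense, $a(f)\varphi$ and $a^*(f)\varphi$ depend continuously on $f$ for each $\varphi\in\mathcal D$, the matrix elements of $r_\alpha^\beta(\chi)$, $t_\alpha^\beta(\chi)$ are measurable in $\chi$ and $\chi\mapsto r_\alpha^\beta(\chi)\varphi,\ t_\alpha^\beta(\chi)\varphi$ are bounded for each $\varphi\in\mathcal D$, $(\Omega,\Omega)=1$, $a(f)\Omega=0$, and $\Omega$ is cyclic for the $a^*(f)$. Likewise, with $a_\alpha(\chi)$ and $a^{*\alpha}(\chi)$ replaced by $\sqrt{4\pi}\,a_\alpha(\chi)$ and $\sqrt{4\pi}\,a^{*\alpha}(\chi)$, everything in the proposition holds with $\kappa=2\pi$. -/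

import Mathlib

namespace RTAlgebra

open MeasureTheory
open scoped ENNReal Kronecker Matrix ComplexConjugate InnerProductSpace

noncomputable section

/-! ## Tensor notation and the input data

`ι` is the finite set of (multi-)indices `α`. A matrix `M` with lower indices `α` (rows) and upper
indices `β` (columns) has the entries `M α β`. -/

/-- The matrix `M` acting on the slots `i`, `j` of an `m`-fold tensor power, identically on the
other slots. -/
def onPair {ι : Type*} [DecidableEq ι] {m : ℕ} (i j : Fin m) (M : Matrix (ι × ι) (ι × ι) ℂ) :
    Matrix (Fin m → ι) (Fin m → ι) ℂ :=
  fun α β => if ∀ k, k ≠ i → k ≠ j → α k = β k then M (α i, α j) (β i, β j) else 0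

/-- The matrix `M` acting on the slot `i` of an `m`-fold tensor power. -/
def onSlot {ι : Type*} [DecidableEq ι] {m : ℕ} (i : Fin m) (M : Matrix ι ι ℂ) :
    Matrix (Fin m → ι) (Fin m → ι) ℂ :=
  fun α β => if ∀ k, k ≠ i → α k = β k then M (α i) (β i) else 0

/-- The assumptions on the exchange factor: unitarity, quantum Yang-Baxter equation in braid form,
Hermitian analyticity, and (measurable) bounded matrix elements. -/
structure IsExchangeFactor {ι : Type*} [Fintype ι] [DecidableEq ι]
    (S : ℝ → ℝ → Matrix (ι × ι) (ι × ι) ℂ) : Prop where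
  unitarity : ∀ x y, S x y * S y x = 1
  yangBaxter : ∀ x y z,
    onPair (0 : Fin 3) 1 (S x y) * onPair 1 2 (S x z) * onPair 0 1 (S y z) =
      onPair 1 2 (S y z) * onPair 0 1 (S x z) * onPair 1 2 (S x y)
  hermitian : ∀ x y, (S x y)ᴴ = S y x
  measurable : ∀ a b, Measurable fun p : ℝ × ℝ => S p.1 p.2 a b
  bounded : ∃ C : ℝ, ∀ x y a b, ‖S x y a b‖ ≤ C

/-- Admissible pairs of a reflection matrix `R` and a transmission matrix `T`: Hermitian
analyticity, the reflection, transmission and transmission-reflection Yang-Baxter equations, the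
two unitarity conditions, and (measurable) bounded matrix elements.
`1 ⊗ₖ M` is `M` acting on the second tensor factor. -/
structure IsAdmissiblePair {ι : Type*} [Fintype ι] [DecidableEq ι]
    (S : ℝ → ℝ → Matrix (ι × ι) (ι × ι) ℂ) (R T : ℝ → Matrix ι ι ℂ) : Prop where
  hermitian_R : ∀ x, (R x)ᴴ = R (-x)
  hermitian_T : ∀ x, (T x)ᴴ = T x
  yangBaxter_RR : ∀ x y,
    S x y * ((1 : Matrix ι ι ℂ) ⊗ₖ R x) * S y (-x) * ((1 : Matrix ι ι ℂ) ⊗ₖ R y) =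
      ((1 : Matrix ι ι ℂ) ⊗ₖ R y) * S x (-y) * ((1 : Matrix ι ι ℂ) ⊗ₖ R x) * S (-y) (-x)
  yangBaxter_TT : ∀ x y,
    S x y * ((1 : Matrix ι ι ℂ) ⊗ₖ T x) * S y x * ((1 : Matrix ι ι ℂ) ⊗ₖ T y) =
      ((1 : Matrix ι ι ℂ) ⊗ₖ T y) * S x y * ((1 : Matrix ι ι ℂ) ⊗ₖ T x) * S y x
  yangBaxter_TR : ∀ x y,
    S x y * ((1 : Matrix ι ι ℂ) ⊗ₖ T x) * S y x * ((1 : Matrix ι ι ℂ) ⊗ₖ R y) =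
      ((1 : Matrix ι ι ℂ) ⊗ₖ R y) * S x (-y) * ((1 : Matrix ι ι ℂ) ⊗ₖ T x) * S (-y) x
  unitarity_one : ∀ x, T x * T x + R x * R (-x) = 1
  unitarity_zero : ∀ x, T x * R x + R x * T (-x) = 0
  measurable_R : ∀ a b, Measurable fun x => R x a b
  measurable_T : ∀ a b, Measurable fun x => T x a b
  bounded_R : ∃ C : ℝ, ∀ x a b, ‖R x a b‖ ≤ C
  bounded_T : ∃ C : ℝ, ∀ x a b, ‖T x a b‖ ≤ C

/-! ## Operator-valued distributions and representations of the algebra -/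

/-- Scalar square integrable functions of one spectral parameter. -/
abbrev L2One : Type := Lp ℂ 2 (volume : Measure ℝ)

/-- Scalar square integrable functions of two spectral parameters. -/
abbrev L2Two : Type := Lp ℂ 2 (volume : Measure (ℝ × ℝ))

/-- The generators as operators on a common domain `D`, which they leave invariant. The bulk
generators are smeared: `a α h = ∫ h(χ) a_α(χ) dχ` and `adag α h = ∫ h(χ) a^{*α}(χ) dχ`, both linear
in `h`. The defect generators `r α β χ = r_α^β(χ)`, `t α β χ = t_α^β(χ)` are functions of `χ`.
Products in `Module.End ℂ D` are compositions. -/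
structure Generators (ι : Type*) (D : Type*) [AddCommGroup D] [Module ℂ D] where
  a : ι → L2One →ₗ[ℂ] Module.End ℂ D
  adag : ι → L2One →ₗ[ℂ] Module.End ℂ D
  r : ι → ι → ℝ → Module.End ℂ D
  t : ι → ι → ℝ → Module.End ℂ D

/-- The bulk generators multiplied by the number `c`. -/
def Generators.scale {ι D : Type*} [AddCommGroup D] [Module ℂ D] (c : ℂ) (G : Generators ι D) :
    Generators ι D where
  a := fun α => c • G.a α
  adag := fun α => c • G.adag α
  r := G.r
  t := G.t

/-- `a(f) = ∑_α ∫ conj (f_α(χ)) a_α(χ) dχ`. -/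
def Generators.annih {ι D : Type*} [Fintype ι] [AddCommGroup D] [Module ℂ D]
    (G : Generators ι D) (f : ι → L2One) : Module.End ℂ D :=
  ∑ α, G.a α (star (f α))

/-- `a^*(f) = ∑_α ∫ f_α(χ) a^{*α}(χ) dχ`. -/
def Generators.creat {ι D : Type*} [Fintype ι] [AddCommGroup D] [Module ℂ D]
    (G : Generators ι D) (f : ι → L2One) : Module.End ℂ D :=
  ∑ α, G.adag α (f α)

section Relations

variable {ι : Type*} [Fintype ι] [DecidableEq ι]
  {H : Type*} [NormedAddCommGroup H] [InnerProductSpace ℂ H] {D : Submodule ℂ H}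

/-- `Q` is the product of the operator-valued distributions `A` and `B`, i.e.
`Q k = ∫∫ k(χ, χ') A(χ) B(χ') dχ dχ'`: the (unique) extension of `f ⊗ g ↦ A(f) B(g)` to all square
integrable functions of two variables which is linear and strongly continuous. -/
structure IsSmearedProduct (A B : L2One →ₗ[ℂ] Module.End ℂ D)
    (Q : L2Two →ₗ[ℂ] Module.End ℂ D) : Prop where
  continuous : ∀ v : D, Continuous fun k => (Q k v : H)
  product : ∀ (f g : L2One) (k : L2Two), (k =ᵐ[volume] fun p => f p.1 * g p.2) → Q k = A f * B g

/-- The generators are operator-valued distributions: the bulk ones depend continuously on the test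
function, and the defect ones have measurable matrix elements and are bounded on each vector. -/
structure IsOperatorDistribution (G : Generators ι D) : Prop where
  continuous_a : ∀ α (v : D), Continuous fun h => (G.a α h v : H)
  continuous_adag : ∀ α (v : D), Continuous fun h => (G.adag α h v : H)
  measurable_r : ∀ α β (v : D) (w : H), AEMeasurable fun χ => ⟪w, (G.r α β χ v : H)⟫_ℂ
  measurable_t : ∀ α β (v : D) (w : H), AEMeasurable fun χ => ⟪w, (G.t α β χ v : H)⟫_ℂ
  bounded_r : ∀ α β (v : D), ∃ C : ℝ, ∀ χ, ‖(G.r α β χ v : H)‖ ≤ C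
  bounded_t : ∀ α β (v : D), ∃ C : ℝ, ∀ χ, ‖(G.t α β χ v : H)‖ ≤ C

/-- The bulk exchange relations, smeared with test functions. In `rel_aa` and `rel_adag_adag` the
function `k` of `(χ₁, χ₂)` is the test function, and `k'` collects the coefficients of the exchanged
product, whose first variable is `χ₂` and whose second one is `χ₁`. In `rel_a_adag` the test
function is `f(χ₁) g(χ₂)` and the identity is stated for all matrix elements; `κ` is the
normalization of the delta functions, i.e. the right-hand side is
`κ δ(χ₁ - χ₂) [δ_{α₁}^{α₂} + t_{α₁}^{α₂}(χ₁)] + κ δ(χ₁ + χ₂) r_{α₁}^{α₂}(χ₁)`. -/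
structure BulkRelations (κ : ℝ) (S : ℝ → ℝ → Matrix (ι × ι) (ι × ι) ℂ) (G : Generators ι D) :
    Prop where
  rel_aa : ∃ Q : ι → ι → L2Two →ₗ[ℂ] Module.End ℂ D,
    (∀ α β, IsSmearedProduct (G.a α) (G.a β) (Q α β)) ∧
    ∀ (α₁ α₂ : ι) (k : L2Two) (k' : ι → ι → L2Two),
      (∀ β₁ β₂, k' β₁ β₂ =ᵐ[volume]
        fun p => S p.1 p.2 (α₂, α₁) (β₁, β₂) * k (p.2, p.1)) →
      Q α₁ α₂ k - ∑ β₁, ∑ β₂, Q β₂ β₁ (k' β₁ β₂) = 0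
  rel_adag_adag : ∃ Q : ι → ι → L2Two →ₗ[ℂ] Module.End ℂ D,
    (∀ α β, IsSmearedProduct (G.adag α) (G.adag β) (Q α β)) ∧
    ∀ (α₁ α₂ : ι) (k : L2Two) (k' : ι → ι → L2Two),
      (∀ β₁ β₂, k' β₁ β₂ =ᵐ[volume]
        fun p => S p.1 p.2 (β₂, β₁) (α₁, α₂) * k (p.2, p.1)) →
      Q α₁ α₂ k - ∑ β₁, ∑ β₂, Q β₂ β₁ (k' β₁ β₂) = 0
  rel_a_adag : ∃ Q : ι → ι → L2Two →ₗ[ℂ] Module.End ℂ D,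
    (∀ α β, IsSmearedProduct (G.adag α) (G.a β) (Q α β)) ∧
    ∀ (α₁ α₂ : ι) (f g : L2One) (k' : ι → ι → L2Two),
      (∀ β₁ β₂, k' β₁ β₂ =ᵐ[volume]
        fun p => S p.2 p.1 (α₁, β₂) (α₂, β₁) * (f p.2 * g p.1)) →
      ∀ (v : D) (w : H),
        ⟪w, (((G.a α₁ f * G.adag α₂ g - ∑ β₁, ∑ β₂, Q β₂ β₁ (k' β₁ β₂)) v : D) : H)⟫_ℂ =
          κ * (∫ χ, f χ * g χ *
              ((if α₁ = α₂ then ⟪w, (v : H)⟫_ℂ else 0) + ⟪w, (G.t α₁ α₂ χ v : H)⟫_ℂ)) +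
          κ * (∫ χ, f χ * g (-χ) * ⟪w, (G.r α₁ α₂ χ v : H)⟫_ℂ)

/-- The defect exchange relations, for all values of the spectral parameters. -/
structure DefectRelations (S : ℝ → ℝ → Matrix (ι × ι) (ι × ι) ℂ) (G : Generators ι D) :
    Prop where
  rel_rr : ∀ (α₁ α₂ β₁ β₂ : ι) (x y : ℝ),
    ∑ γ₁, ∑ γ₂, ∑ δ₁, ∑ δ₂, (S x y (α₁, α₂) (γ₂, γ₁) * S y (-x) (γ₂, δ₁) (β₁, δ₂)) •
        (G.r γ₁ δ₁ x * G.r δ₂ β₂ y) =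
      ∑ γ₁, ∑ γ₂, ∑ δ₁, ∑ δ₂, (S x (-y) (α₁, γ₂) (δ₂, δ₁) * S (-y) (-x) (δ₂, γ₁) (β₁, β₂)) •
        (G.r α₂ γ₂ y * G.r δ₁ γ₁ x)
  rel_tt : ∀ (α₁ α₂ β₁ β₂ : ι) (x y : ℝ),
    ∑ γ₁, ∑ γ₂, ∑ δ₁, ∑ δ₂, (S x y (α₁, α₂) (γ₂, γ₁) * S y x (γ₂, δ₁) (β₁, δ₂)) •
        (G.t γ₁ δ₁ x * G.t δ₂ β₂ y) =
      ∑ γ₁, ∑ γ₂, ∑ δ₁, ∑ δ₂, (S x y (α₁, γ₂) (δ₂, δ₁) * S y x (δ₂, γ₁) (β₁, β₂)) •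
        (G.t α₂ γ₂ y * G.t δ₁ γ₁ x)
  rel_tr : ∀ (α₁ α₂ β₁ β₂ : ι) (x y : ℝ),
    ∑ γ₁, ∑ γ₂, ∑ δ₁, ∑ δ₂, (S x y (α₁, α₂) (γ₂, γ₁) * S y x (γ₂, δ₁) (β₁, δ₂)) •
        (G.t γ₁ δ₁ x * G.r δ₂ β₂ y) =
      ∑ γ₁, ∑ γ₂, ∑ δ₁, ∑ δ₂, (S x (-y) (α₁, γ₂) (δ₂, δ₁) * S (-y) x (δ₂, γ₁) (β₁, β₂)) •
        (G.r α₂ γ₂ y * G.t δ₁ γ₁ x)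

/-- The mixed exchange relations, smeared in the spectral parameter of the bulk generator with `h`
and for all values of the spectral parameter of the defect generator. -/
structure MixedRelations (S : ℝ → ℝ → Matrix (ι × ι) (ι × ι) ℂ) (G : Generators ι D) :
    Prop where
  rel_ar : ∀ (α₁ α₂ β₂ : ι) (χ₂ : ℝ) (h : L2One) (h' : ι → ι → ι → L2One),
    (∀ γ₂ δ₁ δ₂, h' γ₂ δ₁ δ₂ =ᵐ[volume] fun χ₁ =>
      (∑ γ₁, S χ₂ χ₁ (α₂, α₁) (γ₁, γ₂) * S χ₁ (-χ₂) (γ₁, δ₂) (β₂, δ₁)) * h χ₁) →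
    G.a α₁ h * G.r α₂ β₂ χ₂ = ∑ γ₂, ∑ δ₁, ∑ δ₂, G.r γ₂ δ₂ χ₂ * G.a δ₁ (h' γ₂ δ₁ δ₂)
  rel_r_adag : ∀ (α₁ α₂ β₁ : ι) (χ₁ : ℝ) (h : L2One) (h' : ι → ι → ι → L2One),
    (∀ γ₁ δ₁ δ₂, h' γ₁ δ₁ δ₂ =ᵐ[volume] fun χ₂ =>
      (∑ γ₂, S χ₁ χ₂ (α₁, δ₂) (γ₂, δ₁) * S χ₂ (-χ₁) (γ₂, γ₁) (β₁, α₂)) * h χ₂) →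
    G.r α₁ β₁ χ₁ * G.adag α₂ h = ∑ γ₁, ∑ δ₁, ∑ δ₂, G.adag δ₂ (h' γ₁ δ₁ δ₂) * G.r δ₁ γ₁ χ₁
  rel_at : ∀ (α₁ α₂ β₂ : ι) (χ₂ : ℝ) (h : L2One) (h' : ι → ι → ι → L2One),
    (∀ γ₂ δ₁ δ₂, h' γ₂ δ₁ δ₂ =ᵐ[volume] fun χ₁ =>
      (∑ γ₁, S χ₂ χ₁ (α₂, α₁) (γ₁, γ₂) * S χ₁ χ₂ (γ₁, δ₂) (β₂, δ₁)) * h χ₁) →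
    G.a α₁ h * G.t α₂ β₂ χ₂ = ∑ γ₂, ∑ δ₁, ∑ δ₂, G.t γ₂ δ₂ χ₂ * G.a δ₁ (h' γ₂ δ₁ δ₂)
  rel_t_adag : ∀ (α₁ α₂ β₁ : ι) (χ₁ : ℝ) (h : L2One) (h' : ι → ι → ι → L2One),
    (∀ γ₁ δ₁ δ₂, h' γ₁ δ₁ δ₂ =ᵐ[volume] fun χ₂ =>
      (∑ γ₂, S χ₁ χ₂ (α₁, δ₂) (γ₂, δ₁) * S χ₂ χ₁ (γ₂, γ₁) (β₁, α₂)) * h χ₂) →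
    G.t α₁ β₁ χ₁ * G.adag α₂ h = ∑ γ₁, ∑ δ₁, ∑ δ₂, G.adag δ₂ (h' γ₁ δ₁ δ₂) * G.t δ₁ γ₁ χ₁

/-- The unitarity constraints on the defect generators. -/
structure UnitarityConstraints (G : Generators ι D) : Prop where
  unit_one : ∀ (α₁ α₂ : ι) (χ : ℝ),
    (∑ β, G.t α₁ β χ * G.t β α₂ χ) + (∑ β, G.r α₁ β χ * G.r β α₂ (-χ)) =
      if α₁ = α₂ then 1 else 0
  unit_zero : ∀ (α₁ α₂ : ι) (χ : ℝ),
    (∑ β, G.t α₁ β χ * G.r β α₂ χ) + (∑ β, G.r α₁ β χ * G.t β α₂ (-χ)) = 0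

/-- The antilinear involution `a_α(χ) ↔ a^{*α}(χ)`, `r_α^β(χ) ↦ r_β^α(-χ)`, `t_α^β(χ) ↦ t_β^α(χ)` is
Hermitian conjugation with respect to the scalar product. -/
structure InvolutionIsConjugation (G : Generators ι D) : Prop where
  conj_a : ∀ (α : ι) (h : L2One) (v w : D),
    ⟪(G.a α h v : H), (w : H)⟫_ℂ = ⟪(v : H), (G.adag α (star h) w : H)⟫_ℂ
  conj_r : ∀ (α β : ι) (χ : ℝ) (v w : D),
    ⟪(G.r α β χ v : H), (w : H)⟫_ℂ = ⟪(v : H), (G.r β α (-χ) w : H)⟫_ℂ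
  conj_t : ∀ (α β : ι) (χ : ℝ) (v w : D),
    ⟪(G.t α β χ v : H), (w : H)⟫_ℂ = ⟪(v : H), (G.t β α χ w : H)⟫_ℂ

/-- `G` is a Fock representation, on the dense invariant domain `D` of the Hilbert space `H` and
with vacuum `Ω`, of the reflection-transmission algebra with exchange factor `S` (with the
delta functions of the `a a^*` relation normalized by `κ`). -/
structure IsFockRepresentation (κ : ℝ) (S : ℝ → ℝ → Matrix (ι × ι) (ι × ι) ℂ)
    (G : Generators ι D) (Ω : D) : Prop where
  complete : CompleteSpace H
  dense : Dense (D : Set H)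
  distribution : IsOperatorDistribution G
  bulk : BulkRelations κ S G
  defect : DefectRelations S G
  mixed : MixedRelations S G
  unitarity : UnitarityConstraints G
  involution : InvolutionIsConjugation G
  vacuum_norm : ⟪(Ω : H), (Ω : H)⟫_ℂ = 1
  vacuum_annih : ∀ α h, G.a α h Ω = 0
  vacuum_cyclic : Dense (Submodule.span ℂ (Set.range fun l : List (ι × L2One) =>
    (((l.map fun p => G.adag p.1 p.2).prod Ω : D) : H)) : Set H)

end Relations

/-! ## The explicit Fock space -/

/-- The simple reflections of the root system `B_n`, as permutations of the short roots `± e_j`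
(written `(j, ± 1)`): the first `n - 1` ones exchange `e_i` and `e_{i+1}`, the last one changes the
sign of the last basis vector. -/
def simpleReflection (n : ℕ) (i : Fin n) : Equiv.Perm (Fin n × ℤˣ) :=
  if h : (i : ℕ) + 1 < n then (Equiv.swap i ⟨i + 1, h⟩).prodCongr (Equiv.refl ℤˣ)
  else Equiv.swap (i, 1) (i, -1)

/-- The Weyl group of the root system `B_n`, generated by the simple reflections. -/
def weylGroupB (n : ℕ) : Subgroup (Equiv.Perm (Fin n × ℤˣ)) :=
  Subgroup.closure (Set.range (simpleReflection n))

/-- The generators of the Weyl group. -/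
def weylGen (n : ℕ) (i : Fin n) : weylGroupB n :=
  ⟨simpleReflection n i, Subgroup.subset_closure ⟨i, rfl⟩⟩

/-- The `n`-fold Hilbert tensor power of `L = ⊕_α L²(ℝ)`: columns `φ_{α₁…αₙ}(χ₁,…,χₙ)` of
square integrable functions of `n` spectral parameters. -/
abbrev TensorPower (ι : Type*) [Fintype ι] (n : ℕ) : Type _ :=
  Lp (EuclideanSpace ℂ (Fin n → ι)) 2 (volume : Measure (Fin n → ℝ))

section Fock

variable {ι : Type*} [Fintype ι] [DecidableEq ι]

/-- `ρ` is the family of representations of the Weyl groups of type `B_n` on the tensor powers in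
which the generators act by
`[σ_i ψ](χ) = S_{i,i+1}(χ_i, χ_{i+1}) ψ(…, χ_{i+1}, χ_i, …)` for `i < n` and
`[τ ψ](χ) = T_n(χ_n) ψ(χ₁, …, χ_n) + R_n(χ_n) ψ(χ₁, …, -χ_n)`. -/
structure IsWeylRepresentation (S : ℝ → ℝ → Matrix (ι × ι) (ι × ι) ℂ) (R T : ℝ → Matrix ι ι ℂ)
    (ρ : (n : ℕ) → weylGroupB n →* (TensorPower ι n →L[ℂ] TensorPower ι n)) : Prop where
  sigma : ∀ (n : ℕ) (i : Fin n) (h : (i : ℕ) + 1 < n) (ψ : TensorPower ι n),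
    ∀ᵐ x, ∀ α : Fin n → ι, ρ n (weylGen n i) ψ x α =
      ∑ β, onPair i ⟨i + 1, h⟩ (S (x i) (x ⟨i + 1, h⟩)) α β *
        ψ (x ∘ Equiv.swap i ⟨i + 1, h⟩) β
  tau : ∀ (n : ℕ) (i : Fin n) (_ : (i : ℕ) + 1 = n) (ψ : TensorPower ι n),
    ∀ᵐ x, ∀ α : Fin n → ι, ρ n (weylGen n i) ψ x α =
      (∑ β, onSlot i (T (x i)) α β * ψ x β) +
        (∑ β, onSlot i (R (x i)) α β * ψ (Function.update x i (-x i)) β)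

/-- `P^(n) = 1 / (2ⁿ n!) ∑_ν ρ_n(ν)`, the sum running over the (finite) Weyl group. -/
def fockProjection (ρ : (n : ℕ) → weylGroupB n →* (TensorPower ι n →L[ℂ] TensorPower ι n))
    (n : ℕ) : TensorPower ι n →L[ℂ] TensorPower ι n :=
  ((2 ^ n * n.factorial : ℂ)⁻¹) • ∑ᶠ ν : weylGroupB n, ρ n ν

/-- The `n`-particle space `H^(n) = P^(n) L^{⊗n}`. -/
def particleSpace (ρ : (n : ℕ) → weylGroupB n →* (TensorPower ι n →L[ℂ] TensorPower ι n))
    (n : ℕ) : Submodule ℂ (TensorPower ι n) :=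
  LinearMap.range (fockProjection ρ n : TensorPower ι n →ₗ[ℂ] TensorPower ι n)

/-- The Fock space, the Hilbert direct sum of the `n`-particle spaces. -/
abbrev FockSpace (ρ : (n : ℕ) → weylGroupB n →* (TensorPower ι n →L[ℂ] TensorPower ι n)) : Type _ :=
  lp (fun n => particleSpace ρ n) 2

/-- The finite particle space. -/
def finiteParticle (ρ : (n : ℕ) → weylGroupB n →* (TensorPower ι n →L[ℂ] TensorPower ι n)) :
    Submodule ℂ (FockSpace ρ) where
  carrier := {v | ∃ N : ℕ, ∀ n, N ≤ n → v n = 0}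
  add_mem' := by
    rintro v w ⟨N, hN⟩ ⟨M, hM⟩
    refine ⟨max N M, fun n hn => ?_⟩
    rw [lp.coeFn_add, Pi.add_apply, hN n (le_trans (le_max_left _ _) hn),
      hM n (le_trans (le_max_right _ _) hn), add_zero]
  zero_mem' := ⟨0, fun n _ => by rw [lp.coeFn_zero, Pi.zero_apply]⟩
  smul_mem' := by
    rintro c v ⟨N, hN⟩
    refine ⟨N, fun n hn => ?_⟩
    rw [lp.coeFn_smul, Pi.smul_apply, hN n hn, smul_zero]

/-- The `n`-particle component of a vector of the finite particle space. -/
def component {ρ : (n : ℕ) → weylGroupB n →* (TensorPower ι n →L[ℂ] TensorPower ι n)}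
    (v : finiteParticle ρ) (n : ℕ) : TensorPower ι n :=
  (((v : FockSpace ρ) n : particleSpace ρ n) : TensorPower ι n)

/-- The matrix
`S₀₁(χ,χ₁) S₁₂(χ,χ₂) ⋯ S₍ₙ₋₁₎ₙ(χ,χₙ) Mₙ S₍ₙ₋₁₎ₙ(χₙ,χ') ⋯ S₁₂(χ₂,χ') S₀₁(χ₁,χ')`
on `n + 1` slots. -/
def dressing (S : ℝ → ℝ → Matrix (ι × ι) (ι × ι) ℂ) (M : Matrix ι ι ℂ) (χ χ' : ℝ) {n : ℕ}
    (x : Fin n → ℝ) : Matrix (Fin (n + 1) → ι) (Fin (n + 1) → ι) ℂ :=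
  (List.ofFn fun k : Fin n => onPair k.castSucc k.succ (S χ (x k))).prod *
    onSlot (Fin.last n) M *
    (List.ofFn fun k : Fin n => onPair k.castSucc k.succ (S (x k) χ')).reverse.prod

/-- The vacuum `Ω = (1, 0, 0, …)` and the explicit action of the generators on the finite particle
space. In `creat_succ`, `u` is the tensor product of `f` with the `n`-particle component of `v`. -/
structure IsFockAction (S : ℝ → ℝ → Matrix (ι × ι) (ι × ι) ℂ) (R T : ℝ → Matrix ι ι ℂ)
    (ρ : (n : ℕ) → weylGroupB n →* (TensorPower ι n →L[ℂ] TensorPower ι n))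
    (G : Generators ι (finiteParticle ρ)) (Ω : finiteParticle ρ) : Prop where
  vacuum_zero : ∀ᵐ x, ∀ α, component Ω 0 x α = 1
  vacuum_succ : ∀ n, component Ω (n + 1) = 0
  annih : ∀ (f : ι → L2One) (v : finiteParticle ρ) (n : ℕ), ∀ᵐ x, ∀ α : Fin n → ι,
    component (G.annih f v) n x α =
      (Real.sqrt (n + 1) : ℂ) * ∫ χ : ℝ, ∑ α₀, conj (f α₀ χ) *
        component v (n + 1) (Fin.cons χ x : Fin (n + 1) → ℝ) (Fin.cons α₀ α : Fin (n + 1) → ι)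
  creat_zero : ∀ (f : ι → L2One) (v : finiteParticle ρ), component (G.creat f v) 0 = 0
  creat_succ : ∀ (f : ι → L2One) (v : finiteParticle ρ) (n : ℕ), ∃ u : TensorPower ι (n + 1),
    (∀ᵐ x, ∀ α : Fin (n + 1) → ι, u x α = f (α 0) (x 0) * component v n (Fin.tail x) (Fin.tail α)) ∧
    component (G.creat f v) (n + 1) = (Real.sqrt (n + 1) : ℂ) • fockProjection ρ (n + 1) u
  reflection : ∀ (α β : ι) (χ : ℝ) (v : finiteParticle ρ) (n : ℕ), ∀ᵐ x, ∀ γ : Fin n → ι,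
    component (G.r α β χ v) n x γ =
      ∑ δ : Fin n → ι, dressing S (R χ) χ (-χ) x (Fin.cons α γ : Fin (n + 1) → ι)
        (Fin.cons β δ : Fin (n + 1) → ι) * component v n x δ
  transmission : ∀ (α β : ι) (χ : ℝ) (v : finiteParticle ρ) (n : ℕ), ∀ᵐ x, ∀ γ : Fin n → ι,
    component (G.t α β χ v) n x γ =
      ∑ δ : Fin n → ι, dressing S (T χ) χ χ x (Fin.cons α γ : Fin (n + 1) → ι)
        (Fin.cons β δ : Fin (n + 1) → ι) * component v n x δ

end Fock

end

end RTAlgebra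

/-!
The Weyl group of type `B_n` acts on the tensor power of order `n` because it is presented by the
Coxeter relations (`IsCoxeterB.exists_hom`), and these relations are the hypotheses on `S`, `R` and
`T`: the Yang-Baxter equation is the braid relation, the reflection, transmission and mixed equations
give the relation of order four, and the unitarity conditions say that the generators are
involutions. All of this is checked on arbitrary functions, pointwise (`isCoxeterB_sWave`), and
transported to square integrable ones, where boundedness of the entries makes the operations bounded
(`Implements`). Hermitian analyticity makes the generators self-adjoint, so that the average over the
group is an orthogonal projection.

The defect operators are the blocks, with respect to an additional first slot, of the dressed
matrices. Dressing preserves the defect exchange relations (`IsExchangeFactor.dressing_defectExchange`)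
and products (`IsExchangeFactor.dressing_mul`); this gives the relations between the defect generators.
It also shows that the defect operators commute with the Weyl group
(`IsExchangeFactor.defectWave_commute`), so that they act on the Fock space. Their norms are bounded
by one, since by unitarity and Hermitian analyticity the squared norms of `t_c^b(χ) ψ` and
`r_c^b(-χ) ψ`, summed over `c`, add up to that of `ψ`.

The core of the bulk relations is the decomposition of the Weyl group of type `B_{n+1}` into the cosets
of the subgroup of type `B_n` that fixes the first basis vector `e_0` (`weylRep_mul_bijective`). Let
the projection act on a vector with a newly created first particle, and annihilate the first particle
(`annihOp_fockProj_createOp_succ`). The coset of the identity gives the delta function, the coset of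
the sign change `e_0 ↦ -e_0`, represented by the word `s_0 ⋯ s_n ⋯ s_0`, gives the dressed
transmission and reflection matrices (`flipWord_sWave`), and every other coset contains an exchange of
the first two particles, so that these cosets together give the exchanged product `a^* S a`. The factor
`1 / 2` comes from the `2 (n + 1)` cosets against the two factors `√(n + 1)`. The exchange relation of
two creation operators holds because the projection absorbs the generator `s_0`, and the relations
between creation and defect operators follow from peeling one particle off the dressed matrices
(`defectWave_createWave`). The remaining relations are Hermitian conjugates of these.

The products of bulk generators have to be smeared with all square integrable functions of two
variables. They are given by integral kernels, bounded by the Cauchy-Schwarz inequality (`kernelL`).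
The vacuum is cyclic, because a vector orthogonal to everything created from it is mapped to zero by
all annihilation operators, and these are jointly injective (`eq_zero_of_inner_createOp`). Finally,
scaling the bulk generators with `√(4 π)` multiplies the delta functions by `4 π`
(`IsFockRepresentation.scale`), which turns `1 / 2` into `2 π`.
-/

namespace RTAlgebra

open MeasureTheory
open scoped ENNReal Kronecker Matrix ComplexConjugate InnerProductSpace

noncomputable section

set_option linter.unusedSectionVars false

/-! ### The Weyl group of type `B`: coset representatives and presentation -/

/-- The defining relations of the Coxeter group of type `B_n`, for a family `s` of elements of a
monoid: involutivity, commutation of distant generators, the braid relation for neighbours, and the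
relation of order four for the last two generators. -/
structure IsCoxeterB {M : Type*} [Monoid M] (n : ℕ) (s : Fin n → M) : Prop where
  sq : ∀ i, s i * s i = 1
  comm : ∀ i j : Fin n, (i : ℕ) + 1 < j → s i * s j = s j * s i
  braid : ∀ i j : Fin n, (i : ℕ) + 1 = j → (j : ℕ) + 1 < n → s i * s j * s i = s j * s i * s j
  quad : ∀ i j : Fin n, (i : ℕ) + 1 = j → (j : ℕ) + 1 = n →
    s i * s j * s i * s j = s j * s i * s j * s i

theorem IsCoxeterB.tail {M : Type*} [Monoid M] {n : ℕ} {s : Fin (n + 1) → M}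
    (h : IsCoxeterB (n + 1) s) : IsCoxeterB n (fun i => s i.succ) where
  sq i := h.sq _
  comm i j hij := h.comm _ _ (by simpa using hij)
  braid i j hij hj := h.braid _ _ (by simpa using hij) (by simpa using hj)
  quad i j hij hj := h.quad _ _ (by simpa using hij) (by simpa using hj)

/-- The word `s₀ s₁ ⋯ s_n ⋯ s₁ s₀`, which represents the sign change of the first basis vector. -/
def flipWord {M : Type*} [Monoid M] : (n : ℕ) → (Fin (n + 1) → M) → M
  | 0, s => s 0
  | n + 1, s => s 0 * flipWord n (fun i => s i.succ) * s 0

/-- Representatives of the left cosets of the parabolic subgroup of type `B_{n-1}` that fixes the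
first basis vector: the representative of index `(j, ε)` maps `e_0` to `ε e_j`. -/
def cosetRep {M : Type*} [Monoid M] : (n : ℕ) → (Fin n → M) → Fin n × ℤˣ → M
  | 0, _, p => p.1.elim0
  | n + 1, s, p => Fin.cases (if p.2 = 1 then 1 else flipWord n s)
      (fun j => cosetRep n (fun i => s i.succ) (j, p.2) * s 0) p.1

section CosetRep

variable {M : Type*} [Monoid M] {n : ℕ}

theorem cosetRep_zero_one (s : Fin (n + 1) → M) : cosetRep (n + 1) s (0, 1) = 1 := by
  simp [cosetRep]

theorem cosetRep_zero_neg (s : Fin (n + 1) → M) :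
    cosetRep (n + 1) s (0, -1) = flipWord n s := by
  have : (-1 : ℤˣ) ≠ 1 := by decide
  simp [cosetRep, this]

theorem cosetRep_succ (s : Fin (n + 1) → M) (j : Fin n) (ε : ℤˣ) :
    cosetRep (n + 1) s (j.succ, ε) = cosetRep n (fun i => s i.succ) (j, ε) * s 0 := rfl

theorem map_flipWord {N : Type*} [Monoid N] (f : M →* N) :
    ∀ {n : ℕ} (s : Fin (n + 1) → M), f (flipWord n s) = flipWord n (fun i => f (s i))
  | 0, s => rfl
  | n + 1, s => by simp only [flipWord, map_mul, map_flipWord f]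

theorem map_cosetRep {N : Type*} [Monoid N] (f : M →* N) :
    ∀ {n : ℕ} (s : Fin n → M) (p : Fin n × ℤˣ),
      f (cosetRep n s p) = cosetRep n (fun i => f (s i)) p
  | 0, s, p => p.1.elim0
  | n + 1, s, (j, ε) => by
    refine Fin.cases ?_ (fun j => ?_) j
    · rcases Int.units_eq_one_or ε with rfl | rfl
      · simp only [cosetRep_zero_one, map_one]
      · simp only [cosetRep_zero_neg, map_flipWord]
    · simp only [cosetRep_succ, map_mul, map_cosetRep f]

theorem Commute.flipWord_right {x : M} :
    ∀ {n : ℕ} {s : Fin (n + 1) → M}, (∀ i, Commute x (s i)) → Commute x (flipWord n s)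
  | 0, _, h => h 0
  | _ + 1, _, h => ((h 0).mul_right (Commute.flipWord_right fun i => h i.succ)).mul_right (h 0)

theorem Commute.cosetRep_right {x : M} :
    ∀ {n : ℕ} {s : Fin n → M}, (∀ i, Commute x (s i)) → ∀ p, Commute x (cosetRep n s p)
  | 0, _, _, p => p.1.elim0
  | n + 1, s, h, (j, ε) => by
    refine Fin.cases ?_ (fun j => ?_) j
    · rcases Int.units_eq_one_or ε with rfl | rfl
      · rw [cosetRep_zero_one]; exact Commute.one_right x
      · rw [cosetRep_zero_neg]; exact Commute.flipWord_right h
    · rw [cosetRep_succ]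
      exact (Commute.cosetRep_right (fun i => h i.succ) _).mul_right (h 0)

theorem IsCoxeterB.commute_zero {s : Fin (n + 2) → M} (h : IsCoxeterB (n + 2) s) (i : Fin n) :
    Commute (s 0) (s i.succ.succ) :=
  h.comm 0 i.succ.succ (by simp)

theorem IsCoxeterB.commute_flipWord :
    ∀ {n : ℕ} {s : Fin (n + 1) → M}, IsCoxeterB (n + 1) s → ∀ i : Fin n,
      Commute (s i.succ) (flipWord n s)
  | 0, _, _, i => i.elim0
  | n + 1, s, h, i => by
    refine Fin.cases ?_ (fun i => ?_) i
    · rcases n with _ | n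
      · have := h.quad 0 1 rfl rfl
        simp only [Commute, SemiconjBy, flipWord]
        simp only [mul_assoc] at this ⊢
        exact this.symm
      · have hF := Commute.flipWord_right (x := s 0) (s := fun i => s i.succ.succ)
          fun i => h.commute_zero i
        have hb : s 0 * s 1 * s 0 = s 1 * s 0 * s 1 := h.braid 0 1 rfl (by simp)
        change s 1 * (s 0 * (s 1 * flipWord n _ * s 1) * s 0) =
          s 0 * (s 1 * flipWord n _ * s 1) * s 0 * s 1
        generalize flipWord n (fun i => s i.succ.succ) = F at hF
        calc s 1 * (s 0 * (s 1 * F * s 1) * s 0) = s 1 * s 0 * s 1 * F * s 1 * s 0 := by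
              simp only [mul_assoc]
          _ = s 0 * s 1 * (s 0 * F) * s 1 * s 0 := by rw [← hb]; simp only [mul_assoc]
          _ = s 0 * s 1 * F * (s 0 * s 1 * s 0) := by rw [hF.eq]; simp only [mul_assoc]
          _ = _ := by rw [hb]; simp only [mul_assoc]
    · have h1 := (h.commute_zero i).symm
      have h2 := IsCoxeterB.commute_flipWord h.tail i
      exact (h1.mul_right h2).mul_right h1

/-- Left multiplication by a generator permutes the coset representatives up to generators of the
parabolic subgroup on the right. -/
theorem IsCoxeterB.mul_cosetRep :
    ∀ {n : ℕ} {s : Fin (n + 1) → M}, IsCoxeterB (n + 1) s →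
      ∀ (i : Fin (n + 1)) (p : Fin (n + 1) × ℤˣ),
      (∃ q, s i * cosetRep (n + 1) s p = cosetRep (n + 1) s q) ∨
      ∃ k : Fin n, s i * cosetRep (n + 1) s p = cosetRep (n + 1) s p * s k.succ
  | 0, s, h, i, (j, ε) => by
    left
    obtain rfl : i = 0 := Fin.fin_one_eq_zero i
    obtain rfl : j = 0 := Fin.fin_one_eq_zero j
    rcases Int.units_eq_one_or ε with rfl | rfl
    · exact ⟨(0, -1), by rw [cosetRep_zero_one, cosetRep_zero_neg, mul_one]; rfl⟩
    · exact ⟨(0, 1), by rw [cosetRep_zero_one, cosetRep_zero_neg]; exact h.sq 0⟩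
  | n + 1, s, h, i, (j, ε) => by
    refine Fin.cases ?_ (fun i => ?_) i
    · refine Fin.cases ?_ (fun j => ?_) j
      · rcases Int.units_eq_one_or ε with rfl | rfl
        · refine Or.inl ⟨(Fin.succ 0, 1), ?_⟩
          rw [cosetRep_succ, cosetRep_zero_one, cosetRep_zero_one, one_mul, mul_one]
        · refine Or.inl ⟨(Fin.succ 0, -1), ?_⟩
          rw [cosetRep_succ, cosetRep_zero_neg, cosetRep_zero_neg, flipWord, ← mul_assoc,
            ← mul_assoc, h.sq, one_mul]
      · refine Fin.cases ?_ (fun j => ?_) j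
        · rcases Int.units_eq_one_or ε with rfl | rfl
          · refine Or.inl ⟨(0, 1), ?_⟩
            rw [cosetRep_succ, cosetRep_zero_one, cosetRep_zero_one, one_mul, h.sq]
          · refine Or.inl ⟨(0, -1), ?_⟩
            rw [cosetRep_succ, cosetRep_zero_neg, cosetRep_zero_neg, flipWord, ← mul_assoc]
        · rcases n with _ | n
          · exact j.elim0
          refine Or.inr ⟨0, ?_⟩
          rw [cosetRep_succ, cosetRep_succ]
          have hF := Commute.cosetRep_right (x := s 0) (s := fun i => s i.succ.succ)
            (fun i => h.commute_zero i) (j, ε)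
          have hb : s 0 * s 1 * s 0 = s 1 * s 0 * s 1 := h.braid 0 1 rfl (by simp)
          change s 0 * (cosetRep _ _ _ * s 1 * s 0) = cosetRep _ _ _ * s 1 * s 0 * s 1
          rw [mul_assoc _ (s 1), ← mul_assoc, hF.eq, mul_assoc, ← mul_assoc (s 0), hb]
          simp only [mul_assoc]
    · refine Fin.cases ?_ (fun j => ?_) j
      · refine Or.inr ⟨i, ?_⟩
        rcases Int.units_eq_one_or ε with rfl | rfl
        · rw [cosetRep_zero_one, one_mul, mul_one]
        · rw [cosetRep_zero_neg]; exact h.commute_flipWord i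
      · rcases IsCoxeterB.mul_cosetRep h.tail i (j, ε) with ⟨q, hq⟩ | ⟨k, hk⟩
        · refine Or.inl ⟨(q.1.succ, q.2), ?_⟩
          rw [cosetRep_succ, cosetRep_succ, ← mul_assoc, hq]
        · refine Or.inr ⟨k.succ, ?_⟩
          rw [cosetRep_succ, ← mul_assoc, hk, mul_assoc, mul_assoc, (h.commute_zero k).eq]

end CosetRep

/-! #### The concrete reflections -/

theorem simpleReflection_of_lt {n : ℕ} (i : Fin n) (h : (i : ℕ) + 1 < n) :
    simpleReflection n i = (Equiv.swap i ⟨i + 1, h⟩).prodCongr (Equiv.refl ℤˣ) := dif_pos h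

theorem simpleReflection_of_eq {n : ℕ} (i : Fin n) (h : (i : ℕ) + 1 = n) :
    simpleReflection n i = Equiv.swap (i, 1) (i, -1) := dif_neg (by omega)

theorem isCoxeterB_simpleReflection (n : ℕ) : IsCoxeterB n (simpleReflection n) where
  sq i := by
    by_cases h : (i : ℕ) + 1 < n
    · rw [simpleReflection_of_lt i h]; ext x <;> simp
    · rw [simpleReflection_of_eq i (by omega), Equiv.swap_mul_self]
  comm i j hij := by
    rw [simpleReflection_of_lt i (by omega)]
    by_cases h : (j : ℕ) + 1 < n
    · rw [simpleReflection_of_lt j h]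
      refine Equiv.ext fun x => Prod.ext ?_ rfl
      have : Equiv.Perm.Disjoint (Equiv.swap i ⟨i + 1, by omega⟩) (Equiv.swap j ⟨j + 1, h⟩) := by
        refine Equiv.Perm.disjoint_swap_swap ?_
        simp [Fin.ext_iff]; omega
      exact Equiv.congr_fun this.commute.eq x.1
    · rw [simpleReflection_of_eq j (by omega), Equiv.mul_swap_eq_swap_mul]
      have h1 : j ≠ i := by rintro rfl; omega
      have h2 : j ≠ ⟨i + 1, by omega⟩ := by rw [Ne, Fin.ext_iff]; simp; omega
      simp [Equiv.swap_apply_of_ne_of_ne h1 h2]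
  braid i j hij hj := by
    rw [simpleReflection_of_lt i (by omega), simpleReflection_of_lt j hj]
    refine Equiv.ext fun x => Prod.ext ?_ rfl
    have hj' : (⟨i + 1, by omega⟩ : Fin n) = j := Fin.ext hij
    rw [hj']
    have e : Equiv.swap i j * Equiv.swap j ⟨j + 1, hj⟩ * Equiv.swap i j =
        Equiv.swap j ⟨j + 1, hj⟩ * Equiv.swap i j * Equiv.swap j ⟨j + 1, hj⟩ := by
      have h1 : i ≠ j := by rw [Ne, Fin.ext_iff]; omega
      have h2 : j ≠ ⟨j + 1, hj⟩ := by rw [Ne, Fin.ext_iff]; simp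
      have h3 : i ≠ ⟨j + 1, hj⟩ := by rw [Ne, Fin.ext_iff]; simp; omega
      rw [Equiv.swap_mul_swap_mul_swap h1 h3, Equiv.swap_comm i j,
        Equiv.swap_comm j ⟨j + 1, hj⟩, Equiv.swap_mul_swap_mul_swap h2.symm h3.symm,
        Equiv.swap_comm]
    exact Equiv.congr_fun e x.1
  quad i j hij hj := by
    rw [simpleReflection_of_lt i (by omega), simpleReflection_of_eq j hj]
    have hj' : (⟨i + 1, by omega⟩ : Fin n) = j := Fin.ext hij
    rw [hj']
    have h1 : j ≠ i := by rw [Ne, Fin.ext_iff]; omega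
    set t' : Equiv.Perm (Fin n × ℤˣ) := Equiv.swap (i, 1) (i, -1) with ht'
    set t : Equiv.Perm (Fin n × ℤˣ) := Equiv.swap (j, 1) (j, -1) with ht
    set σ : Equiv.Perm (Fin n × ℤˣ) := (Equiv.swap i j).prodCongr (Equiv.refl ℤˣ) with hσ
    have h2 : σ * t = t' * σ := by rw [ht, Equiv.mul_swap_eq_swap_mul]; simp [hσ, ht']
    have h3 : t * t' = t' * t := by
      rw [ht', Equiv.mul_swap_eq_swap_mul, ht, Equiv.swap_apply_of_ne_of_ne,
        Equiv.swap_apply_of_ne_of_ne] <;> simp [h1.symm]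
    have h4 : σ * σ = 1 := by ext x <;> simp [hσ]
    calc σ * t * σ * t = t' * (σ * σ) * t := by rw [h2]; simp only [mul_assoc]
      _ = t * t' * (σ * σ) := by rw [h4, mul_one, mul_one, h3]
      _ = t * (σ * t) * σ := by rw [h2]; simp only [mul_assoc]
      _ = _ := by simp only [mul_assoc]

theorem isCoxeterB_weylGen (n : ℕ) : IsCoxeterB n (weylGen n) where
  sq i := Subtype.ext ((isCoxeterB_simpleReflection n).sq i)
  comm i j hij := Subtype.ext ((isCoxeterB_simpleReflection n).comm i j hij)
  braid i j hij hj := Subtype.ext ((isCoxeterB_simpleReflection n).braid i j hij hj)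
  quad i j hij hj := Subtype.ext ((isCoxeterB_simpleReflection n).quad i j hij hj)

/-- Every property of the Weyl group that holds for the identity and is preserved by left
multiplication with generators holds everywhere. -/
theorem weylGroupB_induction {n : ℕ} {p : weylGroupB n → Prop} (one : p 1)
    (mul : ∀ i g, p g → p (weylGen n i * g)) (g : weylGroupB n) : p g := by
  obtain ⟨g, hg⟩ := g
  induction hg using Subgroup.closure_induction_left with
  | one => exact one
  | mul_left x hx y hy ih =>
    obtain ⟨i, rfl⟩ := hx
    exact mul i ⟨y, hy⟩ ih
  | inv_mul_cancel x hx y hy ih =>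
    obtain ⟨i, rfl⟩ := hx
    have h : (simpleReflection n i)⁻¹ = simpleReflection n i :=
      inv_eq_of_mul_eq_one_left ((isCoxeterB_simpleReflection n).sq i)
    have := mul i ⟨y, hy⟩ ih
    have e : ∀ hz, (⟨(simpleReflection n i)⁻¹ * y, hz⟩ : weylGroupB n) = weylGen n i * ⟨y, hy⟩ :=
      fun _ => Subtype.ext (congrArg (· * y) h)
    exact (congrArg p (e _)).mpr this

/-- The embedding of the short roots `± e_j` that shifts the index. -/
def shiftRoot (n : ℕ) : Fin n × ℤˣ ↪ Fin (n + 1) × ℤˣ :=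
  (Fin.succEmb n).prodMap (Function.Embedding.refl ℤˣ)

theorem shiftRoot_apply (n : ℕ) (p : Fin n × ℤˣ) : shiftRoot n p = (p.1.succ, p.2) := rfl

theorem viaEmbeddingHom_simpleReflection (n : ℕ) (i : Fin n) :
    Equiv.Perm.viaEmbeddingHom (shiftRoot n) (simpleReflection n i) =
      simpleReflection (n + 1) i.succ := by
  refine Equiv.ext fun ⟨j, ε⟩ => ?_
  rw [Equiv.Perm.viaEmbeddingHom_apply]
  refine Fin.cases ?_ (fun j => ?_) j
  · rw [Equiv.Perm.viaEmbedding_apply_of_notMem]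
    · by_cases h : (i : ℕ) + 1 < n
      · rw [simpleReflection_of_lt i.succ (by simpa using h)]
        simp [Equiv.swap_apply_def, Fin.ext_iff]
      · rw [simpleReflection_of_eq i.succ (by simp; omega)]
        rw [Equiv.swap_apply_of_ne_of_ne] <;> simp [Fin.ext_iff]
    · simp [shiftRoot_apply]
  · change (Equiv.Perm.viaEmbedding _ _) (shiftRoot n (j, ε)) = _
    rw [Equiv.Perm.viaEmbedding_apply]
    by_cases h : (i : ℕ) + 1 < n
    · rw [simpleReflection_of_lt i h, simpleReflection_of_lt i.succ (by simpa using h)]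
      refine Prod.ext ?_ rfl
      have : (⟨(i.succ : ℕ) + 1, by simpa using h⟩ : Fin (n + 1)) = Fin.succ ⟨i + 1, h⟩ := rfl
      simp only [shiftRoot_apply, Equiv.prodCongr_apply, Prod.map, this]
      exact ((Fin.succ_injective n).swap_apply _ _ _).symm
    · rw [simpleReflection_of_eq i (by omega), simpleReflection_of_eq i.succ (by simp; omega)]
      simp only [shiftRoot_apply, Equiv.swap_apply_def]
      split_ifs <;> simp_all

/-- The embedding of the Weyl group of type `B_n` into that of type `B_{n+1}` as the parabolic
subgroup fixing the first basis vector. -/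
def weylShift (n : ℕ) : weylGroupB n →* weylGroupB (n + 1) :=
  ((Equiv.Perm.viaEmbeddingHom (shiftRoot n)).comp (weylGroupB n).subtype).codRestrict _ fun g => by
    refine weylGroupB_induction (p := fun g => _ ∈ weylGroupB (n + 1)) ?_ (fun i g hg => ?_) g
    · rw [map_one]; exact one_mem _
    · rw [map_mul]
      refine mul_mem ?_ hg
      change Equiv.Perm.viaEmbeddingHom _ (simpleReflection n i) ∈ _
      rw [viaEmbeddingHom_simpleReflection]
      exact Subgroup.subset_closure ⟨i.succ, rfl⟩

theorem weylShift_weylGen (n : ℕ) (i : Fin n) :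
    weylShift n (weylGen n i) = weylGen (n + 1) i.succ :=
  Subtype.ext (viaEmbeddingHom_simpleReflection n i)

theorem weylShift_injective (n : ℕ) : Function.Injective (weylShift n) := fun _ _ hgh =>
  Subtype.ext (Equiv.Perm.viaEmbeddingHom_injective (shiftRoot n) (congrArg Subtype.val hgh))

theorem weylShift_apply_zero (n : ℕ) (g : weylGroupB n) (ε : ℤˣ) :
    (weylShift n g : Equiv.Perm (Fin (n + 1) × ℤˣ)) (0, ε) = (0, ε) := by
  change Equiv.Perm.viaEmbeddingHom (shiftRoot n) g (0, ε) = _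
  rw [Equiv.Perm.viaEmbeddingHom_apply, Equiv.Perm.viaEmbedding_apply_of_notMem]
  simp [shiftRoot_apply]

theorem weylShift_apply_succ (n : ℕ) (g : weylGroupB n) (j : Fin n) (ε : ℤˣ) :
    (weylShift n g : Equiv.Perm (Fin (n + 1) × ℤˣ)) (j.succ, ε) =
      (((g : Equiv.Perm (Fin n × ℤˣ)) (j, ε)).1.succ, ((g : Equiv.Perm (Fin n × ℤˣ)) (j, ε)).2) := by
  change Equiv.Perm.viaEmbeddingHom (shiftRoot n) g (shiftRoot n (j, ε)) = _
  rw [Equiv.Perm.viaEmbeddingHom_apply, Equiv.Perm.viaEmbedding_apply]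
  rfl

/-- The coset representatives in the Weyl group itself. -/
def weylRep (n : ℕ) (p : Fin n × ℤˣ) : weylGroupB n := cosetRep n (weylGen n) p

theorem weylRep_succ (n : ℕ) (j : Fin n) (ε : ℤˣ) :
    weylRep (n + 1) (j.succ, ε) = weylShift n (weylRep n (j, ε)) * weylGen (n + 1) 0 := by
  simp only [weylRep, cosetRep_succ, map_cosetRep, weylShift_weylGen]

theorem weylGen_zero_apply (n : ℕ) (ε : ℤˣ) :
    (weylGen (n + 2) 0 : Equiv.Perm (Fin (n + 2) × ℤˣ)) (0, ε) = (1, ε) := by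
  change simpleReflection (n + 2) 0 (0, ε) = _
  rw [simpleReflection_of_lt _ (by simp)]
  refine Prod.ext ?_ rfl
  exact Equiv.swap_apply_left _ _

theorem flipWord_weylGen_apply : ∀ n : ℕ,
    ((flipWord n (weylGen (n + 1)) : weylGroupB (n + 1)) : Equiv.Perm (Fin (n + 1) × ℤˣ)) (0, 1) =
      (0, -1)
  | 0 => by
    change simpleReflection 1 0 (0, 1) = _
    rw [simpleReflection_of_eq _ rfl, Equiv.swap_apply_left]
  | n + 1 => by
    have : (fun i : Fin (n + 1) => weylGen (n + 2) i.succ) =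
        fun i => weylShift (n + 1) (weylGen (n + 1) i) := by
      funext i; rw [weylShift_weylGen]
    have h0 : ((weylGen (n + 2) 0 : weylGroupB (n + 2)) : Equiv.Perm (Fin (n + 2) × ℤˣ)) (1, -1) =
        (0, -1) := by
      rw [← weylGen_zero_apply, ← Equiv.Perm.mul_apply, ← Subgroup.coe_mul,
        (isCoxeterB_weylGen (n + 2)).sq]
      rfl
    rw [flipWord, this, ← map_flipWord, Subgroup.coe_mul, Subgroup.coe_mul, Equiv.Perm.mul_apply,
      Equiv.Perm.mul_apply, weylGen_zero_apply, ← Fin.succ_zero_eq_one, weylShift_apply_succ,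
      flipWord_weylGen_apply n]
    exact h0

/-- The representatives lie in different cosets, as they map the first basis vector differently. -/
theorem weylRep_apply (n : ℕ) (p : Fin (n + 1) × ℤˣ) :
    (weylRep (n + 1) p : Equiv.Perm (Fin (n + 1) × ℤˣ)) (0, 1) = p := by
  induction n with
  | zero =>
    obtain ⟨j, ε⟩ := p
    obtain rfl : j = 0 := Fin.fin_one_eq_zero j
    rcases Int.units_eq_one_or ε with rfl | rfl
    · rw [weylRep, cosetRep_zero_one]; rfl
    · rw [weylRep, cosetRep_zero_neg, flipWord_weylGen_apply]
  | succ n ih =>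
    obtain ⟨j, ε⟩ := p
    refine Fin.cases ?_ (fun j => ?_) j
    · rcases Int.units_eq_one_or ε with rfl | rfl
      · rw [weylRep, cosetRep_zero_one]; rfl
      · rw [weylRep, cosetRep_zero_neg, flipWord_weylGen_apply]
    · rw [weylRep_succ, Subgroup.coe_mul, Equiv.Perm.mul_apply, weylGen_zero_apply,
        ← Fin.succ_zero_eq_one, weylShift_apply_succ, ih]

/-- The coset decomposition of the Weyl group. -/
theorem weylRep_mul_bijective (n : ℕ) : Function.Bijective
    fun q : (Fin (n + 1) × ℤˣ) × weylGroupB n => weylRep (n + 1) q.1 * weylShift n q.2 := by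
  constructor
  · rintro ⟨p, g⟩ ⟨q, h⟩ hpq
    have hpq' : weylRep (n + 1) p * weylShift n g = weylRep (n + 1) q * weylShift n h := hpq
    have h1 := congrArg (fun g : weylGroupB (n + 1) => (g : Equiv.Perm (Fin (n + 1) × ℤˣ)) (0, 1))
      hpq'
    simp only [Subgroup.coe_mul, Equiv.Perm.mul_apply, weylShift_apply_zero, weylRep_apply] at h1
    subst h1
    rw [weylShift_injective n (mul_left_cancel hpq')]
  · refine weylGroupB_induction ⟨((0, 1), 1), ?_⟩ ?_
    · change cosetRep _ _ _ * _ = _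
      rw [cosetRep_zero_one, map_one, one_mul]
    · rintro i _ ⟨⟨p, g⟩, rfl⟩
      rcases (isCoxeterB_weylGen (n + 1)).mul_cosetRep i p with ⟨q, hq⟩ | ⟨k, hk⟩
      · refine ⟨(q, g), ?_⟩
        change cosetRep _ _ _ * _ = _ * (cosetRep _ _ _ * _)
        rw [← mul_assoc, hq]
      · refine ⟨(p, weylGen n k * g), ?_⟩
        change cosetRep _ _ _ * _ = _ * (cosetRep _ _ _ * _)
        rw [← mul_assoc, hk, map_mul, weylShift_weylGen, mul_assoc]

instance (n : ℕ) : Finite (weylGroupB n) := Subtype.finite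

theorem card_weylGroupB : ∀ n : ℕ, Nat.card (weylGroupB n) = 2 ^ n * n.factorial
  | 0 => by
    have : Subsingleton (weylGroupB 0) := ⟨fun g h => Subtype.ext (Equiv.ext fun x => x.1.elim0)⟩
    simp [Nat.card_unique]
  | n + 1 => by
    rw [← Nat.card_eq_of_bijective _ (weylRep_mul_bijective n), Nat.card_prod, Nat.card_prod,
      card_weylGroupB n, Nat.card_eq_fintype_card, Nat.card_eq_fintype_card, Fintype.card_fin,
      Fintype.card_units_int, Nat.factorial_succ]
    ring

theorem IsCoxeterB.prod {M N : Type*} [Monoid M] [Monoid N] {n : ℕ} {s : Fin n → M} {t : Fin n → N}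
    (hs : IsCoxeterB n s) (ht : IsCoxeterB n t) : IsCoxeterB n fun i => (s i, t i) where
  sq i := Prod.ext (hs.sq i) (ht.sq i)
  comm i j hij := Prod.ext (hs.comm i j hij) (ht.comm i j hij)
  braid i j hij hj := Prod.ext (hs.braid i j hij hj) (ht.braid i j hij hj)
  quad i j hij hj := Prod.ext (hs.quad i j hij hj) (ht.quad i j hij hj)

/-- The relations of type `B_n` present the Weyl group: a family of elements of a monoid that
satisfies them extends to a homomorphism. In the product of the Weyl group with the monoid, the
submonoid generated by the pairs of generators is the graph of a function, by the normal form
given by the coset representatives. -/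
theorem IsCoxeterB.exists_hom {M : Type*} [Monoid M] :
    ∀ {n : ℕ} {s : Fin n → M}, IsCoxeterB n s →
      ∃ ρ : weylGroupB n →* M, ∀ i, ρ (weylGen n i) = s i
  | 0, _, _ => ⟨1, fun i => i.elim0⟩
  | n + 1, s, h => by
    obtain ⟨ρ', hρ'⟩ := IsCoxeterB.exists_hom h.tail
    have hp := (isCoxeterB_weylGen (n + 1)).prod h
    set s' : Fin (n + 1) → weylGroupB (n + 1) × M := fun i => (weylGen (n + 1) i, s i) with hs'
    have key : ∀ z ∈ Submonoid.closure (Set.range s'), ∃ p g,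
        z = cosetRep (n + 1) s' p * (weylShift n g, ρ' g) := by
      intro z hz
      induction hz using Submonoid.closure_induction_left with
      | one => exact ⟨(0, 1), 1, by rw [cosetRep_zero_one, map_one, map_one, one_mul]; rfl⟩
      | mul_left x hx y hy ih =>
        obtain ⟨i, rfl⟩ := hx
        obtain ⟨p, g, rfl⟩ := ih
        rcases hp.mul_cosetRep i p with ⟨q, hq⟩ | ⟨k, hk⟩
        · exact ⟨q, g, by rw [← mul_assoc, hq]⟩
        · refine ⟨p, weylGen n k * g, ?_⟩
          rw [← mul_assoc, hk, mul_assoc, map_mul, map_mul, weylShift_weylGen, hρ']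
          rfl
    have uniq : ∀ z ∈ Submonoid.closure (Set.range s'), ∀ w ∈ Submonoid.closure (Set.range s'),
        z.1 = w.1 → z.2 = w.2 := by
      intro z hz w hw hzw
      obtain ⟨p, g, rfl⟩ := key z hz
      obtain ⟨q, k, rfl⟩ := key w hw
      have hc : ∀ p, (cosetRep (n + 1) s' p).1 = weylRep (n + 1) p := fun p =>
        map_cosetRep (MonoidHom.fst (weylGroupB (n + 1)) M) s' p
      rw [Prod.fst_mul, Prod.fst_mul, hc, hc] at hzw
      have := (weylRep_mul_bijective n).1 (a₁ := (p, g)) (a₂ := (q, k)) hzw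
      rw [Prod.mk.injEq] at this
      rw [this.1, this.2]
    have ex : ∀ g : weylGroupB (n + 1), ∃ m, (g, m) ∈ Submonoid.closure (Set.range s') := by
      refine weylGroupB_induction ⟨1, one_mem _⟩ ?_
      rintro i g ⟨m, hm⟩
      have hi : s' i ∈ Submonoid.closure (Set.range s') := Submonoid.subset_closure ⟨i, rfl⟩
      exact ⟨s i * m, mul_mem hi hm⟩
    choose f hf using ex
    exact ⟨{ toFun := f
             map_one' := uniq _ (hf 1) _ (one_mem _) rfl
             map_mul' := fun g k => uniq _ (hf (g * k)) _ (mul_mem (hf g) (hf k)) rfl },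
      fun i => uniq _ (hf _) _ (Submonoid.subset_closure ⟨i, rfl⟩) rfl⟩

/-! ### Matrices on tensor powers -/

section Slots

variable {ι : Type*} [Fintype ι] [DecidableEq ι] {m n : ℕ}

/-- The matrix `A` on `m` slots acting on the slots selected by the map `e`, identically on the
others. -/
def onSlots (e : Fin m → Fin n) (A : Matrix (Fin m → ι) (Fin m → ι) ℂ) :
    Matrix (Fin n → ι) (Fin n → ι) ℂ :=
  fun α β => if ∀ k, k ∉ Set.range e → α k = β k then A (α ∘ e) (β ∘ e) else 0

theorem onSlots_apply (e : Fin m → Fin n) (A : Matrix (Fin m → ι) (Fin m → ι) ℂ)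
    (α β : Fin n → ι) : onSlots e A α β =
      if ∀ k, k ∉ Set.range e → α k = β k then A (α ∘ e) (β ∘ e) else 0 := rfl

theorem onSlots_mul {e : Fin m → Fin n} (he : Function.Injective e)
    (A B : Matrix (Fin m → ι) (Fin m → ι) ℂ) :
    onSlots e (A * B) = onSlots e A * onSlots e B := by
  ext α γ
  rw [Matrix.mul_apply, onSlots_apply]
  have hext : ∀ β : Fin m → ι, Function.extend e β α ∘ e = β := fun β =>
    funext fun i => he.extend_apply _ _ _
  split_ifs with h
  · rw [Matrix.mul_apply]
    refine Finset.sum_of_injOn (fun β => Function.extend e β α) ?_ (fun _ _ => by simp) ?_ ?_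
    · intro β _ β' _ hb
      rw [← hext β, ← hext β']
      exact congrArg (· ∘ e) hb
    · intro β _ hβ
      rw [onSlots_apply]
      split_ifs with h'
      · refine absurd ⟨β ∘ e, by simp, funext fun k => ?_⟩ hβ
        by_cases hk : k ∈ Set.range e
        · obtain ⟨i, rfl⟩ := hk
          exact he.extend_apply _ _ _
        · change Function.extend _ _ _ k = _
          rw [Function.extend_apply' _ _ _ hk, h' k hk]
      · rw [zero_mul]
    · intro β _
      rw [onSlots_apply, onSlots_apply, if_pos, if_pos, hext]
      · intro k hk
        rw [Function.extend_apply' _ _ _ hk, h k hk]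
      · intro k hk
        rw [Function.extend_apply' _ _ _ hk]
  · symm
    refine Finset.sum_eq_zero fun β _ => ?_
    rw [onSlots_apply, onSlots_apply]
    split_ifs with h1 h2
    · exact absurd (fun k hk => (h1 k hk).trans (h2 k hk)) h
    all_goals simp

theorem onSlots_onPair (e : Fin m → Fin n) (i j : Fin m) (he : Function.Injective e)
    (M : Matrix (ι × ι) (ι × ι) ℂ) : onSlots e (onPair i j M) = onPair (e i) (e j) M := by
  ext α β
  rw [onSlots_apply, onPair, onPair]
  have : (∀ k, k ≠ e i → k ≠ e j → α k = β k) ↔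
      (∀ k, k ∉ Set.range e → α k = β k) ∧
        ∀ k, k ≠ i → k ≠ j → (α ∘ e) k = (β ∘ e) k := by
    constructor
    · intro h
      refine ⟨fun k hk => h k ?_ ?_, fun k h1 h2 => h (e k) (he.ne h1) (he.ne h2)⟩
      · rintro rfl; exact hk ⟨i, rfl⟩
      · rintro rfl; exact hk ⟨j, rfl⟩
    · rintro ⟨h1, h2⟩ k hi hj
      by_cases hk : k ∈ Set.range e
      · obtain ⟨k, rfl⟩ := hk
        exact h2 k (fun h => hi (h ▸ rfl)) (fun h => hj (h ▸ rfl))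
      · exact h1 k hk
  by_cases h1 : ∀ k, k ∉ Set.range e → α k = β k
  · by_cases h2 : ∀ k, k ≠ i → k ≠ j → (α ∘ e) k = (β ∘ e) k
    · rw [if_pos h1, if_pos h2, if_pos (this.2 ⟨h1, h2⟩)]; rfl
    · rw [if_pos h1, if_neg h2, if_neg fun h => h2 (this.1 h).2]
  · rw [if_neg h1, if_neg fun h => h1 (this.1 h).1]

/-- A two-slot matrix acting on the first two slots. -/
def headPair (n : ℕ) (M : Matrix (ι × ι) (ι × ι) ℂ) :
    Matrix (Fin (n + 2) → ι) (Fin (n + 2) → ι) ℂ :=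
  onPair 0 1 M

theorem headPair_cons (M : Matrix (ι × ι) (ι × ι) ℂ) (a b a' b' : ι) (γ γ' : Fin n → ι) :
    headPair n M (Fin.cons a (Fin.cons b γ : Fin (n + 1) → ι))
      (Fin.cons a' (Fin.cons b' γ' : Fin (n + 1) → ι)) =
      M (a, b) (a', b') * (if γ = γ' then 1 else 0) := by
  rw [headPair, onPair]
  have : (∀ k : Fin (n + 2), k ≠ 0 → k ≠ 1 →
      (Fin.cons a (Fin.cons b γ : Fin (n + 1) → ι) : Fin (n + 2) → ι) k =
      (Fin.cons a' (Fin.cons b' γ' : Fin (n + 1) → ι) : Fin (n + 2) → ι) k) ↔ γ = γ' := by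
    rw [Fin.forall_fin_succ, Fin.forall_fin_succ]
    simp only [ne_eq, Fin.cons_succ, Fin.succ_zero_eq_one, not_true, false_implies, true_and,
      implies_true, Fin.succ_ne_zero, not_false_eq_true, true_implies, funext_iff]
    have h1 : ∀ i : Fin n, i.succ.succ ≠ 1 := fun i => by simp [Fin.ext_iff]
    simp [h1]
  simp only [this, mul_ite, mul_one, mul_zero]
  rfl

theorem onPair_two_mul (M N : Matrix (ι × ι) (ι × ι) ℂ) :
    onPair (0 : Fin 2) 1 (M * N) = onPair 0 1 M * onPair 0 1 N := by
  have h : ∀ k : Fin 2, k ≠ 0 → k ≠ 1 → False := by decide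
  ext α β
  simp only [Matrix.mul_apply, onPair]
  rw [if_pos fun k h0 h1 => (h k h0 h1).elim]
  refine Fintype.sum_equiv (finTwoArrowEquiv ι).symm _ _ fun p => ?_
  rw [if_pos fun k h0 h1 => (h k h0 h1).elim, if_pos fun k h0 h1 => (h k h0 h1).elim]
  simp [finTwoArrowEquiv]

theorem headPair_mul (M N : Matrix (ι × ι) (ι × ι) ℂ) :
    headPair n (M * N) = headPair n M * headPair n N := by
  have he : Function.Injective (Fin.castLE (show 2 ≤ n + 2 by omega)) := Fin.castLE_injective _
  have h : ∀ M : Matrix (ι × ι) (ι × ι) ℂ,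
      headPair n M = onSlots (Fin.castLE (show 2 ≤ n + 2 by omega)) (onPair 0 1 M) := fun M => by
    rw [onSlots_onPair _ _ _ he]; rfl
  rw [h, h, h, ← onSlots_mul he, onPair_two_mul]

theorem headPair_one : headPair n (1 : Matrix (ι × ι) (ι × ι) ℂ) = 1 := by
  ext α β
  rw [← Fin.cons_self_tail α, ← Fin.cons_self_tail (Fin.tail α), ← Fin.cons_self_tail β,
    ← Fin.cons_self_tail (Fin.tail β), headPair_cons, Matrix.one_apply, Matrix.one_apply]
  simp only [Prod.mk.injEq, Fin.cons_inj]
  split_ifs <;> simp_all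

theorem headPair_conjTranspose (M : Matrix (ι × ι) (ι × ι) ℂ) :
    (headPair n M)ᴴ = headPair n Mᴴ := by
  ext α β
  rw [← Fin.cons_self_tail α, ← Fin.cons_self_tail (Fin.tail α), ← Fin.cons_self_tail β,
    ← Fin.cons_self_tail (Fin.tail β), headPair_cons, Matrix.conjTranspose_apply, headPair_cons,
    Matrix.conjTranspose_apply]
  simp only [eq_comm (a := Fin.tail (Fin.tail α))]
  split_ifs <;> simp

/-- A matrix on `n` slots acting on the last `n` of `n + 1` slots. -/
def shiftMat (A : Matrix (Fin n → ι) (Fin n → ι) ℂ) :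
    Matrix (Fin (n + 1) → ι) (Fin (n + 1) → ι) ℂ :=
  fun α β => if α 0 = β 0 then A (Fin.tail α) (Fin.tail β) else 0

theorem shiftMat_cons (A : Matrix (Fin n → ι) (Fin n → ι) ℂ) (a b : ι) (α β : Fin n → ι) :
    shiftMat A (Fin.cons a α : Fin (n + 1) → ι) (Fin.cons b β : Fin (n + 1) → ι) =
      if a = b then A α β else 0 := by
  simp [shiftMat]

theorem sum_fin_succ {M : Type*} [AddCommMonoid M] (f : (Fin (n + 1) → ι) → M) :
    ∑ α, f α = ∑ a : ι, ∑ α : Fin n → ι, f (Fin.cons a α : Fin (n + 1) → ι) := by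
  rw [← Fintype.sum_prod_type']
  exact (Fintype.sum_equiv (Fin.consEquiv fun _ => ι) _ _ fun _ => rfl).symm

theorem matrix_ext_cons {A B : Matrix (Fin (n + 1) → ι) (Fin (n + 1) → ι) ℂ}
    (h : ∀ (a b : ι) (α β : Fin n → ι), A (Fin.cons a α : Fin (n + 1) → ι)
      (Fin.cons b β : Fin (n + 1) → ι) = B (Fin.cons a α : Fin (n + 1) → ι)
      (Fin.cons b β : Fin (n + 1) → ι)) : A = B := by
  ext α β
  rw [← Fin.cons_self_tail α, ← Fin.cons_self_tail β]
  exact h _ _ _ _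

theorem shiftMat_mul (A B : Matrix (Fin n → ι) (Fin n → ι) ℂ) :
    shiftMat (A * B) = shiftMat A * shiftMat B := by
  refine matrix_ext_cons fun a b α β => ?_
  simp only [Matrix.mul_apply, sum_fin_succ, shiftMat_cons, ite_mul, zero_mul, mul_ite, mul_zero]
  rw [Finset.sum_comm]
  simp

theorem shiftMat_one : shiftMat (1 : Matrix (Fin n → ι) (Fin n → ι) ℂ) = 1 := by
  refine matrix_ext_cons fun a b α β => ?_
  simp only [shiftMat_cons, Matrix.one_apply, Fin.cons_inj]
  split_ifs <;> simp_all

theorem shiftMat_add (A B : Matrix (Fin n → ι) (Fin n → ι) ℂ) :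
    shiftMat (A + B) = shiftMat A + shiftMat B := by
  refine matrix_ext_cons fun a b α β => ?_
  simp only [shiftMat_cons, Matrix.add_apply]
  split_ifs <;> simp

theorem shiftMat_conjTranspose (A : Matrix (Fin n → ι) (Fin n → ι) ℂ) :
    (shiftMat A)ᴴ = shiftMat Aᴴ := by
  refine matrix_ext_cons fun a b α β => ?_
  simp only [shiftMat_cons, Matrix.conjTranspose_apply, eq_comm (a := a)]
  split_ifs <;> simp

/-- `shiftMat` as a homomorphism of monoids. -/
def shiftMatHom (ι : Type*) [Fintype ι] [DecidableEq ι] (n : ℕ) :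
    Matrix (Fin n → ι) (Fin n → ι) ℂ →* Matrix (Fin (n + 1) → ι) (Fin (n + 1) → ι) ℂ where
  toFun := shiftMat
  map_one' := shiftMat_one
  map_mul' := shiftMat_mul

theorem shiftMat_onPair (i j : Fin n) (M : Matrix (ι × ι) (ι × ι) ℂ) :
    shiftMat (onPair i j M) = onPair i.succ j.succ M := by
  refine matrix_ext_cons fun a b α β => ?_
  simp only [shiftMat_cons, onPair, Fin.forall_fin_succ, Fin.cons_zero, Fin.cons_succ]
  have h0 : ∀ i : Fin n, (0 : Fin (n + 1)) ≠ i.succ := fun i => (Fin.succ_ne_zero i).symm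
  simp only [ne_eq, h0, not_false_eq_true, true_implies, Fin.succ_inj, ite_and]

theorem shiftMat_onSlot (i : Fin n) (M : Matrix ι ι ℂ) :
    shiftMat (onSlot i M) = onSlot i.succ M := by
  refine matrix_ext_cons fun a b α β => ?_
  simp only [shiftMat_cons, onSlot, Fin.forall_fin_succ, Fin.cons_zero, Fin.cons_succ]
  have h0 : ∀ i : Fin n, (0 : Fin (n + 1)) ≠ i.succ := fun i => (Fin.succ_ne_zero i).symm
  simp only [ne_eq, h0, not_false_eq_true, true_implies, Fin.succ_inj, ite_and]

theorem headPair_commute (M : Matrix (ι × ι) (ι × ι) ℂ) (A : Matrix (Fin n → ι) (Fin n → ι) ℂ) :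
    headPair n M * shiftMat (shiftMat A) = shiftMat (shiftMat A) * headPair n M := by
  ext α β
  rw [← Fin.cons_self_tail α, ← Fin.cons_self_tail (Fin.tail α), ← Fin.cons_self_tail β,
    ← Fin.cons_self_tail (Fin.tail β)]
  simp only [Matrix.mul_apply, sum_fin_succ, shiftMat_cons, headPair_cons, ite_mul, zero_mul,
    mul_ite, mul_zero, mul_one, Finset.sum_ite_eq, Finset.mem_univ, if_true,
    Finset.sum_ite_irrel, Finset.sum_const_zero, Finset.sum_ite_eq']
  exact mul_comm _ _

/-- The block of a matrix on `n + 1` slots with the indices `a`, `b` in the first slot. -/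
def block (A : Matrix (Fin (n + 1) → ι) (Fin (n + 1) → ι) ℂ) (a b : ι) :
    Matrix (Fin n → ι) (Fin n → ι) ℂ :=
  fun α β => A (Fin.cons a α : Fin (n + 1) → ι) (Fin.cons b β : Fin (n + 1) → ι)

theorem block_apply (A : Matrix (Fin (n + 1) → ι) (Fin (n + 1) → ι) ℂ) (a b : ι)
    (α β : Fin n → ι) : block A a b α β =
      A (Fin.cons a α : Fin (n + 1) → ι) (Fin.cons b β : Fin (n + 1) → ι) := rfl

theorem block_mul (A B : Matrix (Fin (n + 1) → ι) (Fin (n + 1) → ι) ℂ) (a b : ι) :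
    block (A * B) a b = ∑ c, block A a c * block B c b := by
  ext α β
  simp only [Matrix.sum_apply, Matrix.mul_apply, block_apply]
  exact sum_fin_succ _

theorem block_one (a b : ι) :
    block (1 : Matrix (Fin (n + 1) → ι) (Fin (n + 1) → ι) ℂ) a b = if a = b then 1 else 0 := by
  ext α β
  simp only [block_apply, Matrix.one_apply, Fin.cons_inj]
  split_ifs <;> simp_all [Matrix.one_apply]

theorem block_shiftMat (A : Matrix (Fin n → ι) (Fin n → ι) ℂ) (a b : ι) :
    block (shiftMat A) a b = if a = b then A else 0 := by
  ext α β
  simp only [block_apply, shiftMat_cons]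
  split_ifs <;> simp_all

theorem block_block_headPair (M : Matrix (ι × ι) (ι × ι) ℂ) (a b a' b' : ι) :
    block (block (headPair n M) a a') b b' = M (a, b) (a', b') • 1 := by
  ext α β
  rw [block_apply, block_apply, headPair_cons, Matrix.smul_apply, Matrix.one_apply, smul_eq_mul]

end Slots

/-! ### The dressed defect matrices -/

section Dressing

variable {ι : Type*} [Fintype ι] [DecidableEq ι] {n : ℕ}
  {S : ℝ → ℝ → Matrix (ι × ι) (ι × ι) ℂ}

theorem dressing_zero (M : Matrix ι ι ℂ) (χ χ' : ℝ) (x : Fin 0 → ℝ) :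
    dressing S M χ χ' x = onSlot 0 M := by
  simp [dressing]

/-- Peeling off the first particle. -/
theorem dressing_succ (M : Matrix ι ι ℂ) (χ χ' : ℝ) (x : Fin (n + 1) → ℝ) :
    dressing S M χ χ' x =
      headPair n (S χ (x 0)) * shiftMat (dressing S M χ χ' (Fin.tail x)) *
        headPair n (S (x 0) χ') := by
  have hprod : ∀ f : Fin n → Matrix (Fin (n + 1) → ι) (Fin (n + 1) → ι) ℂ,
      (List.ofFn fun i => shiftMat (f i)).prod = shiftMat (List.ofFn f).prod := fun f => by
    have := map_list_prod (shiftMatHom ι (n + 1)) (List.ofFn f)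
    rw [List.map_ofFn] at this
    exact this.symm
  have hrev : ∀ f : Fin n → Matrix (Fin (n + 1) → ι) (Fin (n + 1) → ι) ℂ,
      (List.ofFn fun i => shiftMat (f i)).reverse.prod = shiftMat (List.ofFn f).reverse.prod :=
    fun f => by
      have := map_list_prod (shiftMatHom ι (n + 1)) (List.ofFn f).reverse
      rw [List.map_reverse, List.map_ofFn] at this
      exact this.symm
  have h1 : (fun i : Fin n => onPair i.succ.castSucc i.succ.succ (S χ (x i.succ))) =
      fun i => shiftMat (onPair i.castSucc i.succ (S χ (Fin.tail x i))) :=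
    funext fun i => by rw [shiftMat_onPair, Fin.succ_castSucc]; rfl
  have h2 : (fun i : Fin n => onPair i.succ.castSucc i.succ.succ (S (x i.succ) χ')) =
      fun i => shiftMat (onPair i.castSucc i.succ (S (Fin.tail x i) χ')) :=
    funext fun i => by rw [shiftMat_onPair, Fin.succ_castSucc]; rfl
  have h3 : onSlot (Fin.last (n + 1)) M = shiftMat (onSlot (Fin.last n) M) := by
    rw [shiftMat_onSlot, Fin.succ_last]
  rw [dressing, dressing, List.ofFn_succ, List.ofFn_succ, h1, h2, h3, List.prod_cons,
    List.reverse_cons, List.prod_append, List.prod_singleton, hprod, hrev, shiftMat_mul,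
    shiftMat_mul]
  simp only [mul_assoc]
  rfl

theorem dressing_cons (M : Matrix ι ι ℂ) (χ χ' z : ℝ) (x : Fin n → ℝ) :
    dressing S M χ χ' (Fin.cons z x : Fin (n + 1) → ℝ) =
      headPair n (S χ z) * shiftMat (dressing S M χ χ' x) * headPair n (S z χ') := by
  rw [dressing_succ, Fin.cons_zero, Fin.tail_cons]

theorem IsExchangeFactor.headPair_mul_cancel (hS : IsExchangeFactor S) (x y : ℝ) :
    headPair n (S x y) * headPair n (S y x) = 1 := by
  rw [← headPair_mul, hS.unitarity, headPair_one]

/-- The Yang-Baxter equation on the first three of any number of slots. -/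
theorem IsExchangeFactor.headPair_yangBaxter (hS : IsExchangeFactor S) (x y z : ℝ) :
    headPair (n + 1) (S x y) * shiftMat (headPair n (S x z)) * headPair (n + 1) (S y z) =
      shiftMat (headPair n (S y z)) * headPair (n + 1) (S x z) *
        shiftMat (headPair n (S x y)) := by
  have he : Function.Injective (Fin.castLE (show 3 ≤ n + 3 by omega)) := Fin.castLE_injective _
  have h0 : ∀ M : Matrix (ι × ι) (ι × ι) ℂ,
      headPair (n + 1) M = onSlots (Fin.castLE (show 3 ≤ n + 3 by omega)) (onPair 0 1 M) :=
    fun M => by rw [onSlots_onPair _ _ _ he]; rfl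
  have h1 : ∀ M : Matrix (ι × ι) (ι × ι) ℂ, shiftMat (headPair n M) =
      onSlots (Fin.castLE (show 3 ≤ n + 3 by omega)) (onPair 1 2 M) := fun M => by
    rw [onSlots_onPair _ _ _ he, headPair, shiftMat_onPair]; rfl
  simp only [h0, h1, ← onSlots_mul he, hS.yangBaxter]

theorem onSlot_zero_mul (M N : Matrix ι ι ℂ) :
    onSlot (0 : Fin 1) (M * N) = onSlot 0 M * onSlot 0 N := by
  ext α β
  have h : ∀ k : Fin 1, k = 0 := Fin.fin_one_eq_zero
  simp only [onSlot, Matrix.mul_apply, h, ne_eq, not_true, false_implies, implies_true, if_true]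
  exact Fintype.sum_equiv (Equiv.funUnique (Fin 1) ι).symm _ _ fun a => rfl

/-- The dressing is multiplicative when the inner spectral parameters match, because the adjacent
exchange factors cancel by unitarity. -/
theorem IsExchangeFactor.dressing_mul (hS : IsExchangeFactor S) (M N : Matrix ι ι ℂ) (x y z : ℝ) :
    ∀ {n : ℕ} (w : Fin n → ℝ),
      dressing S M x y w * dressing S N y z w = dressing S (M * N) x z w
  | 0, w => by rw [dressing_zero, dressing_zero, dressing_zero, onSlot_zero_mul]
  | n + 1, w => by
    rw [dressing_succ, dressing_succ, dressing_succ, ← hS.dressing_mul M N x y z, shiftMat_mul]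
    simp only [mul_assoc]
    rw [← mul_assoc (headPair n (S (w 0) y)), hS.headPair_mul_cancel, one_mul]

theorem IsExchangeFactor.dressing_one (hS : IsExchangeFactor S) (x : ℝ) :
    ∀ {n : ℕ} (w : Fin n → ℝ), dressing S 1 x x w = 1
  | 0, w => by
    rw [dressing_zero]
    ext α β
    have h : ∀ k : Fin 1, k = 0 := Fin.fin_one_eq_zero
    simp only [onSlot, Matrix.one_apply, h, ne_eq, not_true, false_implies, implies_true, if_true,
      funext_iff, forall_const]
  | n + 1, w => by
    rw [dressing_succ, hS.dressing_one x, shiftMat_one, mul_one, hS.headPair_mul_cancel]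

theorem dressing_add (M N : Matrix ι ι ℂ) (x y : ℝ) :
    ∀ {n : ℕ} (w : Fin n → ℝ),
      dressing S (M + N) x y w = dressing S M x y w + dressing S N x y w
  | 0, w => by
    rw [dressing_zero, dressing_zero, dressing_zero]
    ext α β
    simp only [onSlot, Matrix.add_apply]
    split_ifs <;> simp
  | n + 1, w => by
    rw [dressing_succ, dressing_succ, dressing_succ, dressing_add, shiftMat_add, mul_add, add_mul]

theorem dressing_zero_matrix (x y : ℝ) (w : Fin n → ℝ) : dressing S 0 x y w = 0 := by
  have := dressing_add (S := S) 0 0 x y w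
  rwa [add_zero, left_eq_add] at this

theorem IsExchangeFactor.dressing_conjTranspose (hS : IsExchangeFactor S) (M : Matrix ι ι ℂ)
    (x y : ℝ) : ∀ {n : ℕ} (w : Fin n → ℝ), (dressing S M x y w)ᴴ = dressing S Mᴴ y x w
  | 0, w => by
    rw [dressing_zero, dressing_zero]
    ext α β
    have h : ∀ k : Fin 1, k = 0 := Fin.fin_one_eq_zero
    simp [onSlot, Matrix.conjTranspose_apply, h]
  | n + 1, w => by
    rw [dressing_succ, dressing_succ, Matrix.conjTranspose_mul, Matrix.conjTranspose_mul,
      headPair_conjTranspose, headPair_conjTranspose, shiftMat_conjTranspose,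
      hS.dressing_conjTranspose, hS.hermitian, hS.hermitian, mul_assoc]

/-- Dressed matrices intertwine the exchange of the first two particles. -/
theorem IsExchangeFactor.dressing_exchange (hS : IsExchangeFactor S) (M : Matrix ι ι ℂ)
    (χ χ' u v : ℝ) (w : Fin n → ℝ) :
    shiftMat (headPair n (S u v)) *
        dressing S M χ χ' (Fin.cons v (Fin.cons u w : Fin (n + 1) → ℝ) : Fin (n + 2) → ℝ) =
      dressing S M χ χ' (Fin.cons u (Fin.cons v w : Fin (n + 1) → ℝ) : Fin (n + 2) → ℝ) *
        shiftMat (headPair n (S u v)) := by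
  simp only [dressing_cons, shiftMat_mul]
  have y1 := hS.headPair_yangBaxter (n := n) χ u v
  have y2 := hS.headPair_yangBaxter (n := n) u v χ'
  have c := headPair_commute (S u v) (dressing S M χ χ' w)
  generalize shiftMat (shiftMat (dressing S M χ χ' w)) = D at *
  calc _ = (shiftMat (headPair n (S u v)) * headPair (n + 1) (S χ v) *
        shiftMat (headPair n (S χ u))) * D * shiftMat (headPair n (S u χ')) *
          headPair (n + 1) (S v χ') := by simp only [mul_assoc]
    _ = headPair (n + 1) (S χ u) * shiftMat (headPair n (S χ v)) * (headPair (n + 1) (S u v) * D) *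
          shiftMat (headPair n (S u χ')) * headPair (n + 1) (S v χ') := by
        rw [← y1]; simp only [mul_assoc]
    _ = headPair (n + 1) (S χ u) * shiftMat (headPair n (S χ v)) * D *
          (headPair (n + 1) (S u v) * shiftMat (headPair n (S u χ')) *
            headPair (n + 1) (S v χ')) := by rw [c]; simp only [mul_assoc]
    _ = _ := by rw [y2]; simp only [mul_assoc]

/-- The defect exchange relation `S M S N = N S M S` between the one-slot matrices `M` and `N`, whose
incoming and outgoing spectral parameters are `x`, `x'` and `y`, `y'`. It covers the reflection, the
transmission and the mixed Yang-Baxter equations. -/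
def DefectExchange (S : ℝ → ℝ → Matrix (ι × ι) (ι × ι) ℂ) (x x' : ℝ) (M : Matrix ι ι ℂ)
    (y y' : ℝ) (N : Matrix ι ι ℂ) : Prop :=
  S x y * ((1 : Matrix ι ι ℂ) ⊗ₖ M) * S y x' * ((1 : Matrix ι ι ℂ) ⊗ₖ N) =
    ((1 : Matrix ι ι ℂ) ⊗ₖ N) * S x y' * ((1 : Matrix ι ι ℂ) ⊗ₖ M) * S y' x'

theorem headPair_one_kronecker (M : Matrix ι ι ℂ) :
    headPair 0 ((1 : Matrix ι ι ℂ) ⊗ₖ M) = shiftMat (onSlot 0 M) := by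
  refine matrix_ext_cons fun a b α β => ?_
  rw [← Fin.cons_self_tail α, ← Fin.cons_self_tail β, headPair_cons, shiftMat_cons,
    Matrix.kronecker_apply, if_pos (Subsingleton.elim _ _), mul_one, Matrix.one_apply, ite_mul,
    one_mul, zero_mul, onSlot]
  have h : ∀ k : Fin 1, k = 0 := Fin.fin_one_eq_zero
  simp [h]

/-- The defect exchange relations are inherited by the dressed matrices. -/
theorem IsExchangeFactor.dressing_defectExchange (hS : IsExchangeFactor S) {x x' y y' : ℝ}
    {M N : Matrix ι ι ℂ} (h : DefectExchange S x x' M y y' N) :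
    ∀ {n : ℕ} (w : Fin n → ℝ),
      headPair n (S x y) * shiftMat (dressing S M x x' w) * headPair n (S y x') *
          shiftMat (dressing S N y y' w) =
        shiftMat (dressing S N y y' w) * headPair n (S x y') * shiftMat (dressing S M x x' w) *
          headPair n (S y' x')
  | 0, w => by
    have := congrArg (headPair 0) h
    simpa only [headPair_mul, headPair_one_kronecker, dressing_zero] using this
  | n + 1, w => by
    have ih := congrArg shiftMat (hS.dressing_defectExchange h (Fin.tail w))
    simp only [shiftMat_mul] at ih
    simp only [dressing_succ _ _ _ w, shiftMat_mul]
    generalize w 0 = z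
    have y1 := hS.headPair_yangBaxter (n := n) y z x'
    have y2 := hS.headPair_yangBaxter (n := n) x y z
    have y3 := hS.headPair_yangBaxter (n := n) x z y'
    have y4 := hS.headPair_yangBaxter (n := n) z y' x'
    have cM := fun A => headPair_commute A (dressing S M x x' (Fin.tail w))
    have cN := fun A => headPair_commute A (dressing S N y y' (Fin.tail w))
    generalize shiftMat (shiftMat (dressing S M x x' (Fin.tail w))) = D at *
    generalize shiftMat (shiftMat (dressing S N y y' (Fin.tail w))) = G at *
    calc _ = headPair (n + 1) (S x y) * shiftMat (headPair n (S x z)) * D *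
          (shiftMat (headPair n (S z x')) * headPair (n + 1) (S y x') *
            shiftMat (headPair n (S y z))) * G * shiftMat (headPair n (S z y')) := by
          simp only [mul_assoc]
      _ = headPair (n + 1) (S x y) * shiftMat (headPair n (S x z)) *
          (D * headPair (n + 1) (S y z)) * shiftMat (headPair n (S y x')) *
            (headPair (n + 1) (S z x') * G) * shiftMat (headPair n (S z y')) := by
          rw [← y1]; simp only [mul_assoc]
      _ = (headPair (n + 1) (S x y) * shiftMat (headPair n (S x z)) * headPair (n + 1) (S y z)) *
          D * shiftMat (headPair n (S y x')) * G * headPair (n + 1) (S z x') *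
            shiftMat (headPair n (S z y')) := by
          rw [← cM, cN]; simp only [mul_assoc]
      _ = shiftMat (headPair n (S y z)) * headPair (n + 1) (S x z) *
          (shiftMat (headPair n (S x y)) * D * shiftMat (headPair n (S y x')) * G) *
            headPair (n + 1) (S z x') * shiftMat (headPair n (S z y')) := by
          rw [y2]; simp only [mul_assoc]
      _ = shiftMat (headPair n (S y z)) * (headPair (n + 1) (S x z) * G) *
          shiftMat (headPair n (S x y')) * D * (shiftMat (headPair n (S y' x')) *
            headPair (n + 1) (S z x') * shiftMat (headPair n (S z y'))) := by
          rw [ih]; simp only [mul_assoc]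
      _ = shiftMat (headPair n (S y z)) * G * headPair (n + 1) (S x z) *
          shiftMat (headPair n (S x y')) * (D * headPair (n + 1) (S z y')) *
            shiftMat (headPair n (S z x')) * headPair (n + 1) (S y' x') := by
          rw [cN, ← y4]; simp only [mul_assoc]
      _ = shiftMat (headPair n (S y z)) * G * (headPair (n + 1) (S x z) *
          shiftMat (headPair n (S x y')) * headPair (n + 1) (S z y')) * D *
            shiftMat (headPair n (S z x')) * headPair (n + 1) (S y' x') := by
          rw [← cM]; simp only [mul_assoc]
      _ = _ := by rw [y3]; simp only [mul_assoc]

end Dressing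

/-! ### Wave functions and the pointwise action of the generators -/

/-- Columns of arbitrary functions of `n` spectral parameters. All algebraic identities are proved
for them, pointwise, and transported to square integrable columns afterwards. -/
abbrev Wave (ι : Type*) (n : ℕ) : Type _ := (Fin n → ℝ) → (Fin n → ι) → ℂ

section Wave

variable {ι : Type*} [Fintype ι] [DecidableEq ι] {n : ℕ}

/-- The pull-back along `g` followed by the multiplication with the matrix-valued function `M`. -/
def genWave (M : (Fin n → ℝ) → Matrix (Fin n → ι) (Fin n → ι) ℂ)
    (g : (Fin n → ℝ) → (Fin n → ℝ)) : Module.End ℂ (Wave ι n) where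
  toFun φ x := M x *ᵥ φ (g x)
  map_add' φ ψ := by funext x; exact Matrix.mulVec_add _ _ _
  map_smul' c φ := by funext x; exact Matrix.mulVec_smul (M x) c (φ (g x))

theorem genWave_apply (M : (Fin n → ℝ) → Matrix (Fin n → ι) (Fin n → ι) ℂ)
    (g : (Fin n → ℝ) → (Fin n → ℝ)) (φ : Wave ι n) (x : Fin n → ℝ) :
    genWave M g φ x = M x *ᵥ φ (g x) := rfl

theorem genWave_mul (M N : (Fin n → ℝ) → Matrix (Fin n → ι) (Fin n → ι) ℂ)
    (g h : (Fin n → ℝ) → (Fin n → ℝ)) :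
    genWave M g * genWave N h = genWave (fun x => M x * N (g x)) (h ∘ g) := by
  refine LinearMap.ext fun φ => funext fun x => ?_
  simp only [Module.End.mul_apply, genWave_apply, Matrix.mulVec_mulVec, Function.comp_apply]

theorem genWave_one : genWave (ι := ι) (n := n) (fun _ => 1) id = 1 :=
  LinearMap.ext fun _ => funext fun _ => Matrix.one_mulVec _

theorem genWave_zero (g : (Fin n → ℝ) → (Fin n → ℝ)) :
    genWave (ι := ι) (fun _ => 0) g = 0 :=
  LinearMap.ext fun _ => funext fun _ => Matrix.zero_mulVec _

theorem genWave_add (M N : (Fin n → ℝ) → Matrix (Fin n → ι) (Fin n → ι) ℂ)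
    (g : (Fin n → ℝ) → (Fin n → ℝ)) :
    genWave M g + genWave N g = genWave (fun x => M x + N x) g :=
  LinearMap.ext fun _ => funext fun _ => (Matrix.add_mulVec _ _ _).symm

theorem genWave_sum {κ : Type*} (s : Finset κ)
    (M : κ → (Fin n → ℝ) → Matrix (Fin n → ι) (Fin n → ι) ℂ) (g : (Fin n → ℝ) → (Fin n → ℝ)) :
    ∑ k ∈ s, genWave (M k) g = genWave (fun x => ∑ k ∈ s, M k x) g := by
  classical
  induction s using Finset.induction_on with
  | empty => simp only [Finset.sum_empty, genWave_zero]
  | insert k s hk ih => simp only [Finset.sum_insert hk, ih, genWave_add]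

theorem genWave_smul (c : ℂ) (M : (Fin n → ℝ) → Matrix (Fin n → ι) (Fin n → ι) ℂ)
    (g : (Fin n → ℝ) → (Fin n → ℝ)) : c • genWave M g = genWave (fun x => c • M x) g :=
  LinearMap.ext fun φ => funext fun x => (Matrix.smul_mulVec c (M x) (φ (g x))).symm

theorem commute_genWave {D M : (Fin n → ℝ) → Matrix (Fin n → ι) (Fin n → ι) ℂ}
    {g : (Fin n → ℝ) → (Fin n → ℝ)} (h : ∀ x, M x * D (g x) = D x * M x) :
    Commute (genWave M g) (genWave D id) := by
  simp only [Commute, SemiconjBy, genWave_mul, h]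
  rfl

/-- The wave function of the remaining particles when the first one has the spectral parameter `z`
and the index `a`. -/
def slice (z : ℝ) (a : ι) : Wave ι (n + 1) →ₗ[ℂ] Wave ι n where
  toFun φ x α := φ (Fin.cons z x : Fin (n + 1) → ℝ) (Fin.cons a α : Fin (n + 1) → ι)
  map_add' _ _ := rfl
  map_smul' _ _ := rfl

theorem slice_apply (z : ℝ) (a : ι) (φ : Wave ι (n + 1)) (x : Fin n → ℝ) (α : Fin n → ι) :
    slice z a φ x α = φ (Fin.cons z x : Fin (n + 1) → ℝ) (Fin.cons a α : Fin (n + 1) → ι) := rfl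

theorem wave_ext {φ ψ : Wave ι (n + 1)} (h : ∀ z a, slice z a φ = slice z a ψ) : φ = ψ := by
  funext x α
  rw [← Fin.cons_self_tail x, ← Fin.cons_self_tail α]
  exact congrFun (congrFun (h (x 0) (α 0)) (Fin.tail x)) (Fin.tail α)

/-- An operation on `n` particles applied to the last `n` of `n + 1` particles. -/
def shiftWave (ι : Type*) (n : ℕ) :
    Module.End ℂ (Wave ι n) →* Module.End ℂ (Wave ι (n + 1)) where
  toFun A :=
    { toFun := fun φ x α => A (slice (x 0) (α 0) φ) (Fin.tail x) (Fin.tail α)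
      map_add' := fun φ ψ => by funext x α; rw [map_add, map_add]; rfl
      map_smul' := fun c φ => by funext x α; rw [map_smul, map_smul]; rfl }
  map_one' := by
    refine LinearMap.ext fun φ => funext fun x => funext fun α => ?_
    simp [slice_apply]
  map_mul' A B := by
    refine LinearMap.ext fun φ => funext fun x => funext fun α => ?_
    simp only [LinearMap.coe_mk, AddHom.coe_mk, Module.End.mul_apply]
    rfl

theorem slice_shiftWave (A : Module.End ℂ (Wave ι n)) (z : ℝ) (a : ι) (φ : Wave ι (n + 1)) :
    slice z a (shiftWave ι n A φ) = A (slice z a φ) := rfl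

theorem slice_genWave (M : (Fin (n + 1) → ℝ) → Matrix (Fin (n + 1) → ι) (Fin (n + 1) → ι) ℂ)
    (g : (Fin n → ℝ) → (Fin n → ℝ)) (f : (Fin (n + 1) → ℝ) → (Fin (n + 1) → ℝ)) (z w : ℝ)
    (hf : ∀ x, f (Fin.cons z x) = Fin.cons w (g x)) (a : ι) (φ : Wave ι (n + 1)) :
    slice z a (genWave M f φ) =
      ∑ b, genWave (fun x => block (M (Fin.cons z x)) a b) g (slice w b φ) := by
  funext x α
  rw [slice_apply, genWave_apply, Matrix.mulVec, dotProduct, sum_fin_succ, Finset.sum_apply,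
    Finset.sum_apply, hf]
  rfl

theorem shiftWave_add (A B : Module.End ℂ (Wave ι n)) :
    shiftWave ι n (A + B) = shiftWave ι n A + shiftWave ι n B := rfl

theorem shiftWave_genWave (M : (Fin n → ℝ) → Matrix (Fin n → ι) (Fin n → ι) ℂ)
    (g : (Fin n → ℝ) → (Fin n → ℝ)) :
    shiftWave ι n (genWave M g) =
      genWave (fun x => shiftMat (M (Fin.tail x))) fun x => Fin.cons (x 0) (g (Fin.tail x)) := by
  refine LinearMap.ext fun φ => wave_ext fun z a => ?_
  rw [slice_shiftWave, slice_genWave _ g _ z z (fun x => by simp)]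
  simp only [Fin.tail_cons, block_shiftMat]
  rw [Finset.sum_eq_single a (fun b _ hb => ?_) (fun h => absurd (Finset.mem_univ a) h)]
  · simp
  · simp only [if_neg hb.symm, genWave_zero, LinearMap.zero_apply]

variable (S : ℝ → ℝ → Matrix (ι × ι) (ι × ι) ℂ) (R T : ℝ → Matrix ι ι ℂ)

/-- The pointwise action of the generators of the Weyl group. -/
def sWave (n : ℕ) (i : Fin n) : Module.End ℂ (Wave ι n) :=
  if h : (i : ℕ) + 1 < n then
    genWave (fun x => onPair i ⟨i + 1, h⟩ (S (x i) (x ⟨i + 1, h⟩)))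
      (fun x => x ∘ Equiv.swap i ⟨i + 1, h⟩)
  else
    genWave (fun x => onSlot i (T (x i))) id +
      genWave (fun x => onSlot i (R (x i))) (fun x => Function.update x i (-x i))

theorem sWave_of_lt {n : ℕ} (i : Fin n) (h : (i : ℕ) + 1 < n) :
    sWave S R T n i = genWave (fun x => onPair i ⟨i + 1, h⟩ (S (x i) (x ⟨i + 1, h⟩)))
      (fun x => x ∘ Equiv.swap i ⟨i + 1, h⟩) := dif_pos h

theorem sWave_of_eq {n : ℕ} (i : Fin n) (h : (i : ℕ) + 1 = n) :
    sWave S R T n i = genWave (fun x => onSlot i (T (x i))) id +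
      genWave (fun x => onSlot i (R (x i))) (fun x => Function.update x i (-x i)) :=
  dif_neg (by omega)

theorem sWave_succ (n : ℕ) (i : Fin n) :
    sWave S R T (n + 1) i.succ = shiftWave ι n (sWave S R T n i) := by
  by_cases h : (i : ℕ) + 1 < n
  · rw [sWave_of_lt _ _ _ i h, sWave_of_lt _ _ _ i.succ (by simpa using h), shiftWave_genWave]
    congr 1
    · funext x
      rw [shiftMat_onPair]
      rfl
    · funext x
      refine funext fun j => ?_
      refine Fin.cases ?_ (fun j => ?_) j
      · rw [Function.comp_apply, Fin.cons_zero, Equiv.swap_apply_of_ne_of_ne]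
        · exact (Fin.succ_ne_zero i).symm
        · simp [Fin.ext_iff]
      · rw [Function.comp_apply, Fin.cons_succ]
        exact congrArg x ((Fin.succ_injective n).swap_apply i ⟨i + 1, h⟩ j)
  · have h' : (i : ℕ) + 1 = n := by omega
    rw [sWave_of_eq _ _ _ i h', sWave_of_eq _ _ _ i.succ (by simpa using h'), shiftWave_add,
      shiftWave_genWave, shiftWave_genWave]
    congr 2
    · funext x
      rw [shiftMat_onSlot]
      rfl
    · funext x
      exact (Fin.cons_self_tail x).symm
    · funext x
      rw [shiftMat_onSlot]
      rfl
    · funext x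
      refine funext fun j => ?_
      refine Fin.cases ?_ (fun j => ?_) j
      · rw [Fin.cons_zero, Function.update_of_ne (Fin.succ_ne_zero i).symm]
      · rw [Fin.cons_succ]
        by_cases hj : j = i
        · subst hj; simp [Fin.tail]
        · rw [Function.update_of_ne (fun h => hj (Fin.succ_injective n h)),
            Function.update_of_ne hj]
          rfl

/-- The exchange of the first two entries. -/
def swapHead (x : Fin (n + 2) → ℝ) : Fin (n + 2) → ℝ :=
  Fin.cons (x 1) (Fin.cons (x 0) (Fin.tail (Fin.tail x)) : Fin (n + 1) → ℝ)

theorem swapHead_cons (u v : ℝ) (x : Fin n → ℝ) :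
    swapHead (Fin.cons u (Fin.cons v x : Fin (n + 1) → ℝ) : Fin (n + 2) → ℝ) =
      Fin.cons v (Fin.cons u x : Fin (n + 1) → ℝ) := by
  rw [swapHead, ← Fin.succ_zero_eq_one]
  simp only [Fin.cons_succ, Fin.cons_zero, Fin.tail_cons]

theorem swapHead_swapHead (x : Fin (n + 2) → ℝ) : swapHead (swapHead x) = x := by
  rw [← Fin.cons_self_tail x, ← Fin.cons_self_tail (Fin.tail x), swapHead_cons, swapHead_cons]

theorem sWave_zero (n : ℕ) : sWave S R T (n + 2) 0 =
    genWave (fun x => headPair n (S (x 0) (x 1))) swapHead := by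
  rw [sWave_of_lt _ _ _ _ (by simp)]
  congr 1
  funext x
  rw [← Fin.cons_self_tail x, ← Fin.cons_self_tail (Fin.tail x), swapHead_cons]
  refine funext fun j => ?_
  have h1 : (⟨((0 : Fin (n + 2)) : ℕ) + 1, by simp⟩ : Fin (n + 2)) = 1 := rfl
  rw [h1, Function.comp_apply]
  refine Fin.cases ?_ (fun j => ?_) j
  · rw [Equiv.swap_apply_left]; rfl
  · refine Fin.cases ?_ (fun j => ?_) j
    · rw [Fin.succ_zero_eq_one, Equiv.swap_apply_right]; rfl
    · rw [Equiv.swap_apply_of_ne_of_ne (Fin.succ_ne_zero _) (by simp [Fin.ext_iff])]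
      rfl

theorem slice_slice_sWave_zero (u v : ℝ) (a b : ι) (φ : Wave ι (n + 2)) :
    slice v b (slice u a (sWave S R T (n + 2) 0 φ)) =
      ∑ c, ∑ d, S u v (a, b) (c, d) • slice u d (slice v c φ) := by
  funext x α
  rw [slice_apply, slice_apply, sWave_zero, genWave_apply, swapHead_cons, Matrix.mulVec, dotProduct,
    sum_fin_succ]
  simp only [sum_fin_succ, Finset.sum_apply]
  refine Finset.sum_congr rfl fun c _ => Finset.sum_congr rfl fun d _ => ?_
  simp only [headPair_cons, mul_ite, mul_one, mul_zero, ite_mul, zero_mul, Finset.sum_ite_eq,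
    Finset.mem_univ, if_true]
  rfl

theorem sWave_zero_commute (A : Module.End ℂ (Wave ι n)) :
    Commute (sWave S R T (n + 2) 0) (shiftWave ι (n + 1) (shiftWave ι n A)) := by
  refine LinearMap.ext fun φ => wave_ext fun u a => wave_ext fun v b => ?_
  simp only [Module.End.mul_apply, slice_slice_sWave_zero, slice_shiftWave, map_sum, map_smul]

variable {S R T}

theorem IsExchangeFactor.sWave_zero_sq (hS : IsExchangeFactor S) :
    sWave S R T (n + 2) 0 * sWave S R T (n + 2) 0 = 1 := by
  rw [sWave_zero, genWave_mul, ← genWave_one]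
  congr 1
  · funext x
    exact hS.headPair_mul_cancel _ _
  · exact funext swapHead_swapHead

theorem IsExchangeFactor.sWave_braid (hS : IsExchangeFactor S) :
    sWave S R T (n + 3) 0 * sWave S R T (n + 3) 1 * sWave S R T (n + 3) 0 =
      sWave S R T (n + 3) 1 * sWave S R T (n + 3) 0 * sWave S R T (n + 3) 1 := by
  rw [← Fin.succ_zero_eq_one, sWave_succ, sWave_zero, sWave_zero, shiftWave_genWave]
  simp only [genWave_mul]
  congr 1
  funext x
  exact hS.headPair_yangBaxter (x 0) (x 1) (x 2)

/-! #### The pointwise defect operators -/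

/-- The entry `a`, `b` of the dressed matrix, acting on `n`-particle wave functions. -/
def defectWave (S : ℝ → ℝ → Matrix (ι × ι) (ι × ι) ℂ) (M : Matrix ι ι ℂ) (χ χ' : ℝ) (n : ℕ)
    (a b : ι) : Module.End ℂ (Wave ι n) :=
  genWave (fun x => block (dressing S M χ χ' x) a b) id

theorem block_sum {κ : Type*} (t : Finset κ)
    (f : κ → Matrix (Fin (n + 1) → ι) (Fin (n + 1) → ι) ℂ) (a b : ι) :
    block (∑ p ∈ t, f p) a b = ∑ p ∈ t, block (f p) a b := by
  ext α β
  simp only [block_apply, Matrix.sum_apply]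

theorem block_mul_shiftMat (A : Matrix (Fin (n + 1) → ι) (Fin (n + 1) → ι) ℂ)
    (B : Matrix (Fin n → ι) (Fin n → ι) ℂ) (a b : ι) :
    block (A * shiftMat B) a b = block A a b * B := by
  simp only [block_mul, block_shiftMat, mul_ite, mul_zero, Finset.sum_ite_eq', Finset.mem_univ,
    if_true]

theorem block_shiftMat_mul (A : Matrix (Fin (n + 1) → ι) (Fin (n + 1) → ι) ℂ)
    (B : Matrix (Fin n → ι) (Fin n → ι) ℂ) (a b : ι) :
    block (shiftMat B * A) a b = B * block A a b := by
  simp only [block_mul, block_shiftMat, ite_mul, zero_mul, Finset.sum_ite_eq, Finset.mem_univ,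
    if_true]

theorem block_block_headPair_conj (A : Matrix (Fin (n + 1) → ι) (Fin (n + 1) → ι) ℂ)
    (B C : Matrix (ι × ι) (ι × ι) ℂ) (a b c d : ι) :
    block (block (headPair n B * shiftMat A * headPair n C) a b) c d =
      ∑ p, ∑ q, ∑ r, (B (a, c) (p, q) * C (p, r) (b, d)) • block A q r := by
  simp only [block_mul _ (headPair n C), block_mul_shiftMat, block_sum]
  refine Finset.sum_congr rfl fun p _ => ?_
  simp only [block_mul, block_block_headPair, Finset.sum_mul]
  rw [Finset.sum_comm]
  refine Finset.sum_congr rfl fun q _ => Finset.sum_congr rfl fun r _ => ?_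
  rw [smul_mul_assoc, one_mul, mul_smul_comm, mul_one, smul_smul, mul_comm]

theorem block_block_dressing (M : Matrix ι ι ℂ) (χ χ' z : ℝ) (x : Fin n → ℝ) (a b c d : ι) :
    block (block (dressing S M χ χ' (Fin.cons z x : Fin (n + 1) → ℝ)) a b) c d =
      ∑ p, ∑ q, ∑ r, (S χ z (a, c) (p, q) * S z χ' (p, r) (b, d)) •
        block (dressing S M χ χ' x) q r := by
  rw [dressing_cons, block_block_headPair_conj]

/-- The action of the defect operators after peeling off the first particle. -/
theorem slice_defectWave (M : Matrix ι ι ℂ) (χ χ' z : ℝ) (a b c : ι) (φ : Wave ι (n + 1)) :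
    slice z c (defectWave S M χ χ' (n + 1) a b φ) =
      ∑ d, ∑ p, ∑ q, ∑ r, (S χ z (a, c) (p, q) * S z χ' (p, r) (b, d)) •
        defectWave S M χ χ' n q r (slice z d φ) := by
  rw [defectWave, slice_genWave _ id _ z z (fun x => rfl)]
  refine Finset.sum_congr rfl fun d _ => ?_
  simp only [block_block_dressing, defectWave, ← LinearMap.smul_apply, ← LinearMap.sum_apply]
  simp only [genWave_smul, genWave_sum]

/-- The one-slot matrix `M` with the spectral parameters `χ`, `χ'` satisfies the defect exchange
relations with the transmission and with the reflection matrix. -/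
structure IsDefectCompatible (S : ℝ → ℝ → Matrix (ι × ι) (ι × ι) ℂ) (R T : ℝ → Matrix ι ι ℂ)
    (χ χ' : ℝ) (M : Matrix ι ι ℂ) : Prop where
  transmission : ∀ y, DefectExchange S χ χ' M y y (T y)
  reflection : ∀ y, DefectExchange S χ χ' M y (-y) (R y)

theorem IsAdmissiblePair.compatible_T (hRT : IsAdmissiblePair S R T) (x : ℝ) :
    IsDefectCompatible S R T x x (T x) :=
  ⟨fun y => hRT.yangBaxter_TT x y, fun y => hRT.yangBaxter_TR x y⟩

theorem IsAdmissiblePair.compatible_R (hS : IsExchangeFactor S) (hRT : IsAdmissiblePair S R T)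
    (x : ℝ) : IsDefectCompatible S R T x (-x) (R x) := by
  refine ⟨fun y => ?_, fun y => hRT.yangBaxter_RR x y⟩
  -- the transmission-reflection equation, with its outermost exchange factors moved across
  have h := congrArg (fun A => S x y * A * S y (-x)) (hRT.yangBaxter_TR y x)
  simp only [← mul_assoc] at h
  rw [hS.unitarity, one_mul] at h
  have h2 := hS.unitarity (-x) y
  rw [mul_assoc _ (S (-x) y), h2, mul_one] at h
  exact h.symm

/-- The defect operators commute with the action of the Weyl group. -/
theorem IsExchangeFactor.defectWave_commute (hS : IsExchangeFactor S) {χ χ' : ℝ} {M : Matrix ι ι ℂ}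
    (hM : IsDefectCompatible S R T χ χ' M) :
    ∀ {n : ℕ} (i : Fin n) (a b : ι),
      Commute (sWave S R T n i) (defectWave S M χ χ' n a b)
  | n + 1, i, a, b => by
    have hb : ∀ {m : ℕ} {N : Matrix (Fin m → ι) (Fin m → ι) ℂ}
        {A B : Matrix (Fin (m + 1) → ι) (Fin (m + 1) → ι) ℂ},
        shiftMat N * A = B * shiftMat N → N * block A a b = block B a b * N := by
      intro m N A B h
      have := congrArg (block · a b) h
      simpa only [block_shiftMat_mul, block_mul_shiftMat] using this
    refine Fin.cases ?_ (fun i => ?_) i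
    · rcases n with _ | n
      · rw [sWave_of_eq _ _ _ _ rfl]
        have key : ∀ {y y' : ℝ} {N : Matrix ι ι ℂ}, DefectExchange S χ χ' M y y' N →
            ∀ x : Fin 1 → ℝ, x 0 = y → ∀ x' : Fin 1 → ℝ, x' 0 = y' →
            shiftMat (onSlot 0 N) * dressing S M χ χ' x' =
              dressing S M χ χ' x * shiftMat (onSlot 0 N) := by
          rintro y y' N h x rfl x' rfl
          have := congrArg (headPair 0) h
          simp only [headPair_mul, headPair_one_kronecker] at this
          rw [dressing_succ, dressing_succ, dressing_zero, dressing_zero, this]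
          simp only [mul_assoc]
        refine Commute.add_left ?_ ?_
        · exact commute_genWave fun x => hb (key (hM.transmission (x 0)) x rfl x rfl)
        · exact commute_genWave fun x => hb (key (hM.reflection (x 0)) x rfl _ (by simp))
      · rw [sWave_zero]
        refine commute_genWave fun x => hb ?_
        rw [← Fin.cons_self_tail x, ← Fin.cons_self_tail (Fin.tail x), swapHead_cons]
        exact hS.dressing_exchange M χ χ' _ _ _
    · rw [sWave_succ]
      refine LinearMap.ext fun φ => wave_ext fun z c => ?_
      simp only [Module.End.mul_apply, slice_defectWave, slice_shiftWave, map_sum, map_smul]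
      refine Finset.sum_congr rfl fun d _ => Finset.sum_congr rfl fun p _ =>
        Finset.sum_congr rfl fun q _ => Finset.sum_congr rfl fun r _ => congrArg _ ?_
      exact LinearMap.congr_fun (hS.defectWave_commute hM i q r) _

variable (S R T) in
/-- The action of the sign change of the first basis vector: it produces the dressed transmission
and reflection matrices. -/
theorem flipWord_sWave : ∀ n : ℕ, flipWord n (sWave S R T (n + 1)) =
    genWave (fun x => dressing S (T (x 0)) (x 0) (x 0) (Fin.tail x)) id +
      genWave (fun x => dressing S (R (x 0)) (x 0) (-x 0) (Fin.tail x))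
        (fun x => Fin.cons (-x 0) (Fin.tail x))
  | 0 => by
    simp only [flipWord, dressing_zero]
    rw [sWave_of_eq _ _ _ _ rfl]
    congr 2
    funext x
    refine funext fun j => ?_
    rw [Fin.fin_one_eq_zero j]
    simp
  | n + 1 => by
    have h : (fun i : Fin (n + 1) => sWave S R T (n + 2) i.succ) =
        fun i => shiftWave ι (n + 1) (sWave S R T (n + 1) i) := funext fun i => sWave_succ _ _ _ _ _
    rw [flipWord, h, ← map_flipWord, flipWord_sWave n, shiftWave_add, shiftWave_genWave,
      shiftWave_genWave, sWave_zero, mul_add, add_mul]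
    simp only [genWave_mul]
    congr 2
    · funext x
      rw [dressing_succ]
      rw [← Fin.cons_self_tail x, ← Fin.cons_self_tail (Fin.tail x)]
      simp only [Function.comp_apply, swapHead_cons, Fin.tail_cons, Fin.cons_zero,
        ← Fin.succ_zero_eq_one, Fin.cons_succ, id_eq]
    · funext x
      rw [← Fin.cons_self_tail x, ← Fin.cons_self_tail (Fin.tail x)]
      simp only [Function.comp_apply, swapHead_cons, Fin.tail_cons, Fin.cons_zero, id_eq]
    · funext x
      rw [dressing_succ]
      rw [← Fin.cons_self_tail x, ← Fin.cons_self_tail (Fin.tail x)]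
      simp only [Function.comp_apply, swapHead_cons, Fin.tail_cons, Fin.cons_zero,
        ← Fin.succ_zero_eq_one, Fin.cons_succ]
    · funext x
      rw [← Fin.cons_self_tail x, ← Fin.cons_self_tail (Fin.tail x)]
      simp only [Function.comp_apply, swapHead_cons, Fin.tail_cons, Fin.cons_zero]

theorem slice_flipWord_sWave (z : ℝ) (a : ι) (φ : Wave ι (n + 1)) :
    slice z a (flipWord n (sWave S R T (n + 1)) φ) =
      ∑ b, (defectWave S (T z) z z n a b (slice z b φ) +
        defectWave S (R z) z (-z) n a b (slice (-z) b φ)) := by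
  rw [flipWord_sWave, LinearMap.add_apply, map_add,
    slice_genWave _ id _ z z (fun x => rfl), slice_genWave _ id _ z (-z) (fun x => by simp),
    Finset.sum_add_distrib]
  simp only [Fin.cons_zero, Fin.tail_cons, defectWave]

theorem sWave_last_sq (hRT : IsAdmissiblePair S R T) : sWave S R T 1 0 * sWave S R T 1 0 = 1 := by
  have h2 : (fun x : Fin 1 → ℝ => Function.update x 0 (-x 0)) ∘
      (fun x => Function.update x 0 (-x 0)) = id := by
    funext x; simp
  have hT : ∀ x : Fin 1 → ℝ, onSlot (0 : Fin 1) (T (x 0)) * onSlot 0 (T (x 0)) +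
      onSlot 0 (R (x 0)) * onSlot 0 (R (Function.update x 0 (-x 0) 0)) = 1 := fun x => by
    have := congrArg (onSlot (0 : Fin 1)) (hRT.unitarity_one (x 0))
    ext α β
    have := congrFun (congrFun this α) β
    simp only [onSlot, Matrix.add_apply, Matrix.one_apply] at this ⊢
    simp only [← onSlot_zero_mul, onSlot, Function.update_self]
    have h : ∀ k : Fin 1, k = 0 := Fin.fin_one_eq_zero
    simp only [h, ne_eq, not_true, false_implies, implies_true, if_true, funext_iff,
      forall_const] at this ⊢
    exact this
  have hR : ∀ x : Fin 1 → ℝ, onSlot (0 : Fin 1) (T (x 0)) * onSlot 0 (R (x 0)) +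
      onSlot 0 (R (x 0)) * onSlot 0 (T (Function.update x 0 (-x 0) 0)) = 0 := fun x => by
    have := congrArg (onSlot (0 : Fin 1)) (hRT.unitarity_zero (x 0))
    ext α β
    have := congrFun (congrFun this α) β
    simp only [onSlot, Matrix.add_apply, Matrix.zero_apply] at this ⊢
    simp only [← onSlot_zero_mul, onSlot, Function.update_self]
    have h : ∀ k : Fin 1, k = 0 := Fin.fin_one_eq_zero
    simp only [h, ne_eq, not_true, false_implies, implies_true, if_true] at this ⊢
    exact this
  rw [sWave_of_eq _ _ _ _ rfl, add_mul, mul_add, mul_add]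
  simp only [genWave_mul, Function.comp_id, Function.id_comp, id_eq]
  have e : ∀ A B C D : Module.End ℂ (Wave ι 1), A + B + (C + D) = (A + D) + (B + C) :=
    fun A B C D => by abel
  rw [h2, e, genWave_add, genWave_add]
  simp only [hT, hR, genWave_zero, add_zero]
  exact genWave_one

/-- The sign change of the first vector acts by defect operators, which commute with the Weyl group
of the remaining particles. -/
theorem IsExchangeFactor.shiftWave_sWave_commute (hS : IsExchangeFactor S)
    (hRT : IsAdmissiblePair S R T) (i : Fin n) :
    Commute (shiftWave ι n (sWave S R T n i)) (flipWord n (sWave S R T (n + 1))) := by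
  refine LinearMap.ext fun φ => wave_ext fun z a => ?_
  simp only [Module.End.mul_apply, slice_flipWord_sWave, slice_shiftWave, map_sum, map_add]
  refine Finset.sum_congr rfl fun b _ => congrArg₂ _ ?_ ?_
  · exact LinearMap.congr_fun (hS.defectWave_commute (hRT.compatible_T z) i a b) _
  · exact LinearMap.congr_fun (hS.defectWave_commute (hRT.compatible_R hS z) i a b) _

theorem IsExchangeFactor.sWave_quad (hS : IsExchangeFactor S) (hRT : IsAdmissiblePair S R T) :
    sWave S R T 2 0 * sWave S R T 2 1 * sWave S R T 2 0 * sWave S R T 2 1 =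
      sWave S R T 2 1 * sWave S R T 2 0 * sWave S R T 2 1 * sWave S R T 2 0 := by
  have h1 : sWave S R T 2 1 = shiftWave ι 1 (sWave S R T 1 0) := sWave_succ S R T 1 0
  have hc := (hS.shiftWave_sWave_commute hRT (0 : Fin 1)).eq
  have hf : flipWord 1 (sWave S R T (1 + 1)) =
      sWave S R T 2 0 * sWave S R T 2 1 * sWave S R T 2 0 := rfl
  rw [← h1, hf] at hc
  rw [← hc]
  simp only [mul_assoc]

/-- The pointwise operations satisfy the defining relations of the Weyl group. -/
theorem isCoxeterB_sWave (hS : IsExchangeFactor S) (hRT : IsAdmissiblePair S R T) :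
    ∀ n : ℕ, IsCoxeterB n (sWave S R T n)
  | 0 => ⟨fun i => i.elim0, fun i => i.elim0, fun i => i.elim0, fun i => i.elim0⟩
  | 1 => by
    have h : ∀ i : Fin 1, (i : ℕ) = 0 := fun i => by omega
    refine ⟨fun i => ?_, fun i j hij => ?_, fun i j hij => ?_, fun i j hij => ?_⟩
    · rw [Fin.fin_one_eq_zero i]; exact sWave_last_sq hRT
    all_goals have := h i; have := h j; omega
  | n + 2 => by
    have ih := isCoxeterB_sWave hS hRT (n + 1)
    have hpos : ∀ {i j : Fin (n + 2)}, (i : ℕ) < j → ∃ k : Fin (n + 1), j = k.succ :=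
      fun {i j} hij => ⟨j.pred (by rintro rfl; simp at hij), (Fin.succ_pred _ _).symm⟩
    refine ⟨fun i => ?_, fun i j hij => ?_, fun i j hij hj => ?_, fun i j hij hj => ?_⟩
    · refine Fin.cases ?_ (fun i => ?_) i
      · exact hS.sWave_zero_sq
      · rw [sWave_succ, ← map_mul, ih.sq, map_one]
    · obtain ⟨j, rfl⟩ := hpos (i := i) (j := j) (by omega)
      refine Fin.cases (fun hij => ?_) (fun i hij => ?_) i hij
      · obtain ⟨k, rfl⟩ : ∃ k : Fin n, j = k.succ :=
          ⟨j.pred (by rintro rfl; simp at hij), (Fin.succ_pred _ _).symm⟩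
        rw [sWave_succ, sWave_succ]
        exact sWave_zero_commute _ _ _ _
      · rw [sWave_succ, sWave_succ, ← map_mul, ih.comm i j (by simpa using hij), map_mul]
    · obtain ⟨j, rfl⟩ := hpos (i := i) (j := j) (by omega)
      refine Fin.cases (fun hij => ?_) (fun i hij => ?_) i hij
      · obtain rfl : j = 0 := Fin.ext (by simpa using hij.symm)
        rcases n with _ | n
        · simp at hj
        · exact hS.sWave_braid
      · rw [sWave_succ, sWave_succ, ← map_mul, ← map_mul, ih.braid i j (by simpa using hij)
          (by simpa using hj), map_mul, map_mul]
    · obtain ⟨j, rfl⟩ := hpos (i := i) (j := j) (by omega)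
      refine Fin.cases (fun hij => ?_) (fun i hij => ?_) i hij
      · obtain rfl : j = 0 := Fin.ext (by simpa using hij.symm)
        rcases n with _ | n
        · exact hS.sWave_quad hRT
        · simp at hj
      · simp only [sWave_succ, ← map_mul]
        rw [ih.quad i j (by simpa using hij) (by simpa using hj)]

/-! #### Pointwise creation -/

/-- Creation of a first particle with index `a` and wave function `h`. -/
def createWave (n : ℕ) (a : ι) (h : ℝ → ℂ) : Wave ι n →ₗ[ℂ] Wave ι (n + 1) where
  toFun φ x α := (if α 0 = a then h (x 0) else 0) * φ (Fin.tail x) (Fin.tail α)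
  map_add' φ ψ := by funext x α; exact mul_add _ _ _
  map_smul' c φ := by funext x α; exact mul_left_comm _ _ _

/-- Creation of two particles with indices `a`, `b` and the joint wave function `k`. -/
def createPairWave (n : ℕ) (a b : ι) (k : ℝ × ℝ → ℂ) : Wave ι n →ₗ[ℂ] Wave ι (n + 2) where
  toFun φ x α := (if α 0 = a ∧ α 1 = b then k (x 0, x 1) else 0) *
    φ (Fin.tail (Fin.tail x)) (Fin.tail (Fin.tail α))
  map_add' φ ψ := by funext x α; exact mul_add _ _ _
  map_smul' c φ := by funext x α; exact mul_left_comm _ _ _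

theorem slice_createWave (a c : ι) (h : ℝ → ℂ) (z : ℝ) (φ : Wave ι n) :
    slice z c (createWave n a h φ) = (if c = a then h z else 0) • φ := rfl

theorem slice_slice_createPairWave (a b c d : ι) (k : ℝ × ℝ → ℂ) (u v : ℝ) (φ : Wave ι n) :
    slice v d (slice u c (createPairWave n a b k φ)) =
      (if c = a ∧ d = b then k (u, v) else 0) • φ := rfl

theorem shiftWave_createWave (A : Module.End ℂ (Wave ι n)) (a : ι) (h : ℝ → ℂ) (φ : Wave ι n) :
    shiftWave ι n A (createWave n a h φ) = createWave n a h (A φ) :=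
  wave_ext fun z c => by
    rw [slice_shiftWave, slice_createWave, slice_createWave, map_smul]

theorem createWave_createWave (a b : ι) (f g : ℝ → ℂ) (φ : Wave ι n) :
    createWave (n + 1) a f (createWave n b g φ) = createPairWave n a b (fun p => f p.1 * g p.2) φ :=
  wave_ext fun u c => wave_ext fun v d => by
    rw [slice_createWave, map_smul, slice_createWave, slice_slice_createPairWave, smul_smul]
    congr 1
    split_ifs <;> simp_all

theorem sWave_zero_createPairWave (a b : ι) (k : ℝ × ℝ → ℂ) (φ : Wave ι n) :
    sWave S R T (n + 2) 0 (createPairWave n a b k φ) =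
      ∑ c, ∑ d, createPairWave n c d (fun p => S p.1 p.2 (c, d) (a, b) * k (p.2, p.1)) φ := by
  refine wave_ext fun u c => wave_ext fun v d => ?_
  simp only [slice_slice_sWave_zero, map_sum, slice_slice_createPairWave]
  have e : ∀ (p q a b : ι) (z w : ℂ) (ψ : Wave ι n), z • (if p = a ∧ q = b then w else 0) • ψ =
      if q = b then (if p = a then (z * w) • ψ else 0) else 0 := fun p q a b z w ψ => by
    split_ifs <;> simp_all [smul_smul]
  have e' : ∀ (p q : ι), (if c = p ∧ d = q then
      S u v (p, q) (a, b) * k (v, u) else 0) • φ =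
      if d = q then (if c = p then (S u v (p, q) (a, b) * k (v, u)) • φ else 0) else 0 :=
    fun p q => by split_ifs <;> simp_all
  simp only [e, e', Finset.sum_ite_eq, Finset.sum_ite_eq', Finset.mem_univ, if_true]

/-- The exchange relation between the defect operators and creation. -/
theorem defectWave_createWave (M : Matrix ι ι ℂ) (χ χ' : ℝ) (a b e : ι) (h : ℝ → ℂ)
    (φ : Wave ι n) :
    defectWave S M χ χ' (n + 1) a b (createWave n e h φ) =
      ∑ r, ∑ q, ∑ c, createWave n c
        (fun z => (∑ p, S χ z (a, c) (p, q) * S z χ' (p, r) (b, e)) * h z)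
        (defectWave S M χ χ' n q r φ) := by
  refine wave_ext fun z c => ?_
  simp only [slice_defectWave, map_sum, slice_createWave, LinearMap.map_smul, smul_smul, mul_ite,
    mul_zero]
  rw [Finset.sum_eq_single e (fun d _ hd => by
    simp only [if_neg hd, zero_smul, Finset.sum_const_zero]) (fun h => absurd (Finset.mem_univ _) h)]
  simp only [if_true, ite_smul, zero_smul, Finset.sum_ite_eq, Finset.mem_univ, Finset.sum_mul,
    Finset.sum_smul]
  calc _ = ∑ p, ∑ r, ∑ q, _ := Finset.sum_congr rfl fun p _ => Finset.sum_comm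
    _ = ∑ r, ∑ p, ∑ q, _ := Finset.sum_comm
    _ = _ := Finset.sum_congr rfl fun r _ => Finset.sum_comm

/-! #### Pointwise defect relations -/

/-- The defect exchange relations between the pointwise defect operators. -/
theorem IsExchangeFactor.defectWave_defectExchange (hS : IsExchangeFactor S) {x x' y y' : ℝ}
    {M N : Matrix ι ι ℂ} (h : DefectExchange S x x' M y y' N) (n : ℕ) (α₁ α₂ β₁ β₂ : ι) :
    ∑ γ₁, ∑ γ₂, ∑ δ₁, ∑ δ₂, (S x y (α₁, α₂) (γ₂, γ₁) * S y x' (γ₂, δ₁) (β₁, δ₂)) •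
        (defectWave S M x x' n γ₁ δ₁ * defectWave S N y y' n δ₂ β₂) =
      ∑ γ₁, ∑ γ₂, ∑ δ₁, ∑ δ₂, (S x y' (α₁, γ₂) (δ₂, δ₁) * S y' x' (δ₂, γ₁) (β₁, β₂)) •
        (defectWave S N y y' n α₂ γ₂ * defectWave S M x x' n δ₁ γ₁) := by
  simp only [defectWave, genWave_mul, genWave_smul, genWave_sum, Function.comp_id, id_eq]
  congr 1
  funext w
  have := congrArg (fun A => block (block A α₁ β₁) α₂ β₂) (hS.dressing_defectExchange h w)
  rw [mul_assoc (shiftMat _), mul_assoc (shiftMat _), block_mul_shiftMat, block_shiftMat_mul,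
    block_mul _ (dressing S N y y' w), block_mul (dressing S N y y' w)] at this
  simp only [block_block_headPair_conj, Finset.sum_mul, Finset.mul_sum, smul_mul_assoc,
    mul_smul_comm] at this
  -- only the order of the sums differs
  have e1 : ∀ f : ι → ι → ι → ι → Matrix (Fin n → ι) (Fin n → ι) ℂ,
      ∑ s, ∑ p, ∑ q, ∑ r, f s p q r = ∑ q, ∑ p, ∑ r, ∑ s, f s p q r := fun f => by
    calc _ = ∑ p, ∑ s, ∑ q, ∑ r, f s p q r := Finset.sum_comm
      _ = ∑ p, ∑ q, ∑ s, ∑ r, f s p q r := Finset.sum_congr rfl fun _ _ => Finset.sum_comm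
      _ = ∑ p, ∑ q, ∑ r, ∑ s, f s p q r := Finset.sum_congr rfl fun _ _ =>
          Finset.sum_congr rfl fun _ _ => Finset.sum_comm
      _ = _ := Finset.sum_comm
  have e2 : ∀ f : ι → ι → ι → ι → Matrix (Fin n → ι) (Fin n → ι) ℂ,
      ∑ q, ∑ p, ∑ r, ∑ s, f q p r s = ∑ s, ∑ q, ∑ r, ∑ p, f q p r s := fun f => by
    calc _ = ∑ q, ∑ r, ∑ p, ∑ s, f q p r s := Finset.sum_congr rfl fun _ _ => Finset.sum_comm
      _ = ∑ q, ∑ r, ∑ s, ∑ p, f q p r s := Finset.sum_congr rfl fun _ _ =>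
          Finset.sum_congr rfl fun _ _ => Finset.sum_comm
      _ = ∑ q, ∑ s, ∑ r, ∑ p, f q p r s := Finset.sum_congr rfl fun _ _ => Finset.sum_comm
      _ = _ := Finset.sum_comm
  exact (e1 _).symm.trans (this.trans (e2 _))

/-- Products of pointwise defect operators with matching inner spectral parameters. -/
theorem IsExchangeFactor.sum_defectWave_mul (hS : IsExchangeFactor S) (x y z : ℝ)
    (M N : Matrix ι ι ℂ) (n : ℕ) (a c : ι) :
    ∑ b, defectWave S M x y n a b * defectWave S N y z n b c =
      defectWave S (M * N) x z n a c := by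
  simp only [defectWave, genWave_mul, genWave_sum, Function.comp_id, id_eq, ← block_mul,
    hS.dressing_mul]

theorem defectWave_add (x y : ℝ) (M N : Matrix ι ι ℂ) (n : ℕ) (a b : ι) :
    defectWave S M x y n a b + defectWave S N x y n a b = defectWave S (M + N) x y n a b := by
  simp only [defectWave, genWave_add, dressing_add]
  rfl

theorem defectWave_zero_matrix (x y : ℝ) (n : ℕ) (a b : ι) :
    defectWave S 0 x y n a b = 0 := by
  simp only [defectWave, dressing_zero_matrix]
  exact genWave_zero id

theorem IsExchangeFactor.defectWave_one (hS : IsExchangeFactor S) (x : ℝ) (n : ℕ) (a b : ι) :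
    defectWave S 1 x x n a b = if a = b then 1 else 0 := by
  simp only [defectWave, hS.dressing_one, block_one]
  split_ifs
  · exact genWave_one
  · exact genWave_zero id

end Wave

/-! ### Integral kernels on square integrable functions -/

section Kernel

variable {X Y Z : Type*} [MeasurableSpace X] [MeasurableSpace Y] [MeasurableSpace Z]
  {μ : Measure X} {ν : Measure Y} {τ : Measure Z} [SigmaFinite μ] [SigmaFinite ν] [SigmaFinite τ]

/-- The Cauchy-Schwarz inequality for the contraction of two functions over a common variable. -/
theorem lintegral_kernel_sq_le {k : X × Y → ℂ} {f : Y × Z → ℂ} (hk : Measurable k)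
    (hf : Measurable f) :
    ∫⁻ p, (∫⁻ y, ‖k (p.1, y)‖ₑ * ‖f (y, p.2)‖ₑ ∂ν) ^ (2 : ℝ) ∂(μ.prod τ) ≤
      (∫⁻ q, ‖k q‖ₑ ^ (2 : ℝ) ∂(μ.prod ν)) * ∫⁻ q, ‖f q‖ₑ ^ (2 : ℝ) ∂(ν.prod τ) := by
  have hk2 : Measurable fun q => ‖k q‖ₑ ^ (2 : ℝ) := hk.enorm.pow_const _
  have hf2 : Measurable fun q => ‖f q‖ₑ ^ (2 : ℝ) := hf.enorm.pow_const _
  calc _ ≤ ∫⁻ p, (∫⁻ y, ‖k (p.1, y)‖ₑ ^ (2 : ℝ) ∂ν) * (∫⁻ y, ‖f (y, p.2)‖ₑ ^ (2 : ℝ) ∂ν)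
        ∂(μ.prod τ) := by
        refine lintegral_mono fun p => ?_
        have h := ENNReal.lintegral_mul_le_Lp_mul_Lq ν Real.HolderConjugate.two_two
          (f := fun y => ‖k (p.1, y)‖ₑ) (g := fun y => ‖f (y, p.2)‖ₑ)
          (hk.comp measurable_prodMk_left).enorm.aemeasurable
          (hf.comp measurable_prodMk_right).enorm.aemeasurable
        have h' := ENNReal.rpow_le_rpow h (z := 2) (by norm_num)
        rw [ENNReal.mul_rpow_of_nonneg _ _ (by norm_num), ← ENNReal.rpow_mul, ← ENNReal.rpow_mul]
          at h'
        norm_num at h'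
        simpa using h'
    _ = (∫⁻ x, ∫⁻ y, ‖k (x, y)‖ₑ ^ (2 : ℝ) ∂ν ∂μ) * ∫⁻ z, ∫⁻ y, ‖f (y, z)‖ₑ ^ (2 : ℝ) ∂ν ∂τ :=
        lintegral_prod_mul hk2.lintegral_prod_right'.aemeasurable
          hf2.lintegral_prod_left'.aemeasurable
    _ = _ := by rw [lintegral_prod _ hk2.aemeasurable, lintegral_prod_symm _ hf2.aemeasurable]

theorem lintegral_enorm_sq_lt_top (f : Lp ℂ 2 μ) : ∫⁻ x, ‖f x‖ₑ ^ (2 : ℝ) ∂μ < ∞ := by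
  have := lintegral_rpow_enorm_lt_top_of_eLpNorm_lt_top (by norm_num) (by norm_num) (Lp.memLp f).2
  simpa using this

theorem ae_integrable_kernel (k : Lp ℂ 2 (μ.prod ν)) (f : Lp ℂ 2 (ν.prod τ)) :
    ∀ᵐ p ∂(μ.prod τ), Integrable (fun y => k (p.1, y) * f (y, p.2)) ν := by
  have hk := (Lp.stronglyMeasurable k).measurable
  have hf := (Lp.stronglyMeasurable f).measurable
  have hm : Measurable fun p : X × Z => ∫⁻ y, ‖k (p.1, y)‖ₑ * ‖f (y, p.2)‖ₑ ∂ν := by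
    refine Measurable.lintegral_prod_right (f := fun (p : X × Z) (y : Y) =>
      ‖k (p.1, y)‖ₑ * ‖f (y, p.2)‖ₑ) ?_
    exact (hk.comp (by fun_prop)).enorm.mul (hf.comp (by fun_prop)).enorm
  have hlt := (lintegral_kernel_sq_le hk hf (μ := μ) (ν := ν) (τ := τ)).trans_lt
    (ENNReal.mul_lt_top (lintegral_enorm_sq_lt_top k) (lintegral_enorm_sq_lt_top f))
  filter_upwards [ae_lt_top (hm.pow_const _) hlt.ne] with p hp
  refine ⟨((hk.comp measurable_prodMk_left).mul
    (hf.comp measurable_prodMk_right)).aestronglyMeasurable, ?_⟩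
  have : ∫⁻ y, ‖k (p.1, y)‖ₑ * ‖f (y, p.2)‖ₑ ∂ν < ∞ := by
    by_contra h
    rw [not_lt, top_le_iff] at h
    rw [h] at hp
    simp at hp
  simpa only [HasFiniteIntegral, enorm_mul] using this

theorem ae_kernel_congr {k k' : X × Y → ℂ} {f f' : Y × Z → ℂ} (hk : k =ᵐ[μ.prod ν] k')
    (hf : f =ᵐ[ν.prod τ] f') :
    ∀ᵐ p ∂(μ.prod τ), (fun y => k (p.1, y) * f (y, p.2)) =ᵐ[ν]
      fun y => k' (p.1, y) * f' (y, p.2) := by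
  have h1 : ∀ᵐ x ∂μ, ∀ᵐ y ∂ν, k (x, y) = k' (x, y) := Measure.ae_ae_of_ae_prod hk
  have h2 : ∀ᵐ z ∂τ, ∀ᵐ y ∂ν, f (y, z) = f' (y, z) :=
    Measure.ae_ae_of_ae_prod
      ((Measure.measurePreserving_swap (μ := τ) (ν := ν)).quasiMeasurePreserving.ae hf)
  filter_upwards [Measure.quasiMeasurePreserving_fst.ae h1,
    Measure.quasiMeasurePreserving_snd.ae h2] with p hp1 hp2
  filter_upwards [hp1, hp2] with y hy1 hy2
  rw [hy1, hy2]

variable (μ ν τ) in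
/-- The contraction `(x, z) ↦ ∫ k(x, y) f(y, z) dy`. -/
def kernelFun (k : X × Y → ℂ) (f : Y × Z → ℂ) (p : X × Z) : ℂ := ∫ y, k (p.1, y) * f (y, p.2) ∂ν

theorem stronglyMeasurable_kernelFun {k : X × Y → ℂ} {f : Y × Z → ℂ} (hk : StronglyMeasurable k)
    (hf : StronglyMeasurable f) : StronglyMeasurable (kernelFun ν k f) := by
  refine StronglyMeasurable.integral_prod_right (f := fun (p : X × Z) (y : Y) =>
    k (p.1, y) * f (y, p.2)) ?_
  exact (hk.comp_measurable (g := fun q : (X × Z) × Y => (q.1.1, q.2)) (by fun_prop)).mul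
    (hf.comp_measurable (g := fun q : (X × Z) × Y => (q.2, q.1.2)) (by fun_prop))

theorem eLpNorm_kernelFun_le {k : X × Y → ℂ} {f : Y × Z → ℂ} (hk : Measurable k)
    (hf : Measurable f) :
    eLpNorm (kernelFun ν k f) 2 (μ.prod τ) ≤ eLpNorm k 2 (μ.prod ν) * eLpNorm f 2 (ν.prod τ) := by
  rw [eLpNorm_eq_lintegral_rpow_enorm_toReal (by norm_num) (by norm_num),
    eLpNorm_eq_lintegral_rpow_enorm_toReal (by norm_num) (by norm_num),
    eLpNorm_eq_lintegral_rpow_enorm_toReal (by norm_num) (by norm_num),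
    ← ENNReal.mul_rpow_of_nonneg _ _ (by norm_num)]
  refine ENNReal.rpow_le_rpow ?_ (by norm_num)
  rw [ENNReal.toReal_ofNat]
  refine le_trans (lintegral_mono fun p => ?_) (lintegral_kernel_sq_le hk hf)
  refine ENNReal.rpow_le_rpow ((enorm_integral_le_lintegral_enorm _).trans_eq ?_) (by norm_num)
  simp only [enorm_mul]

theorem memLp_kernelFun (k : Lp ℂ 2 (μ.prod ν)) (f : Lp ℂ 2 (ν.prod τ)) :
    MemLp (kernelFun ν k f) 2 (μ.prod τ) :=
  ⟨(stronglyMeasurable_kernelFun (Lp.stronglyMeasurable k)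
      (Lp.stronglyMeasurable f)).aestronglyMeasurable,
    (eLpNorm_kernelFun_le (Lp.stronglyMeasurable k).measurable
      (Lp.stronglyMeasurable f).measurable).trans_lt
      (ENNReal.mul_lt_top (Lp.memLp k).2 (Lp.memLp f).2)⟩

theorem kernelFun_congr {k k' : X × Y → ℂ} {f f' : Y × Z → ℂ} (hk : k =ᵐ[μ.prod ν] k')
    (hf : f =ᵐ[ν.prod τ] f') : kernelFun ν k f =ᵐ[μ.prod τ] kernelFun ν k' f' := by
  filter_upwards [ae_kernel_congr hk hf] with p hp
  exact integral_congr_ae hp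

variable (μ ν τ) in
/-- The contraction of two square integrable functions over a common variable, as a bounded
bilinear operation. -/
def kernelL : Lp ℂ 2 (μ.prod ν) →L[ℂ] Lp ℂ 2 (ν.prod τ) →L[ℂ] Lp ℂ 2 (μ.prod τ) :=
  LinearMap.mkContinuous₂
    (LinearMap.mk₂ ℂ (fun k f => (memLp_kernelFun k f).toLp (kernelFun ν k f))
      (fun k k' f => by
        rw [← MemLp.toLp_add]
        refine MemLp.toLp_congr _ _ ?_
        filter_upwards [ae_integrable_kernel k f, ae_integrable_kernel k' f,
          ae_kernel_congr (Lp.coeFn_add k k') (Filter.EventuallyEq.refl _ f)] with p h1 h2 h3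
        rw [Pi.add_apply, kernelFun, kernelFun, kernelFun, ← integral_add h1 h2]
        refine integral_congr_ae (h3.trans (Filter.Eventually.of_forall fun y => ?_))
        exact add_mul _ _ _)
      (fun c k f => by
        rw [← MemLp.toLp_const_smul]
        refine MemLp.toLp_congr _ _ ?_
        filter_upwards [ae_kernel_congr (Lp.coeFn_smul c k) (Filter.EventuallyEq.refl _ f)]
          with p h3
        rw [Pi.smul_apply, kernelFun, kernelFun, ← integral_smul]
        refine integral_congr_ae (h3.trans (Filter.Eventually.of_forall fun y => ?_))
        exact smul_mul_assoc c (k (p.1, y)) _)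
      (fun k f f' => by
        rw [← MemLp.toLp_add]
        refine MemLp.toLp_congr _ _ ?_
        filter_upwards [ae_integrable_kernel k f, ae_integrable_kernel k f',
          ae_kernel_congr (Filter.EventuallyEq.refl _ k) (Lp.coeFn_add f f')] with p h1 h2 h3
        rw [Pi.add_apply, kernelFun, kernelFun, kernelFun, ← integral_add h1 h2]
        refine integral_congr_ae (h3.trans (Filter.Eventually.of_forall fun y => ?_))
        exact mul_add _ _ _)
      (fun c k f => by
        rw [← MemLp.toLp_const_smul]
        refine MemLp.toLp_congr _ _ ?_
        filter_upwards [ae_kernel_congr (Filter.EventuallyEq.refl _ k) (Lp.coeFn_smul c f)]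
          with p h3
        rw [Pi.smul_apply, kernelFun, kernelFun, ← integral_smul]
        refine integral_congr_ae (h3.trans (Filter.Eventually.of_forall fun y => ?_))
        exact mul_smul_comm c (k (p.1, y)) _))
    1 (fun k f => by
      rw [LinearMap.mk₂_apply, Lp.norm_toLp, one_mul, Lp.norm_def, Lp.norm_def,
        ← ENNReal.toReal_mul]
      exact ENNReal.toReal_mono (ENNReal.mul_lt_top (Lp.memLp k).2 (Lp.memLp f).2).ne
        (eLpNorm_kernelFun_le (Lp.stronglyMeasurable k).measurable
          (Lp.stronglyMeasurable f).measurable))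

theorem coeFn_kernelL (k : Lp ℂ 2 (μ.prod ν)) (f : Lp ℂ 2 (ν.prod τ)) :
    kernelL μ ν τ k f =ᵐ[μ.prod τ] kernelFun ν k f :=
  MemLp.coeFn_toLp (memLp_kernelFun k f)

/-- The composition with a measure preserving map, as a bounded operator. -/
def compL {μ : Measure X} {ν : Measure Y} (g : X → Y) (hg : MeasurePreserving g μ ν) :
    Lp ℂ 2 ν →L[ℂ] Lp ℂ 2 μ :=
  (Lp.compMeasurePreservingₗᵢ ℂ g hg).toContinuousLinearMap

theorem coeFn_compL {μ : Measure X} {ν : Measure Y} (g : X → Y) (hg : MeasurePreserving g μ ν)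
    (f : Lp ℂ 2 ν) : compL g hg f =ᵐ[μ] fun x => f (g x) :=
  Lp.coeFn_compMeasurePreserving f hg

theorem measurePreserving_mk_unit :
    MeasurePreserving (Prod.mk ()) τ ((Measure.dirac ()).prod τ) :=
  ⟨measurable_prodMk_left, (Measure.dirac_prod ()).symm⟩

variable (ν τ) in
/-- The contraction `z ↦ ∫ h(y) f(y, z) dy`, i.e. `kernelL` with a one-point space of variables `x`. -/
def contractL : Lp ℂ 2 ν →L[ℂ] Lp ℂ 2 (ν.prod τ) →L[ℂ] Lp ℂ 2 τ :=
  ((ContinuousLinearMap.compL ℂ _ _ _ (compL _ measurePreserving_mk_unit)).comp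
    (kernelL (Measure.dirac ()) ν τ)).comp (compL Prod.snd measurePreserving_snd)

variable (μ τ) in
/-- The tensor product of two square integrable functions, i.e. `kernelL` with a one-point space of
variables `y`. -/
def tensorL : Lp ℂ 2 μ →L[ℂ] Lp ℂ 2 τ →L[ℂ] Lp ℂ 2 (μ.prod τ) :=
  (((ContinuousLinearMap.compL ℂ _ _ _).flip (compL Prod.snd measurePreserving_snd)).comp
    (kernelL μ (Measure.dirac ()) τ)).comp (compL Prod.fst measurePreserving_fst)

theorem coeFn_contractL (h : Lp ℂ 2 ν) (f : Lp ℂ 2 (ν.prod τ)) {η : Y → ℂ} {φ : Y × Z → ℂ}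
    (hη : h =ᵐ[ν] η) (hφ : f =ᵐ[ν.prod τ] φ) :
    ∀ᵐ z ∂τ, Integrable (fun y => η y * φ (y, z)) ν ∧
      contractL ν τ h f z = ∫ y, η y * φ (y, z) ∂ν := by
  have h1 : compL Prod.snd measurePreserving_snd h =ᵐ[(Measure.dirac ()).prod ν]
      fun p => η p.2 :=
    (coeFn_compL _ measurePreserving_snd h).trans
      (measurePreserving_snd.quasiMeasurePreserving.ae_eq_comp hη)
  have hmk := (measurePreserving_mk_unit (τ := τ)).quasiMeasurePreserving
  filter_upwards [coeFn_compL _ measurePreserving_mk_unit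
      (kernelL (Measure.dirac ()) ν τ (compL Prod.snd measurePreserving_snd h) f),
    hmk.ae (coeFn_kernelL (compL Prod.snd measurePreserving_snd h) f),
    hmk.ae (ae_integrable_kernel (compL Prod.snd measurePreserving_snd h) f),
    hmk.ae (ae_kernel_congr h1 hφ)] with z e1 e2 e3 e4
  refine ⟨e3.congr e4, ?_⟩
  exact e1.trans (e2.trans (integral_congr_ae e4))

theorem coeFn_tensorL (h : Lp ℂ 2 μ) (f : Lp ℂ 2 τ) :
    tensorL μ τ h f =ᵐ[μ.prod τ] fun p => h p.1 * f p.2 := by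
  have h1 := coeFn_compL Prod.fst (measurePreserving_fst (μ := μ) (ν := Measure.dirac ())) h
  have h2 := coeFn_compL Prod.snd (measurePreserving_snd (μ := Measure.dirac ()) (ν := τ)) f
  refine (coeFn_kernelL _ _).trans ((kernelFun_congr h1 h2).trans ?_)
  refine Filter.Eventually.of_forall fun p => ?_
  simp [kernelFun]

/-- Tensoring with `h` is adjoint to the contraction with the complex conjugate of `h`, by Fubini's
theorem; the first equation is the iterated integral in the other order. -/
theorem inner_tensorL (h : Lp ℂ 2 μ) (f : Lp ℂ 2 τ) (F : Lp ℂ 2 (μ.prod τ)) {Φ : X × Z → ℂ}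
    (hΦ : F =ᵐ[μ.prod τ] Φ) :
    ⟪tensorL μ τ h f, F⟫_ℂ = ∫ x, conj (h x) * ∫ z, conj (f z) * Φ (x, z) ∂τ ∂μ ∧
    Integrable (fun x => conj (h x) * ∫ z, conj (f z) * Φ (x, z) ∂τ) μ ∧
    ⟪tensorL μ τ h f, F⟫_ℂ = ⟪f, contractL μ τ (star h) F⟫_ℂ := by
  have hI := L2.integrable_inner (𝕜 := ℂ) (tensorL μ τ h f) F
  have hE : (fun p => ⟪tensorL μ τ h f p, F p⟫_ℂ) =ᵐ[μ.prod τ]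
      fun p => conj (h p.1) * (conj (f p.2) * Φ p) := by
    filter_upwards [coeFn_tensorL h f, hΦ] with p h1 h2
    rw [RCLike.inner_apply, h1, h2, map_mul]
    ring
  have hI' := hI.congr hE
  rw [L2.inner_def, integral_congr_ae hE]
  refine ⟨?_, ?_, ?_⟩
  · rw [integral_prod _ hI']
    simp only [integral_const_mul]
  · simpa only [integral_const_mul] using hI'.integral_prod_left
  · rw [integral_prod_symm _ hI', L2.inner_def]
    have hs : ((star h : Lp ℂ 2 μ) : X → ℂ) =ᵐ[μ] fun x => conj (h x) := Lp.coeFn_star h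
    refine integral_congr_ae ?_
    filter_upwards [coeFn_contractL (star h) F hs hΦ] with z hz
    rw [RCLike.inner_apply, hz.2, ← integral_mul_const]
    refine integral_congr_ae (Filter.Eventually.of_forall fun x => ?_)
    change conj (h x) * (conj (f z) * Φ (x, z)) = _
    ring

/-- A square integrable function of two variables whose contractions with all square integrable
functions vanish is zero. -/
theorem eq_zero_of_contractL_eq_zero [SecondCountableTopology (Lp ℂ 2 ν)] {F : Lp ℂ 2 (ν.prod τ)}
    (hF : ∀ h, contractL ν τ h F = 0) : F = 0 := by
  -- the null sets depend on `h`, so only countably many test functions can be used at once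
  obtain ⟨s, hsc, hsd⟩ := TopologicalSpace.exists_countable_dense (Lp ℂ 2 ν)
  have h1 : ∀ᵐ z ∂τ, ∀ h ∈ s, ∫ y, h y * F (y, z) ∂ν = 0 := by
    rw [ae_ball_iff hsc]
    intro h _
    filter_upwards [coeFn_contractL h F (Filter.EventuallyEq.refl _ _)
      (Filter.EventuallyEq.refl _ _), Lp.coeFn_zero ℂ 2 τ] with z hz h0
    rw [← hz.2, hF, h0, Pi.zero_apply]
  have hm := (Lp.stronglyMeasurable F).measurable
  have h2 : ∀ᵐ z ∂τ, MemLp (fun y => F (y, z)) 2 ν := by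
    have hf2 : Measurable fun q => ‖F q‖ₑ ^ (2 : ℝ) := hm.enorm.pow_const _
    have hlt := lintegral_enorm_sq_lt_top F
    rw [lintegral_prod_symm _ hf2.aemeasurable] at hlt
    filter_upwards [ae_lt_top hf2.lintegral_prod_left' hlt.ne] with z hz
    refine ⟨(hm.comp measurable_prodMk_right).aestronglyMeasurable, ?_⟩
    rw [eLpNorm_eq_lintegral_rpow_enorm_toReal (by norm_num) (by norm_num)]
    refine ENNReal.rpow_lt_top_of_nonneg (by norm_num) ?_
    rw [ENNReal.toReal_ofNat]
    exact hz.ne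
  have h3 : ∀ᵐ z ∂τ, ∀ᵐ y ∂ν, F (y, z) = 0 := by
    filter_upwards [h1, h2] with z hz1 hz2
    have hg' : ((star (hz2.toLp _) : Lp ℂ 2 ν) : Y → ℂ) =ᵐ[ν] fun y => conj (F (y, z)) := by
      filter_upwards [Lp.coeFn_star (hz2.toLp _), MemLp.coeFn_toLp hz2] with y e1 e2
      rw [e1, Pi.star_apply, e2]; rfl
    have hg0 : (star (hz2.toLp _) : Lp ℂ 2 ν) = 0 := by
      refine hsd.eq_zero_of_inner_left ℂ fun h hh => ?_
      rw [L2.inner_def, ← hz1 h hh]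
      refine integral_congr_ae ?_
      filter_upwards [hg'] with y hy
      rw [RCLike.inner_apply, hy, RCLike.conj_conj]
    filter_upwards [hg', Lp.coeFn_zero ℂ 2 ν] with y e1 e2
    rw [hg0, e2, Pi.zero_apply] at e1
    simpa using e1.symm
  refine Lp.ext ?_
  refine (Filter.EventuallyEq.trans ?_ (Lp.coeFn_zero ℂ 2 _).symm)
  have : ∀ᵐ p ∂(τ.prod ν), F p.swap = 0 := by
    exact (Measure.ae_prod_iff_ae_ae (p := fun p : Z × Y => F p.swap = 0)
      (measurableSet_eq_fun (hm.comp measurable_swap) measurable_const)).2 h3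
  have := (Measure.measurePreserving_swap (μ := ν) (ν := τ)).quasiMeasurePreserving.ae this
  filter_upwards [this] with p hp
  simpa using hp

end Kernel

section BoundedMul

variable {X : Type*} [MeasurableSpace X] {μ : Measure X}

theorem memLp_bounded_mul {b : X → ℂ} (hb : Measurable b) {C : ℝ} (hC : ∀ x, ‖b x‖ ≤ C)
    (f : Lp ℂ 2 μ) : MemLp (fun x => b x * f x) 2 μ :=
  (Lp.memLp f).of_le_mul (hb.aestronglyMeasurable.mul (Lp.aestronglyMeasurable f))
    (Filter.Eventually.of_forall fun x => (norm_mul_le (b x) (f x)).trans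
      (mul_le_mul_of_nonneg_right (hC x) (norm_nonneg _)))

/-- The multiplication with a bounded measurable function. -/
def mulL (μ : Measure X) (b : X → ℂ) (hb : Measurable b) (C : ℝ) (hC : ∀ x, ‖b x‖ ≤ C) :
    Lp ℂ 2 μ →L[ℂ] Lp ℂ 2 μ :=
  LinearMap.mkContinuous
    ({ toFun := fun f => (memLp_bounded_mul hb hC f).toLp (fun x => b x * f x)
       map_add' := fun f g => by
        rw [← MemLp.toLp_add]
        refine MemLp.toLp_congr _ _ ?_
        filter_upwards [Lp.coeFn_add f g] with x hx
        rw [hx]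
        exact mul_add _ _ _
       map_smul' := fun c f => by
        rw [RingHom.id_apply, ← MemLp.toLp_const_smul]
        refine MemLp.toLp_congr _ _ ?_
        filter_upwards [Lp.coeFn_smul c f] with x hx
        rw [hx]
        exact mul_smul_comm c (b x) _ } : Lp ℂ 2 μ →ₗ[ℂ] Lp ℂ 2 μ) C
    fun f => by
      refine Lp.norm_le_mul_norm_of_ae_le_mul ?_
      refine (MemLp.coeFn_toLp (memLp_bounded_mul hb hC f)).mono fun x hx => ?_
      exact (congrArg norm hx).le.trans ((norm_mul_le _ _).trans
        (mul_le_mul_of_nonneg_right (hC x) (norm_nonneg _)))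

theorem coeFn_mulL (b : X → ℂ) (hb : Measurable b) (C : ℝ) (hC : ∀ x, ‖b x‖ ≤ C) (f : Lp ℂ 2 μ) :
    mulL μ b hb C hC f =ᵐ[μ] fun x => b x * f x :=
  MemLp.coeFn_toLp (memLp_bounded_mul hb hC f)

end BoundedMul

/-! ### Operators on square integrable waves -/

section TensorPower

variable {ι : Type*} [Fintype ι] [DecidableEq ι] {n m l : ℕ}

/-- The wave `φ` is a representative of the class `ψ`. -/
def IsRep (ψ : TensorPower ι n) (φ : Wave ι n) : Prop := ∀ᵐ x, ∀ α, ψ x α = φ x α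

theorem isRep_self (ψ : TensorPower ι n) : IsRep ψ (fun x α => ψ x α) :=
  Filter.Eventually.of_forall fun _ _ => rfl

theorem IsRep.ext {ψ ψ' : TensorPower ι n} {φ : Wave ι n} (h : IsRep ψ φ) (h' : IsRep ψ' φ) :
    ψ = ψ' := by
  refine Lp.ext ?_
  filter_upwards [h, h'] with x e e'
  ext α
  rw [e, e']

theorem IsRep.add {ψ ψ' : TensorPower ι n} {φ φ' : Wave ι n} (h : IsRep ψ φ) (h' : IsRep ψ' φ') :
    IsRep (ψ + ψ') (φ + φ') := by
  filter_upwards [h, h', Lp.coeFn_add ψ ψ'] with x e e' hx α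
  rw [hx, Pi.add_apply, PiLp.add_apply, e, e']
  rfl

theorem IsRep.smul (c : ℂ) {ψ : TensorPower ι n} {φ : Wave ι n} (h : IsRep ψ φ) :
    IsRep (c • ψ) (c • φ) := by
  filter_upwards [h, Lp.coeFn_smul c ψ] with x e hx α
  rw [hx, Pi.smul_apply, PiLp.smul_apply, e]
  rfl

theorem isRep_zero : IsRep (0 : TensorPower ι n) 0 := by
  filter_upwards [Lp.coeFn_zero (EuclideanSpace ℂ (Fin n → ι)) 2
    (volume : Measure (Fin n → ℝ))] with x hx α
  rw [hx]
  rfl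

theorem IsRep.sum {κ : Type*} (s : Finset κ) {ψ : κ → TensorPower ι n} {φ : κ → Wave ι n}
    (h : ∀ i, IsRep (ψ i) (φ i)) : IsRep (∑ i ∈ s, ψ i) (∑ i ∈ s, φ i) := by
  classical
  induction s using Finset.induction_on with
  | empty => simpa using isRep_zero
  | insert i s hi ih => rw [Finset.sum_insert hi, Finset.sum_insert hi]; exact (h i).add ih

/-- The bounded operator `A` is given by the operation `B` on representatives. -/
def Implements (A : TensorPower ι n →L[ℂ] TensorPower ι m) (B : Wave ι n →ₗ[ℂ] Wave ι m) : Prop :=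
  ∀ ψ φ, IsRep ψ φ → IsRep (A ψ) (B φ)

theorem Implements.ext {A A' : TensorPower ι n →L[ℂ] TensorPower ι m}
    {B B' : Wave ι n →ₗ[ℂ] Wave ι m} (h : Implements A B) (h' : Implements A' B') (e : B = B') :
    A = A' := by
  subst e
  exact ContinuousLinearMap.ext fun ψ => (h ψ _ (isRep_self ψ)).ext (h' ψ _ (isRep_self ψ))

theorem Implements.add {A A' : TensorPower ι n →L[ℂ] TensorPower ι m}
    {B B' : Wave ι n →ₗ[ℂ] Wave ι m} (h : Implements A B) (h' : Implements A' B') :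
    Implements (A + A') (B + B') := fun ψ φ r => (h ψ φ r).add (h' ψ φ r)

theorem Implements.smul (c : ℂ) {A : TensorPower ι n →L[ℂ] TensorPower ι m}
    {B : Wave ι n →ₗ[ℂ] Wave ι m} (h : Implements A B) :
    Implements (c • A) (c • B) := fun ψ φ r => (h ψ φ r).smul c

theorem implements_zero : Implements (0 : TensorPower ι n →L[ℂ] TensorPower ι m) 0 :=
  fun _ _ _ => isRep_zero

theorem Implements.sum {κ : Type*} (s : Finset κ) {A : κ → TensorPower ι n →L[ℂ] TensorPower ι m}
    {B : κ → Wave ι n →ₗ[ℂ] Wave ι m} (h : ∀ i, Implements (A i) (B i)) :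
    Implements (∑ i ∈ s, A i) (∑ i ∈ s, B i) := fun ψ φ r => by
  rw [_root_.sum_apply, LinearMap.sum_apply]
  exact IsRep.sum s fun i => h i ψ φ r

theorem Implements.mul {A A' : TensorPower ι n →L[ℂ] TensorPower ι n}
    {B B' : Module.End ℂ (Wave ι n)} (h : Implements A B) (h' : Implements A' B') :
    Implements (A * A') (B * B') := fun ψ φ r => h _ _ (h' ψ φ r)

theorem implements_one : Implements (1 : TensorPower ι n →L[ℂ] TensorPower ι n)
    (1 : Module.End ℂ (Wave ι n)) := fun _ _ r => r

theorem isRep_sum_apply {κ : Type*} [Fintype κ] {ψ : κ → TensorPower ι n} {φ : κ → Wave ι n}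
    (h : ∀ i, IsRep (ψ i) (φ i)) : IsRep (∑ i, ψ i) (fun x α => ∑ i, φ i x α) := by
  have := IsRep.sum Finset.univ h
  filter_upwards [this] with x hx α
  rw [hx, Finset.sum_apply, Finset.sum_apply]

/-- The component of a column of square integrable functions. -/
def compOp (γ : Fin n → ι) : TensorPower ι n →L[ℂ] Lp ℂ 2 (volume : Measure (Fin n → ℝ)) :=
  (EuclideanSpace.proj (𝕜 := ℂ) γ).compLpL 2 volume

theorem IsRep.compOp {ψ : TensorPower ι n} {φ : Wave ι n} (h : IsRep ψ φ) (γ : Fin n → ι) :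
    compOp γ ψ =ᵐ[volume] fun x => φ x γ := by
  filter_upwards [h, (EuclideanSpace.proj (𝕜 := ℂ) γ).coeFn_compLpL (p := 2) (μ := volume) ψ]
    with x e e'
  exact e'.trans (e γ)

/-- The column with a single non-zero entry. -/
def embOp (γ : Fin n → ι) : Lp ℂ 2 (volume : Measure (Fin n → ℝ)) →L[ℂ] TensorPower ι n :=
  (ContinuousLinearMap.toSpanSingleton ℂ
    (EuclideanSpace.single γ (1 : ℂ) : EuclideanSpace ℂ (Fin n → ι))).compLpL 2 volume

theorem isRep_embOp (γ : Fin n → ι) {f : Lp ℂ 2 (volume : Measure (Fin n → ℝ))}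
    {η : (Fin n → ℝ) → ℂ} (h : f =ᵐ[volume] η) :
    IsRep (embOp γ f) (fun x α => if α = γ then η x else 0) := by
  filter_upwards [h, (ContinuousLinearMap.toSpanSingleton ℂ
    (EuclideanSpace.single γ (1 : ℂ) : EuclideanSpace ℂ (Fin n → ι))).coeFn_compLpL (p := 2)
      (μ := volume) f] with x e e' α
  have e'' : embOp γ f x = f x • (EuclideanSpace.single γ (1 : ℂ) : EuclideanSpace ℂ (Fin n → ι)) :=
    e'
  rw [e'', PiLp.smul_apply, PiLp.single_apply, e, smul_eq_mul, mul_ite, mul_one, mul_zero]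

theorem inner_eq_integral (ψ ψ' : TensorPower ι n) {φ φ' : Wave ι n} (h : IsRep ψ φ)
    (h' : IsRep ψ' φ') : ⟪ψ, ψ'⟫_ℂ = ∫ x, star (φ x) ⬝ᵥ φ' x := by
  rw [L2.inner_def]
  refine integral_congr_ae ?_
  filter_upwards [h, h'] with x e e'
  rw [PiLp.inner_apply, dotProduct]
  refine Finset.sum_congr rfl fun α _ => ?_
  rw [RCLike.inner_apply, e, e', Pi.star_apply, mul_comm]
  rfl

theorem inner_embOp (γ : Fin n → ι) (f : Lp ℂ 2 (volume : Measure (Fin n → ℝ)))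
    (ψ : TensorPower ι n) : ⟪embOp γ f, ψ⟫_ℂ = ⟪f, compOp γ ψ⟫_ℂ := by
  rw [inner_eq_integral _ ψ (isRep_embOp γ (Filter.EventuallyEq.refl _ f)) (isRep_self ψ),
    L2.inner_def]
  refine integral_congr_ae ?_
  filter_upwards [(isRep_self ψ).compOp γ] with x e
  rw [e, RCLike.inner_apply, dotProduct, Finset.sum_eq_single γ]
  · rw [Pi.star_apply, if_pos rfl, mul_comm]; rfl
  · intro b _ hb
    rw [Pi.star_apply, if_neg hb, star_zero, zero_mul]
  · exact fun h => absurd (Finset.mem_univ _) h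

theorem eq_zero_of_compOp {ψ : TensorPower ι n} (h : ∀ γ, compOp γ ψ = 0) : ψ = 0 := by
  refine IsRep.ext ?_ isRep_zero
  have : ∀ γ, ∀ᵐ x, ψ x γ = 0 := fun γ => by
    filter_upwards [(isRep_self ψ).compOp γ, Lp.coeFn_zero ℂ 2
      (volume : Measure (Fin n → ℝ))] with x e e'
    rw [← e, h γ, e']; rfl
  exact ae_all_iff.2 this

/-- `x ↦ M x` has bounded measurable entries. -/
def IsBoundedMeasurable {X κ κ' : Type*} [MeasurableSpace X] (M : X → Matrix κ κ' ℂ) : Prop :=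
  ∀ a b, Measurable (fun x => M x a b) ∧ ∃ C : ℝ, ∀ x, ‖M x a b‖ ≤ C

theorem exists_implements_genWave {M : (Fin n → ℝ) → Matrix (Fin n → ι) (Fin n → ι) ℂ}
    (hM : IsBoundedMeasurable M) {g : (Fin n → ℝ) → (Fin n → ℝ)} (hg : MeasurePreserving g) :
    ∃ A : TensorPower ι n →L[ℂ] TensorPower ι n, Implements A (genWave M g) := by
  choose hm C hC using hM
  refine ⟨∑ γ, ∑ δ, embOp γ ∘L mulL volume _ (hm γ δ) (C γ δ) (hC γ δ) ∘L compL g hg ∘L compOp δ,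
    fun ψ φ h => ?_⟩
  simp only [_root_.sum_apply]
  have := isRep_sum_apply fun γ => isRep_sum_apply fun δ => isRep_embOp γ
    ((coeFn_mulL _ (hm γ δ) (C γ δ) (hC γ δ) (compL g hg (compOp δ ψ))).trans
      (((coeFn_compL g hg (compOp δ ψ)).trans
        (hg.quasiMeasurePreserving.ae_eq_comp (h.compOp δ))).mono fun x hx =>
          congrArg (M x γ δ * ·) hx))
  filter_upwards [this] with x hx α
  refine (hx α).trans ?_
  rw [genWave_apply, Matrix.mulVec, dotProduct,
    Finset.sum_eq_single α]
  · simp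
  · intro b _ hb
    simp [hb.symm]
  · exact fun h => absurd (Finset.mem_univ _) h

/-- The adjoint of a pull-back along an involution followed by a multiplication. -/
theorem inner_genWave {M N : (Fin n → ℝ) → Matrix (Fin n → ι) (Fin n → ι) ℂ}
    {g : (Fin n → ℝ) → (Fin n → ℝ)} (hg : MeasurePreserving g) (hgg : ∀ x, g (g x) = x)
    (hMN : ∀ x, (M (g x))ᴴ = N x) {A B : TensorPower ι n →L[ℂ] TensorPower ι n}
    (hA : Implements A (genWave M g)) (hB : Implements B (genWave N g)) (ψ ψ' : TensorPower ι n) :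
    ⟪A ψ, ψ'⟫_ℂ = ⟪ψ, B ψ'⟫_ℂ := by
  rw [inner_eq_integral _ _ (hA ψ _ (isRep_self ψ)) (isRep_self ψ'),
    inner_eq_integral _ _ (isRep_self ψ) (hB ψ' _ (isRep_self ψ'))]
  let e : (Fin n → ℝ) ≃ᵐ (Fin n → ℝ) :=
    { toFun := g, invFun := g, left_inv := hgg, right_inv := hgg,
      measurable_toFun := hg.measurable, measurable_invFun := hg.measurable }
  rw [← hg.integral_comp e.measurableEmbedding]
  refine integral_congr_ae (Filter.Eventually.of_forall fun x => ?_)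
  simp only [genWave_apply, hgg]
  rw [Matrix.star_mulVec, hMN, Matrix.dotProduct_mulVec]

end TensorPower

section Slots

variable {ι : Type*} [Fintype ι] [DecidableEq ι] {n m : ℕ} {X : Type} [MeasureSpace X]
  [SigmaFinite (volume : Measure X)]

/-- A bilinear operation composed with bounded operators on its second argument and its value. -/
def sandwich {V A B A' B' : Type*} [NormedAddCommGroup V] [NormedSpace ℂ V]
    [NormedAddCommGroup A] [NormedSpace ℂ A] [NormedAddCommGroup B] [NormedSpace ℂ B]
    [NormedAddCommGroup A'] [NormedSpace ℂ A'] [NormedAddCommGroup B'] [NormedSpace ℂ B']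
    (r : B →L[ℂ] B') (b : V →L[ℂ] A →L[ℂ] B) (l : A' →L[ℂ] A) : V →L[ℂ] A' →L[ℂ] B' :=
  ((ContinuousLinearMap.compL ℂ A' A B').flip l) ∘L (ContinuousLinearMap.compL ℂ A B B' r) ∘L b

theorem sandwich_apply {V A B A' B' : Type*} [NormedAddCommGroup V] [NormedSpace ℂ V]
    [NormedAddCommGroup A] [NormedSpace ℂ A] [NormedAddCommGroup B] [NormedSpace ℂ B]
    [NormedAddCommGroup A'] [NormedSpace ℂ A'] [NormedAddCommGroup B'] [NormedSpace ℂ B']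
    (r : B →L[ℂ] B') (b : V →L[ℂ] A →L[ℂ] B) (l : A' →L[ℂ] A) (x : V) (y : A') :
    sandwich r b l x y = r (b x (l y)) := rfl

variable (e : (Fin m → ℝ) ≃ᵐ X × (Fin n → ℝ)) (he : MeasurePreserving e)
  (J : (Fin n → ι) → (Fin m → ι))

/-- Tensoring with a function of the variables in `X`, after splitting the variables with `e`;
the indices `J γ` are those of the product with the component `γ`. -/
def tensorOp : Lp ℂ 2 (volume : Measure X) →L[ℂ] TensorPower ι n →L[ℂ] TensorPower ι m :=
  ∑ γ, sandwich (embOp (J γ) ∘L compL e he) (tensorL volume volume) (compOp γ)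

/-- Contracting with a function of the variables in `X`, after splitting the variables with `e`. -/
def contractOp : Lp ℂ 2 (volume : Measure X) →L[ℂ] TensorPower ι m →L[ℂ] TensorPower ι n :=
  ∑ γ, sandwich (embOp γ) (contractL volume volume) (compL e.symm (he.symm e) ∘L compOp (J γ))

theorem isRep_tensorOp {h : Lp ℂ 2 (volume : Measure X)} {η : X → ℂ} (hη : h =ᵐ[volume] η)
    {ψ : TensorPower ι n} {φ : Wave ι n} (hφ : IsRep ψ φ) :
    IsRep (tensorOp e he J h ψ)
      (fun x α => ∑ γ, if α = J γ then η (e x).1 * φ (e x).2 γ else 0) := by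
  simp only [tensorOp, _root_.sum_apply, sandwich_apply]
  refine isRep_sum_apply fun γ => isRep_embOp (J γ) ?_
  have ht : tensorL volume volume h (compOp γ ψ) =ᵐ[volume] fun p => η p.1 * φ p.2 γ := ?_
  · exact (coeFn_compL e he _).trans (he.quasiMeasurePreserving.ae_eq_comp ht)
  refine (coeFn_tensorL h (compOp γ ψ)).trans ?_
  filter_upwards [Measure.quasiMeasurePreserving_fst.ae hη,
    Measure.quasiMeasurePreserving_snd.ae (hφ.compOp γ)] with p e1 e2
  rw [e1, e2]

theorem isRep_compL_symm {ψ : TensorPower ι m} {φ : Wave ι m} (hφ : IsRep ψ φ) (γ : Fin m → ι) :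
    compL e.symm (he.symm e) (compOp γ ψ) =ᵐ[volume] fun p => φ (e.symm p) γ :=
  (coeFn_compL e.symm (he.symm e) _).trans
    ((he.symm e).quasiMeasurePreserving.ae_eq_comp (hφ.compOp γ))

theorem contractOp_apply_ae {h : Lp ℂ 2 (volume : Measure X)} {η : X → ℂ} (hη : h =ᵐ[volume] η)
    {ψ : TensorPower ι m} {φ : Wave ι m} (hφ : IsRep ψ φ) :
    ∀ᵐ x, ∀ γ, Integrable (fun y => η y * φ (e.symm (y, x)) (J γ)) ∧
      contractOp e he J h ψ x γ = ∫ y, η y * φ (e.symm (y, x)) (J γ) := by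
  have h1 := fun γ => coeFn_contractL h _ hη (isRep_compL_symm e he hφ (J γ))
  have h2 : IsRep (contractOp e he J h ψ) (fun x α => ∑ γ, if α = γ then
      contractL volume volume h (compL e.symm (he.symm e) (compOp (J γ) ψ)) x else 0) := by
    simp only [contractOp, _root_.sum_apply, sandwich_apply]
    exact isRep_sum_apply fun γ => isRep_embOp γ (Filter.EventuallyEq.refl _ _)
  filter_upwards [ae_all_iff.2 h1, h2] with x hx hx' γ
  refine ⟨(hx γ).1, (hx' γ).trans ?_⟩
  rw [Finset.sum_ite_eq, if_pos (Finset.mem_univ _)]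
  exact (hx γ).2

theorem inner_compL_equiv (F : Lp ℂ 2 (volume : Measure (X × (Fin n → ℝ))))
    (G : Lp ℂ 2 (volume : Measure (Fin m → ℝ))) :
    ⟪compL e he F, G⟫_ℂ = ⟪F, compL e.symm (he.symm e) G⟫_ℂ := by
  rw [L2.inner_def, L2.inner_def, ← he.integral_comp e.measurableEmbedding]
  refine integral_congr_ae ?_
  filter_upwards [coeFn_compL e he F,
    he.quasiMeasurePreserving.ae (coeFn_compL e.symm (he.symm e) G)] with x e1 e2
  rw [e1, e2, MeasurableEquiv.symm_apply_apply]

theorem inner_tensorOp_eq_sum (h : Lp ℂ 2 (volume : Measure X)) (w : TensorPower ι n)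
    (ψ : TensorPower ι m) : ⟪tensorOp e he J h w, ψ⟫_ℂ =
      ∑ γ, ⟪tensorL volume volume h (compOp γ w), compL e.symm (he.symm e) (compOp (J γ) ψ)⟫_ℂ := by
  simp only [tensorOp, _root_.sum_apply, sandwich_apply, sum_inner]
  refine Finset.sum_congr rfl fun γ _ => ?_
  rw [ContinuousLinearMap.comp_apply, inner_embOp, inner_compL_equiv]

theorem inner_tensorOp (h : Lp ℂ 2 (volume : Measure X)) (w : TensorPower ι n)
    (ψ : TensorPower ι m) :
    ⟪tensorOp e he J h w, ψ⟫_ℂ = ⟪w, contractOp e he J (star h) ψ⟫_ℂ := by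
  rw [inner_tensorOp_eq_sum]
  simp only [contractOp, _root_.sum_apply, sandwich_apply, inner_sum]
  refine Finset.sum_congr rfl fun γ _ => ?_
  rw [(inner_tensorL h _ _ (Filter.EventuallyEq.refl _ _)).2.2, ← inner_conj_symm w,
    inner_embOp, inner_conj_symm]
  rfl

/-- The scalar product with a tensor product, as an iterated integral. -/
theorem inner_tensorOp_eq_integral (h : Lp ℂ 2 (volume : Measure X)) (w : TensorPower ι n)
    {ψ : TensorPower ι m} {φ : Wave ι m} (hφ : IsRep ψ φ) :
    ⟪tensorOp e he J h w, ψ⟫_ℂ =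
      ∫ y, conj (h y) * ∑ γ, ∫ x, conj (w x γ) * φ (e.symm (y, x)) (J γ) := by
  rw [inner_tensorOp_eq_sum]
  have h1 := fun γ => inner_tensorL h (compOp γ w) _ (isRep_compL_symm e he hφ (J γ))
  have h2 : ∀ γ y, ∫ x, conj (compOp γ w x) * φ (e.symm (y, x)) (J γ) =
      ∫ x, conj (w x γ) * φ (e.symm (y, x)) (J γ) := fun γ y => by
    refine integral_congr_ae ?_
    filter_upwards [(isRep_self w).compOp γ] with x hx
    rw [hx]
  simp only [h2] at h1
  simp only [Finset.mul_sum]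
  rw [integral_finsetSum _ fun γ _ => (h1 γ).2.1]
  exact Finset.sum_congr rfl fun γ _ => (h1 γ).1

end Slots

/-! ### Creation, annihilation and exchange kernels on the tensor powers -/

section Creation

variable {ι : Type*} [Fintype ι] [DecidableEq ι] {n m : ℕ}

theorem Implements.comp {l : ℕ} {A : TensorPower ι m →L[ℂ] TensorPower ι l}
    {A' : TensorPower ι n →L[ℂ] TensorPower ι m} {B : Wave ι m →ₗ[ℂ] Wave ι l}
    {B' : Wave ι n →ₗ[ℂ] Wave ι m} (h : Implements A B) (h' : Implements A' B') :
    Implements (A ∘L A') (B ∘ₗ B') := fun ψ φ r => h _ _ (h' ψ φ r)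

/-- Splitting off the first spectral parameter. -/
def headEquiv (n : ℕ) : (Fin (n + 1) → ℝ) ≃ᵐ ℝ × (Fin n → ℝ) :=
  MeasurableEquiv.piFinSuccAbove (fun _ => ℝ) 0

theorem headEquiv_apply (x : Fin (n + 1) → ℝ) : headEquiv n x = (x 0, Fin.tail x) := by
  refine Prod.ext rfl ?_
  funext j
  rfl

theorem headEquiv_symm_apply (p : ℝ × (Fin n → ℝ)) :
    (headEquiv n).symm p = (Fin.cons p.1 p.2 : Fin (n + 1) → ℝ) := by
  rw [MeasurableEquiv.symm_apply_eq, headEquiv_apply, Fin.cons_zero, Fin.tail_cons]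

theorem measurePreserving_headEquiv (n : ℕ) : MeasurePreserving (headEquiv n) :=
  volume_preserving_piFinSuccAbove (fun _ => ℝ) 0

/-- Splitting off the first two spectral parameters. -/
def headPairEquiv (n : ℕ) : (Fin (n + 2) → ℝ) ≃ᵐ (ℝ × ℝ) × (Fin n → ℝ) :=
  (headEquiv (n + 1)).trans
    (((MeasurableEquiv.refl ℝ).prodCongr (headEquiv n)).trans MeasurableEquiv.prodAssoc.symm)

theorem headPairEquiv_apply (x : Fin (n + 2) → ℝ) :
    headPairEquiv n x = ((x 0, x 1), Fin.tail (Fin.tail x)) := rfl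

theorem measurePreserving_headPairEquiv (n : ℕ) : MeasurePreserving (headPairEquiv n) :=
  (volume_preserving_prodAssoc.symm _).comp
    (((MeasurePreserving.id volume).prod (measurePreserving_headEquiv n)).comp
      (measurePreserving_headEquiv (n + 1)))

/-- Creation of a particle of index `a` in the first slot, without symmetrization. -/
def createOp (n : ℕ) (a : ι) : L2One →L[ℂ] TensorPower ι n →L[ℂ] TensorPower ι (n + 1) :=
  tensorOp (headEquiv n) (measurePreserving_headEquiv n) (fun γ => Fin.cons a γ)

/-- Annihilation of a particle of index `a` in the first slot. -/
def annihOp (n : ℕ) (a : ι) : L2One →L[ℂ] TensorPower ι (n + 1) →L[ℂ] TensorPower ι n :=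
  contractOp (headEquiv n) (measurePreserving_headEquiv n) (fun γ => Fin.cons a γ)

/-- Creation of two particles of indices `a`, `b` in the first two slots. -/
def createPairOp (n : ℕ) (a b : ι) : L2Two →L[ℂ] TensorPower ι n →L[ℂ] TensorPower ι (n + 2) :=
  tensorOp (headPairEquiv n) (measurePreserving_headPairEquiv n)
    (fun γ => Fin.cons a (Fin.cons b γ : Fin (n + 1) → ι))

/-- Annihilation of two particles of indices `a`, `b` in the first two slots. -/
def annihPairOp (n : ℕ) (a b : ι) : L2Two →L[ℂ] TensorPower ι (n + 2) →L[ℂ] TensorPower ι n :=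
  contractOp (headPairEquiv n) (measurePreserving_headPairEquiv n)
    (fun γ => Fin.cons a (Fin.cons b γ : Fin (n + 1) → ι))

/-- The integral kernel `k`, acting on the first slot and mapping the index `a` to the index `b`. -/
def kernelOp (n : ℕ) (b a : ι) :
    L2Two →L[ℂ] TensorPower ι (n + 1) →L[ℂ] TensorPower ι (n + 1) :=
  ∑ γ : Fin n → ι, sandwich
    (embOp (Fin.cons b γ) ∘L compL (headEquiv n) (measurePreserving_headEquiv n))
    (kernelL volume volume volume)
    (compL (headEquiv n).symm ((measurePreserving_headEquiv n).symm (headEquiv n)) ∘L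
      compOp (Fin.cons a γ))

theorem sum_ite_eq_cons {M : Type*} [AddCommMonoid M] (α : Fin (n + 1) → ι) (a : ι)
    (F : (Fin n → ι) → M) :
    (∑ γ : Fin n → ι, if α = Fin.cons a γ then F γ else 0) =
      if α 0 = a then F (Fin.tail α) else 0 := by
  have h : ∀ γ : Fin n → ι, (α = (Fin.cons a γ : Fin (n + 1) → ι)) ↔ (α 0 = a ∧ Fin.tail α = γ) :=
    fun γ => by
      constructor
      · rintro rfl; exact ⟨rfl, rfl⟩
      · rintro ⟨rfl, rfl⟩; exact (Fin.cons_self_tail α).symm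
  simp only [h]
  by_cases h0 : α 0 = a
  · simp [h0]
  · simp [h0]

theorem implements_createOp (a : ι) {h : L2One} {η : ℝ → ℂ} (hη : h =ᵐ[volume] η) :
    Implements (createOp n a h) (createWave n a η) := fun ψ φ hφ => by
  filter_upwards [isRep_tensorOp (headEquiv n) (measurePreserving_headEquiv n)
    (fun γ => Fin.cons a γ) hη hφ] with x hx α
  refine (hx α).trans ?_
  rw [sum_ite_eq_cons, headEquiv_apply]
  change _ = (if α 0 = a then η (x 0) else 0) * φ (Fin.tail x) (Fin.tail α)
  rw [ite_mul, zero_mul]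

theorem implements_createPairOp (a b : ι) {h : L2Two} {η : ℝ × ℝ → ℂ} (hη : h =ᵐ[volume] η) :
    Implements (createPairOp n a b h) (createPairWave n a b η) := fun ψ φ hφ => by
  filter_upwards [isRep_tensorOp (headPairEquiv n) (measurePreserving_headPairEquiv n)
    (fun γ => Fin.cons a (Fin.cons b γ : Fin (n + 1) → ι)) hη hφ] with x hx α
  refine (hx α).trans ?_
  have h2 : ∀ γ : Fin n → ι, (α = Fin.cons a (Fin.cons b γ : Fin (n + 1) → ι)) ↔
      (α 0 = a ∧ Fin.tail α = (Fin.cons b γ : Fin (n + 1) → ι)) := fun γ => by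
    constructor
    · rintro rfl; exact ⟨rfl, rfl⟩
    · rintro ⟨rfl, h⟩; rw [← h]; exact (Fin.cons_self_tail α).symm
  simp only [h2, ite_and]
  change _ = (if α 0 = a ∧ α 1 = b then η (x 0, x 1) else 0) *
    φ (Fin.tail (Fin.tail x)) (Fin.tail (Fin.tail α))
  by_cases h0 : α 0 = a
  · simp only [h0, if_true, true_and]
    rw [sum_ite_eq_cons, headPairEquiv_apply, ite_mul, zero_mul]
    rfl
  · simp [h0]

theorem annihOp_apply_ae (a : ι) {h : L2One} {η : ℝ → ℂ} (hη : h =ᵐ[volume] η)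
    {ψ : TensorPower ι (n + 1)} {φ : Wave ι (n + 1)} (hφ : IsRep ψ φ) :
    ∀ᵐ x, ∀ γ, Integrable (fun z => η z * slice z a φ x γ) ∧
      annihOp n a h ψ x γ = ∫ z, η z * slice z a φ x γ := by
  filter_upwards [contractOp_apply_ae (headEquiv n) (measurePreserving_headEquiv n)
    (fun γ => Fin.cons a γ) hη hφ] with x hx γ
  have := hx γ
  simp only [headEquiv_symm_apply] at this
  exact this

theorem isRep_annihOp (a : ι) {h : L2One} {η : ℝ → ℂ} (hη : h =ᵐ[volume] η)
    {ψ : TensorPower ι (n + 1)} {φ : Wave ι (n + 1)} (hφ : IsRep ψ φ) :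
    IsRep (annihOp n a h ψ) (fun x γ => ∫ z, η z * slice z a φ x γ) :=
  (annihOp_apply_ae a hη hφ).mono fun _ hx γ => (hx γ).2

theorem inner_createOp (a : ι) (h : L2One) (w : TensorPower ι n) (ψ : TensorPower ι (n + 1)) :
    ⟪createOp n a h w, ψ⟫_ℂ = ⟪w, annihOp n a (star h) ψ⟫_ℂ :=
  inner_tensorOp _ _ _ h w ψ

theorem inner_createPairOp (a b : ι) (h : L2Two) (w : TensorPower ι n)
    (ψ : TensorPower ι (n + 2)) :
    ⟪createPairOp n a b h w, ψ⟫_ℂ = ⟪w, annihPairOp n a b (star h) ψ⟫_ℂ :=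
  inner_tensorOp _ _ _ h w ψ

/-- The scalar product with a column is the sum over its components. -/
theorem sum_integral_eq_inner (w : TensorPower ι n) {ψ : TensorPower ι n} {φ : Wave ι n}
    (h : IsRep ψ φ) : ∑ γ, ∫ x, conj (w x γ) * φ x γ = ⟪w, ψ⟫_ℂ := by
  rw [inner_eq_integral w ψ (isRep_self w) h]
  simp only [dotProduct]
  rw [integral_finsetSum]
  · rfl
  · intro γ _
    refine (L2.integrable_inner (𝕜 := ℂ) (compOp γ w) (compOp γ ψ)).congr ?_
    filter_upwards [(isRep_self w).compOp γ, h.compOp γ] with x e1 e2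
    rw [RCLike.inner_apply, e1, e2, mul_comm]
    rfl

theorem inner_annihOp_eq_integral (a : ι) (f : L2One) (w : TensorPower ι n)
    {ψ : TensorPower ι (n + 1)} {φ : Wave ι (n + 1)} (hφ : IsRep ψ φ) :
    ⟪w, annihOp n a f ψ⟫_ℂ =
      ∫ z, f z * ∑ γ, ∫ x, conj (w x γ) * slice z a φ x γ := by
  have h1 := inner_createOp a (star f) w ψ
  rw [star_star] at h1
  rw [← h1]
  refine (inner_tensorOp_eq_integral (headEquiv n) (measurePreserving_headEquiv n)
    (fun γ => Fin.cons a γ) (star f) w hφ).trans ?_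
  refine integral_congr_ae ?_
  filter_upwards [Lp.coeFn_star f] with z hz
  rw [hz]
  simp only [headEquiv_symm_apply, Pi.star_apply, RCLike.star_def, RCLike.conj_conj]
  rfl

/-- A column orthogonal to all products is zero. -/
theorem eq_zero_of_inner_createOp {ψ : TensorPower ι (n + 1)}
    (h : ∀ a f w, ⟪createOp n a f w, ψ⟫_ℂ = 0) : ψ = 0 := by
  have h1 : ∀ a f, annihOp n a f ψ = 0 := fun a f => by
    have := h a (star f) (annihOp n a f ψ)
    rw [inner_createOp, star_star] at this
    exact inner_self_eq_zero.1 this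
  have : Fact ((2 : ℝ≥0∞) ≠ ∞) := ⟨by norm_num⟩
  refine eq_zero_of_compOp fun γ => ?_
  set F := compL (headEquiv n).symm ((measurePreserving_headEquiv n).symm (headEquiv n))
    (compOp γ ψ) with hF
  have hF0 : F = 0 := by
    refine eq_zero_of_contractL_eq_zero (ν := (volume : Measure ℝ))
      (τ := (volume : Measure (Fin n → ℝ))) fun f => ?_
    refine Lp.ext ?_
    filter_upwards [coeFn_contractL f F (Filter.EventuallyEq.refl _ _)
        (isRep_compL_symm (headEquiv n) (measurePreserving_headEquiv n) (isRep_self ψ) γ),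
      isRep_annihOp (γ 0) (Filter.EventuallyEq.refl _ f) (isRep_self ψ), isRep_zero (ι := ι),
      Lp.coeFn_zero ℂ 2 (volume : Measure (Fin n → ℝ))] with x e1 e2 e3 e4
    rw [e1.2, e4]
    have := e2 (Fin.tail γ)
    rw [h1, e3] at this
    refine Eq.trans ?_ this.symm
    simp only [headEquiv_symm_apply, slice_apply, Fin.cons_self_tail]
  have hback := coeFn_compL (headEquiv n).symm
    ((measurePreserving_headEquiv n).symm (headEquiv n)) (compOp γ ψ)
  rw [← hF, hF0] at hback
  refine Lp.ext ?_
  have h2 := (measurePreserving_headEquiv n).quasiMeasurePreserving.ae hback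
  have h3 := (measurePreserving_headEquiv n).quasiMeasurePreserving.ae
    (Lp.coeFn_zero ℂ 2 (volume : Measure (ℝ × (Fin n → ℝ))))
  filter_upwards [h2, h3, Lp.coeFn_zero ℂ 2 (volume : Measure (Fin (n + 1) → ℝ))] with x e2 e3 e4
  rw [e4, Pi.zero_apply, ← (headEquiv n).symm_apply_apply x, ← e2, e3]
  rfl

/-- The integrals that define `kernelOp` converge, also when representatives are used. -/
theorem kernelOp_apply_ae (b a : ι) {k : L2Two} {κ : ℝ × ℝ → ℂ} (hκ : k =ᵐ[volume] κ)
    {ψ : TensorPower ι (n + 1)} {φ : Wave ι (n + 1)} (hφ : IsRep ψ φ) :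
    ∀ᵐ x, ∀ γ : Fin (n + 1) → ι,
      Integrable (fun z => κ (x 0, z) * slice z a φ (Fin.tail x) (Fin.tail γ)) ∧
      kernelOp n b a k ψ x γ =
        if γ 0 = b then ∫ z, κ (x 0, z) * slice z a φ (Fin.tail x) (Fin.tail γ) else 0 := by
  have he := measurePreserving_headEquiv n
  have hc := fun γ : Fin n → ι => isRep_compL_symm (headEquiv n) he hφ (Fin.cons a γ)
  have h1 := fun γ : Fin n → ι => he.quasiMeasurePreserving.ae (ae_integrable_kernel k
    (compL (headEquiv n).symm (he.symm (headEquiv n)) (compOp (Fin.cons a γ) ψ)))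
  have h2 := fun γ : Fin n → ι => he.quasiMeasurePreserving.ae (ae_kernel_congr hκ (hc γ))
  have h3 : IsRep (kernelOp n b a k ψ) (fun x α => ∑ γ : Fin n → ι,
      if α = Fin.cons b γ then kernelFun volume κ
        (fun p => φ ((headEquiv n).symm p) (Fin.cons a γ)) (headEquiv n x) else 0) := by
    simp only [kernelOp, _root_.sum_apply, sandwich_apply]
    refine isRep_sum_apply fun γ => isRep_embOp _ ?_
    refine (coeFn_compL _ he _).trans ?_
    have h4 := (coeFn_kernelL k (compL (headEquiv n).symm (he.symm (headEquiv n))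
      (compOp (Fin.cons a γ) ψ))).trans (kernelFun_congr hκ (hc γ))
    exact he.quasiMeasurePreserving.ae_eq_comp h4
  filter_upwards [ae_all_iff.2 h1, ae_all_iff.2 h2, h3] with x e1 e2 e3 γ
  have e1' := (e1 (Fin.tail γ)).congr (e2 (Fin.tail γ))
  simp only [headEquiv_symm_apply, headEquiv_apply] at e1'
  refine ⟨e1', ?_⟩
  rw [e3, sum_ite_eq_cons]
  simp only [kernelFun, headEquiv_symm_apply, headEquiv_apply]
  rfl

/-- A kernel of rank one is annihilation followed by creation. -/
theorem kernelOp_eq_comp (b a : ι) {f g : L2One} {k : L2Two}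
    (hk : k =ᵐ[volume] fun p => f p.1 * g p.2) (ψ : TensorPower ι (n + 1)) :
    kernelOp n b a k ψ = createOp n b f (annihOp n a g ψ) := by
  refine IsRep.ext (φ := fun x γ => if γ 0 = b then
    ∫ z, (f (x 0) * g z) * slice z a (fun x α => ψ x α) (Fin.tail x) (Fin.tail γ) else 0)
    ((kernelOp_apply_ae b a hk (isRep_self ψ)).mono fun x hx γ => (hx γ).2) ?_
  have := implements_createOp b (Filter.EventuallyEq.refl _ f) _ _
    (isRep_annihOp a (Filter.EventuallyEq.refl _ g) (isRep_self ψ))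
  filter_upwards [this] with x hx γ
  rw [hx]
  simp only [mul_assoc, integral_const_mul]
  change (if γ 0 = b then f (x 0) else 0) * _ = _
  rw [ite_mul, zero_mul]

end Creation

/-! ### The representations of the Weyl groups on the tensor powers -/

section Bounded

variable {ι : Type*} [Fintype ι] [DecidableEq ι] {n m : ℕ} {X : Type*} [MeasurableSpace X]

theorem IsBoundedMeasurable.mul {κ κ' κ'' : Type*} [Fintype κ'] {M : X → Matrix κ κ' ℂ}
    {N : X → Matrix κ' κ'' ℂ} (hM : IsBoundedMeasurable M) (hN : IsBoundedMeasurable N) :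
    IsBoundedMeasurable (fun x => M x * N x) := fun a b => by
  choose hm C hC using hM
  choose hn D hD using hN
  simp only [Matrix.mul_apply]
  refine ⟨Finset.measurable_sum _ fun c _ => (hm a c).mul (hn c b), ∑ c, C a c * D c b,
    fun x => (norm_sum_le _ _).trans (Finset.sum_le_sum fun c _ => ?_)⟩
  rw [norm_mul]
  exact mul_le_mul (hC a c x) (hD c b x) (norm_nonneg _) ((norm_nonneg _).trans (hC a c x))

theorem isBoundedMeasurable_const {κ κ' : Type*} (M : Matrix κ κ' ℂ) :
    IsBoundedMeasurable (fun _ : X => M) := fun a b => ⟨measurable_const, ‖M a b‖, fun _ => le_rfl⟩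

theorem IsBoundedMeasurable.onPair {M : X → Matrix (ι × ι) (ι × ι) ℂ} (hM : IsBoundedMeasurable M)
    (i j : Fin m) : IsBoundedMeasurable (fun x => onPair i j (M x)) := fun α β => by
  simp only [RTAlgebra.onPair]
  split_ifs
  · exact hM _ _
  · exact ⟨measurable_const, 0, fun _ => by simp⟩

theorem IsBoundedMeasurable.onSlot {M : X → Matrix ι ι ℂ} (hM : IsBoundedMeasurable M)
    (i : Fin m) : IsBoundedMeasurable (fun x => onSlot i (M x)) := fun α β => by
  simp only [RTAlgebra.onSlot]
  split_ifs
  · exact hM _ _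
  · exact ⟨measurable_const, 0, fun _ => by simp⟩

theorem IsBoundedMeasurable.list_prod {κ : Type*} [Fintype κ] [DecidableEq κ] :
    ∀ {L : List (X → Matrix κ κ ℂ)}, (∀ M ∈ L, IsBoundedMeasurable M) →
      IsBoundedMeasurable (fun x => (L.map fun M => M x).prod)
  | [], _ => isBoundedMeasurable_const 1
  | M :: L, h => by
    simp only [List.map_cons, List.prod_cons]
    exact (h M List.mem_cons_self).mul
      (IsBoundedMeasurable.list_prod fun N hN => h N (List.mem_cons_of_mem _ hN))

variable {S : ℝ → ℝ → Matrix (ι × ι) (ι × ι) ℂ} {R T : ℝ → Matrix ι ι ℂ}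

theorem IsExchangeFactor.isBoundedMeasurable (hS : IsExchangeFactor S) {u v : X → ℝ}
    (hu : Measurable u) (hv : Measurable v) : IsBoundedMeasurable (fun x => S (u x) (v x)) :=
  fun a b => ⟨(hS.measurable a b).comp (hu.prodMk hv), hS.bounded.choose,
    fun _ => hS.bounded.choose_spec _ _ a b⟩

theorem IsAdmissiblePair.isBoundedMeasurable_R (hRT : IsAdmissiblePair S R T) {u : X → ℝ}
    (hu : Measurable u) : IsBoundedMeasurable (fun x => R (u x)) :=
  fun a b => ⟨(hRT.measurable_R a b).comp hu, hRT.bounded_R.choose,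
    fun _ => hRT.bounded_R.choose_spec _ a b⟩

theorem IsAdmissiblePair.isBoundedMeasurable_T (hRT : IsAdmissiblePair S R T) {u : X → ℝ}
    (hu : Measurable u) : IsBoundedMeasurable (fun x => T (u x)) :=
  fun a b => ⟨(hRT.measurable_T a b).comp hu, hRT.bounded_T.choose,
    fun _ => hRT.bounded_T.choose_spec _ a b⟩

theorem IsExchangeFactor.isBoundedMeasurable_dressing (hS : IsExchangeFactor S)
    {M : X → Matrix ι ι ℂ} (hM : IsBoundedMeasurable M) {u v : X → ℝ} (hu : Measurable u)
    (hv : Measurable v) {y : X → Fin n → ℝ} (hy : Measurable y) (a b : ι) :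
    IsBoundedMeasurable (fun x => block (dressing S (M x) (u x) (v x) (y x)) a b) := by
  have hyk : ∀ k, Measurable fun x => y x k := fun k => (measurable_pi_apply k).comp hy
  have h1 : IsBoundedMeasurable fun x => (List.ofFn fun k : Fin n =>
      RTAlgebra.onPair k.castSucc k.succ (S (u x) (y x k))).prod := by
    have := IsBoundedMeasurable.list_prod (L := List.ofFn fun k : Fin n => fun x =>
      RTAlgebra.onPair k.castSucc k.succ (S (u x) (y x k))) fun N hN => by
        obtain ⟨k, rfl⟩ := (List.mem_ofFn' _ _).1 hN
        exact (hS.isBoundedMeasurable hu (hyk k)).onPair _ _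
    simpa only [List.map_ofFn, Function.comp_def] using this
  have h2 : IsBoundedMeasurable fun x => (List.ofFn fun k : Fin n =>
      RTAlgebra.onPair k.castSucc k.succ (S (y x k) (v x))).reverse.prod := by
    have := IsBoundedMeasurable.list_prod (L := (List.ofFn fun k : Fin n => fun x =>
      RTAlgebra.onPair k.castSucc k.succ (S (y x k) (v x))).reverse) fun N hN => by
        obtain ⟨k, rfl⟩ := (List.mem_ofFn' _ _).1 (List.mem_reverse.1 hN)
        exact (hS.isBoundedMeasurable (hyk k) hv).onPair _ _
    simpa only [List.map_reverse, List.map_ofFn, Function.comp_def] using this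
  exact fun α β => ((h1.mul (hM.onSlot (Fin.last n))).mul h2) _ _

theorem measurePreserving_comp_swap (i j : Fin n) :
    MeasurePreserving (fun x : Fin n → ℝ => x ∘ Equiv.swap i j) := by
  have h : (fun x : Fin n → ℝ => x ∘ Equiv.swap i j) =
      MeasurableEquiv.piCongrLeft (fun _ : Fin n => ℝ) (Equiv.swap i j) := ?_
  · rw [h]
    exact volume_measurePreserving_piCongrLeft (fun _ : Fin n => ℝ) (Equiv.swap i j)
  funext x k
  obtain ⟨k, rfl⟩ := (Equiv.swap i j).surjective k
  rw [MeasurableEquiv.coe_piCongrLeft, Equiv.piCongrLeft_apply_apply]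
  simp

theorem measurePreserving_update_neg (i : Fin n) :
    MeasurePreserving (fun x : Fin n → ℝ => Function.update x i (-x i)) := by
  have h := volume_preserving_pi (f := fun j : Fin n => if j = i then (Neg.neg : ℝ → ℝ) else id)
    fun j => by
      split_ifs
      · exact Measure.measurePreserving_neg volume
      · exact MeasurePreserving.id volume
  convert h using 1
  funext x j
  by_cases hj : j = i
  · subst hj; simp
  · simp [hj]

end Bounded

section Weyl

variable {ι : Type*} [Fintype ι] [DecidableEq ι] {n m : ℕ}
  {S : ℝ → ℝ → Matrix (ι × ι) (ι × ι) ℂ} {R T : ℝ → Matrix ι ι ℂ}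

/-- The generators of the Weyl group act by self-adjoint operators, by Hermitian analyticity. -/
theorem exists_implements_sWave (hS : IsExchangeFactor S) (hRT : IsAdmissiblePair S R T) (n : ℕ)
    (i : Fin n) :
    ∃ A : TensorPower ι n →L[ℂ] TensorPower ι n, Implements A (sWave S R T n i) ∧
      ∀ ψ ψ', ⟪A ψ, ψ'⟫_ℂ = ⟪ψ, A ψ'⟫_ℂ := by
  have hx : ∀ j : Fin n, Measurable fun x : Fin n → ℝ => x j := fun j => measurable_pi_apply j
  by_cases h : (i : ℕ) + 1 < n
  · obtain ⟨A, hA⟩ := exists_implements_genWave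
      ((hS.isBoundedMeasurable (hx i) (hx ⟨i + 1, h⟩)).onPair i ⟨i + 1, h⟩)
      (measurePreserving_comp_swap i ⟨i + 1, h⟩)
    refine ⟨A, by rwa [sWave_of_lt _ _ _ i h], ?_⟩
    refine inner_genWave (measurePreserving_comp_swap i ⟨i + 1, h⟩) (fun x => ?_) (fun x => ?_)
      hA hA
    · funext k; simp
    · simp only [Function.comp_apply, Equiv.swap_apply_left, Equiv.swap_apply_right]
      rw [← hS.hermitian]
      ext α β
      simp only [Matrix.conjTranspose_apply, onPair]
      split_ifs with h1 h2 h2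
      · exact star_star _
      · exact absurd (fun k hk hk' => (h1 k hk hk').symm) h2
      · exact absurd (fun k hk hk' => (h2 k hk hk').symm) h1
      · simp
  · have h' : (i : ℕ) + 1 = n := by omega
    obtain ⟨A, hA⟩ := exists_implements_genWave
      ((hRT.isBoundedMeasurable_T (hx i)).onSlot i) (MeasurePreserving.id volume)
    obtain ⟨B, hB⟩ := exists_implements_genWave
      ((hRT.isBoundedMeasurable_R (hx i)).onSlot i) (measurePreserving_update_neg i)
    have hstar : ∀ M : Matrix ι ι ℂ, (onSlot i M)ᴴ = onSlot i Mᴴ := fun M => by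
      ext α β
      simp only [Matrix.conjTranspose_apply, onSlot]
      split_ifs with h1 h2 h2
      · rfl
      · exact absurd (fun k hk => (h1 k hk).symm) h2
      · exact absurd (fun k hk => (h2 k hk).symm) h1
      · simp
    refine ⟨A + B, by rw [sWave_of_eq _ _ _ i h']; exact hA.add hB, fun ψ ψ' => ?_⟩
    rw [_root_.add_apply, _root_.add_apply, inner_add_left, inner_add_right]
    congr 1
    · refine inner_genWave (MeasurePreserving.id volume) (fun x => rfl) (fun x => ?_) hA hA ψ ψ'
      rw [hstar, hRT.hermitian_T]; rfl
    · refine inner_genWave (measurePreserving_update_neg i) (fun x => ?_) (fun x => ?_) hB hB ψ ψ'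
      · simp
      · rw [hstar, hRT.hermitian_R, Function.update_self, neg_neg]

/-- The pointwise identities carry over to the bounded operators, so that these satisfy the relations
that present the Weyl group. -/
theorem exists_weylRep (hS : IsExchangeFactor S) (hRT : IsAdmissiblePair S R T) (n : ℕ) :
    ∃ ρ : weylGroupB n →* (TensorPower ι n →L[ℂ] TensorPower ι n),
      (∀ i, Implements (ρ (weylGen n i)) (sWave S R T n i)) ∧
      ∀ i ψ ψ', ⟪ρ (weylGen n i) ψ, ψ'⟫_ℂ = ⟪ψ, ρ (weylGen n i) ψ'⟫_ℂ := by
  choose A hA hA' using exists_implements_sWave hS hRT n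
  have hW := isCoxeterB_sWave hS hRT n
  have hcox : IsCoxeterB n A :=
    { sq := fun i => ((hA i).mul (hA i)).ext implements_one (hW.sq i)
      comm := fun i j hij => ((hA i).mul (hA j)).ext ((hA j).mul (hA i)) (hW.comm i j hij)
      braid := fun i j hij hj => (((hA i).mul (hA j)).mul (hA i)).ext
        (((hA j).mul (hA i)).mul (hA j)) (hW.braid i j hij hj)
      quad := fun i j hij hj => ((((hA i).mul (hA j)).mul (hA i)).mul (hA j)).ext
        ((((hA j).mul (hA i)).mul (hA j)).mul (hA i)) (hW.quad i j hij hj) }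
  obtain ⟨ρ, hρ⟩ := hcox.exists_hom
  exact ⟨ρ, fun i => by rw [hρ]; exact hA i, fun i => by rw [hρ]; exact hA' i⟩

variable (hS : IsExchangeFactor S) (hRT : IsAdmissiblePair S R T)

/-- The representations of the Weyl groups on the tensor powers. -/
def weylOp (n : ℕ) : weylGroupB n →* (TensorPower ι n →L[ℂ] TensorPower ι n) :=
  (exists_weylRep hS hRT n).choose

theorem implements_weylOp (n : ℕ) (i : Fin n) :
    Implements (weylOp hS hRT n (weylGen n i)) (sWave S R T n i) :=
  (exists_weylRep hS hRT n).choose_spec.1 i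

theorem inner_weylOp (g : weylGroupB n) (ψ ψ' : TensorPower ι n) :
    ⟪weylOp hS hRT n g ψ, ψ'⟫_ℂ = ⟪ψ, weylOp hS hRT n g⁻¹ ψ'⟫_ℂ := by
  induction g using weylGroupB_induction generalizing ψ ψ' with
  | one => simp
  | mul i g ih =>
    have hi : (weylGen n i)⁻¹ = weylGen n i :=
      inv_eq_of_mul_eq_one_left ((isCoxeterB_weylGen n).sq i)
    rw [map_mul, mul_inv_rev, hi, map_mul, mul_apply_eq_comp,
      show ∀ ψ ψ', ⟪weylOp hS hRT n (weylGen n i) ψ, ψ'⟫_ℂ = ⟪ψ, weylOp hS hRT n (weylGen n i) ψ'⟫_ℂ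
        from (exists_weylRep hS hRT n).choose_spec.2 i, mul_apply_eq_comp]
    exact ih _ _

/-- The Weyl group of the last `n` slots commutes with creation in the first one. -/
theorem weylOp_shift_createOp (a : ι) (h : L2One) (g : weylGroupB n) (ψ : TensorPower ι n) :
    weylOp hS hRT (n + 1) (weylShift n g) (createOp n a h ψ) =
      createOp n a h (weylOp hS hRT n g ψ) := by
  induction g using weylGroupB_induction generalizing ψ with
  | one => simp
  | mul i g ih =>
    rw [map_mul, map_mul, map_mul, mul_apply_eq_comp, ih,
      mul_apply_eq_comp, weylShift_weylGen]
    have hc := implements_createOp (n := n) a (Filter.EventuallyEq.refl _ h)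
    have h1 := ((implements_weylOp hS hRT (n + 1) i.succ).comp hc).ext
      (hc.comp (implements_weylOp hS hRT n i)) (by
        rw [sWave_succ]
        exact LinearMap.ext fun φ => shiftWave_createWave _ a h φ)
    exact DFunLike.congr_fun h1 _

theorem annihOp_weylOp_shift (a : ι) (h : L2One) (g : weylGroupB n) (ψ : TensorPower ι (n + 1)) :
    annihOp n a h (weylOp hS hRT (n + 1) (weylShift n g) ψ) =
      weylOp hS hRT n g (annihOp n a h ψ) := by
  refine ext_inner_left ℂ fun w => ?_
  have h1 := fun w => inner_createOp (n := n) a (star h) w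
  simp only [star_star] at h1
  have h2 := inner_weylOp hS hRT (n := n) g⁻¹ w
  simp only [inv_inv] at h2
  have h3 := inner_weylOp hS hRT (weylShift n g)⁻¹ (createOp n a (star h) w)
  simp only [inv_inv] at h3
  rw [← h1, ← h3, ← h2, ← h1, ← map_inv, weylOp_shift_createOp]

/-- The exchange of two created particles. -/
theorem weylOp_zero_createPairOp (a b : ι) (k : L2Two) (k' : ι → ι → L2Two)
    (hk : ∀ c d, k' c d =ᵐ[volume] fun p => S p.1 p.2 (c, d) (a, b) * k (p.2, p.1))
    (ψ : TensorPower ι n) :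
    weylOp hS hRT (n + 2) (weylGen (n + 2) 0) (createPairOp n a b k ψ) =
      ∑ c, ∑ d, createPairOp n c d (k' c d) ψ := by
  have h1 := ((implements_weylOp hS hRT (n + 2) 0).comp
      (implements_createPairOp (n := n) a b (Filter.EventuallyEq.refl _ k))).ext
    (Implements.sum Finset.univ fun c => Implements.sum Finset.univ fun d =>
      implements_createPairOp (n := n) c d (hk c d)) (LinearMap.ext fun φ => by
        simp only [LinearMap.comp_apply, LinearMap.sum_apply]
        exact sWave_zero_createPairWave a b k φ)
  have := DFunLike.congr_fun h1 ψ
  simpa only [_root_.sum_apply, ContinuousLinearMap.comp_apply] using this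

theorem createOp_createOp (a b : ι) (f g : L2One) (k : L2Two)
    (hk : k =ᵐ[volume] fun p => f p.1 * g p.2) (ψ : TensorPower ι n) :
    createOp (n + 1) a f (createOp n b g ψ) = createPairOp n a b k ψ := by
  have h1 := ((implements_createOp (n := n + 1) a (Filter.EventuallyEq.refl _ f)).comp
      (implements_createOp (n := n) b (Filter.EventuallyEq.refl _ g))).ext
    (implements_createPairOp a b hk)
      (LinearMap.ext fun φ => createWave_createWave a b f g φ)
  exact DFunLike.congr_fun h1 ψ

/-- Annihilation after the exchange of the created particle with the first one is a sum of integral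
kernels. -/
theorem annihOp_weylOp_zero_createOp (a b : ι) (f g : L2One) (k : ι → ι → L2Two)
    (hk : ∀ c d, k c d =ᵐ[volume] fun p => S p.2 p.1 (a, c) (b, d) * (f p.2 * g p.1))
    (ψ : TensorPower ι (n + 1)) :
    annihOp (n + 1) a f (weylOp hS hRT (n + 2) (weylGen (n + 2) 0) (createOp (n + 1) b g ψ)) =
      ∑ d, ∑ c, kernelOp n c d (k c d) ψ := by
  have hrep := implements_weylOp hS hRT (n + 2) 0 _ _
    (implements_createOp b (Filter.EventuallyEq.refl _ g) _ _ (isRep_self ψ))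
  refine IsRep.ext (isRep_annihOp a (Filter.EventuallyEq.refl _ f) hrep) ?_
  have hK := fun c d => kernelOp_apply_ae c d (hk c d) (isRep_self ψ)
  have hsum := isRep_sum_apply fun d => isRep_sum_apply fun c => isRep_self (kernelOp n c d (k c d) ψ)
  filter_upwards [hsum, ae_all_iff.2 fun c => ae_all_iff.2 (hK c)] with x e1 e2 γ
  rw [e1]
  simp only [fun c d => (e2 c d γ).2, Finset.sum_ite_eq, Finset.mem_univ, if_true]
  rw [← integral_finsetSum _ fun d _ => (e2 (γ 0) d γ).1]
  refine integral_congr_ae (Filter.Eventually.of_forall fun z => ?_)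
  set φ : Wave ι (n + 1) := fun x α => ψ x α
  have h1 : slice (x 0) (γ 0) (slice z a (sWave S R T (n + 2) 0 (createWave (n + 1) b g φ))) =
      ∑ d, S z (x 0) (a, γ 0) (b, d) • g (x 0) • slice z d φ := by
    rw [slice_slice_sWave_zero, Finset.sum_eq_single b (fun c _ hc => by
      simp only [slice_createWave, if_neg hc, zero_smul, map_zero, smul_zero,
        Finset.sum_const_zero]) (fun h => absurd (Finset.mem_univ _) h)]
    simp only [slice_createWave, if_true, map_smul]
  have h2 := congrFun (congrFun h1 (Fin.tail x)) (Fin.tail γ)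
  rw [slice_apply (x 0), Fin.cons_self_tail, Fin.cons_self_tail, Finset.sum_apply,
    Finset.sum_apply] at h2
  refine Eq.trans ?_ (congrArg (f z * ·) h2).symm
  dsimp only
  rw [Finset.mul_sum]
  refine Finset.sum_congr rfl fun d _ => ?_
  simp only [Pi.smul_apply, smul_eq_mul]
  ring

end Weyl

/-! ### The defect operators on the tensor powers -/

section Defect

variable {ι : Type*} [Fintype ι] [DecidableEq ι] {n m : ℕ}
  {S : ℝ → ℝ → Matrix (ι × ι) (ι × ι) ℂ} {R T : ℝ → Matrix ι ι ℂ}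

theorem exists_implements_defectWave (hS : IsExchangeFactor S) (M : Matrix ι ι ℂ) (χ χ' : ℝ) (n : ℕ)
    (a b : ι) : ∃ A : TensorPower ι n →L[ℂ] TensorPower ι n,
      Implements A (defectWave S M χ χ' n a b) :=
  exists_implements_genWave (hS.isBoundedMeasurable_dressing (isBoundedMeasurable_const M)
    measurable_const measurable_const measurable_id a b) (MeasurePreserving.id volume)

variable (hS : IsExchangeFactor S) (hRT : IsAdmissiblePair S R T)

/-- The defect operators on the tensor powers. -/
def defectOp (M : Matrix ι ι ℂ) (χ χ' : ℝ) (n : ℕ) (a b : ι) :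
    TensorPower ι n →L[ℂ] TensorPower ι n :=
  (exists_implements_defectWave hS M χ χ' n a b).choose

theorem implements_defectOp (M : Matrix ι ι ℂ) (χ χ' : ℝ) (n : ℕ) (a b : ι) :
    Implements (defectOp hS M χ χ' n a b) (defectWave S M χ χ' n a b) :=
  (exists_implements_defectWave hS M χ χ' n a b).choose_spec

theorem commute_weylOp_defectOp {χ χ' : ℝ} {M : Matrix ι ι ℂ}
    (hM : IsDefectCompatible S R T χ χ' M) (g : weylGroupB n) (a b : ι) :
    Commute (weylOp hS hRT n g) (defectOp hS M χ χ' n a b) := by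
  induction g using weylGroupB_induction with
  | one => rw [map_one]; exact Commute.one_left _
  | mul i g ih =>
    rw [map_mul]
    refine Commute.mul_left ?_ ih
    exact ((implements_weylOp hS hRT n i).mul (implements_defectOp hS M χ χ' n a b)).ext
      ((implements_defectOp hS M χ χ' n a b).mul (implements_weylOp hS hRT n i))
      (hS.defectWave_commute hM i a b)

theorem inner_defectOp (M : Matrix ι ι ℂ) (χ χ' : ℝ) (a b : ι) (ψ ψ' : TensorPower ι n) :
    ⟪defectOp hS M χ χ' n a b ψ, ψ'⟫_ℂ = ⟪ψ, defectOp hS Mᴴ χ' χ n b a ψ'⟫_ℂ := by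
  refine inner_genWave (MeasurePreserving.id volume) (fun x => rfl) (fun x => ?_)
    (implements_defectOp hS M χ χ' n a b) (implements_defectOp hS Mᴴ χ' χ n b a) ψ ψ'
  rw [← hS.dressing_conjTranspose]
  rfl

theorem defectOp_defectExchange {x x' y y' : ℝ} {M N : Matrix ι ι ℂ}
    (h : DefectExchange S x x' M y y' N) (n : ℕ) (α₁ α₂ β₁ β₂ : ι) :
    ∑ γ₁, ∑ γ₂, ∑ δ₁, ∑ δ₂, (S x y (α₁, α₂) (γ₂, γ₁) * S y x' (γ₂, δ₁) (β₁, δ₂)) •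
        (defectOp hS M x x' n γ₁ δ₁ * defectOp hS N y y' n δ₂ β₂) =
      ∑ γ₁, ∑ γ₂, ∑ δ₁, ∑ δ₂, (S x y' (α₁, γ₂) (δ₂, δ₁) * S y' x' (δ₂, γ₁) (β₁, β₂)) •
        (defectOp hS N y y' n α₂ γ₂ * defectOp hS M x x' n δ₁ γ₁) :=
  Implements.ext
    (Implements.sum _ fun _ => Implements.sum _ fun _ => Implements.sum _ fun _ =>
      Implements.sum _ fun _ => ((implements_defectOp hS M x x' n _ _).mul
        (implements_defectOp hS N y y' n _ _)).smul _)
    (Implements.sum _ fun _ => Implements.sum _ fun _ => Implements.sum _ fun _ =>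
      Implements.sum _ fun _ => ((implements_defectOp hS N y y' n _ _).mul
        (implements_defectOp hS M x x' n _ _)).smul _)
    (hS.defectWave_defectExchange h n α₁ α₂ β₁ β₂)

theorem sum_defectOp_mul (x y z : ℝ) (M N : Matrix ι ι ℂ) (n : ℕ) (a c : ι) :
    ∑ b, defectOp hS M x y n a b * defectOp hS N y z n b c = defectOp hS (M * N) x z n a c :=
  (Implements.sum Finset.univ fun b => (implements_defectOp hS M x y n a b).mul
    (implements_defectOp hS N y z n b c)).ext (implements_defectOp hS (M * N) x z n a c)
    (hS.sum_defectWave_mul x y z M N n a c)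

theorem defectOp_add (x y : ℝ) (M N : Matrix ι ι ℂ) (n : ℕ) (a b : ι) :
    defectOp hS M x y n a b + defectOp hS N x y n a b = defectOp hS (M + N) x y n a b :=
  ((implements_defectOp hS M x y n a b).add (implements_defectOp hS N x y n a b)).ext
    (implements_defectOp hS (M + N) x y n a b) (defectWave_add x y M N n a b)

theorem defectOp_zero (x y : ℝ) (n : ℕ) (a b : ι) : defectOp hS 0 x y n a b = 0 :=
  (implements_defectOp hS 0 x y n a b).ext implements_zero (defectWave_zero_matrix x y n a b)

theorem defectOp_one (x : ℝ) (n : ℕ) (a b : ι) :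
    defectOp hS 1 x x n a b = if a = b then 1 else 0 := by
  refine (implements_defectOp hS 1 x x n a b).ext (B' := if a = b then 1 else 0) ?_
    (hS.defectWave_one x n a b)
  split_ifs
  · exact implements_one
  · exact implements_zero

theorem defectOp_createOp (M : Matrix ι ι ℂ) (χ χ' : ℝ) (a b e : ι) (h : L2One)
    (h' : ι → ι → ι → L2One) (hh : ∀ r q c, h' r q c =ᵐ[volume] fun z =>
      (∑ p, S χ z (a, c) (p, q) * S z χ' (p, r) (b, e)) * h z) (ψ : TensorPower ι n) :
    defectOp hS M χ χ' (n + 1) a b (createOp n e h ψ) =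
      ∑ r, ∑ q, ∑ c, createOp n c (h' r q c) (defectOp hS M χ χ' n q r ψ) := by
  have h1 := ((implements_defectOp hS M χ χ' (n + 1) a b).comp
      (implements_createOp (n := n) e (Filter.EventuallyEq.refl _ h))).ext
    (Implements.sum Finset.univ fun r => Implements.sum Finset.univ fun q =>
      Implements.sum Finset.univ fun c => (implements_createOp (n := n) c (hh r q c)).comp
        (implements_defectOp hS M χ χ' n q r)) (LinearMap.ext fun φ => by
        simp only [LinearMap.comp_apply, LinearMap.sum_apply]
        exact defectWave_createWave M χ χ' a b e h φ)
  have := DFunLike.congr_fun h1 ψ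
  simpa only [_root_.sum_apply, ContinuousLinearMap.comp_apply] using this

/-- The scalar products with the defect operators are measurable in the spectral parameter. -/
theorem measurable_inner_defectOp {M : ℝ → Matrix ι ι ℂ} (hM : IsBoundedMeasurable M)
    {u v : ℝ → ℝ} (hu : Measurable u) (hv : Measurable v) (a b : ι) (w ψ : TensorPower ι n) :
    Measurable fun χ => ⟪w, defectOp hS (M χ) (u χ) (v χ) n a b ψ⟫_ℂ := by
  have hB := hS.isBoundedMeasurable_dressing (X := ℝ × (Fin n → ℝ)) (M := fun p => M p.1)
    (fun a b => ⟨(hM a b).1.comp measurable_fst, (hM a b).2.choose,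
      fun p => (hM a b).2.choose_spec p.1⟩) (hu.comp measurable_fst) (hv.comp measurable_fst)
    measurable_snd a b
  have hc : ∀ (φ : TensorPower ι n) (γ : Fin n → ι),
      Measurable fun p : ℝ × (Fin n → ℝ) => φ p.2 γ := fun φ γ =>
    ((EuclideanSpace.proj (𝕜 := ℂ) γ).continuous.measurable.comp
      (Lp.stronglyMeasurable φ).measurable).comp measurable_snd
  have h1 : Measurable fun p : ℝ × (Fin n → ℝ) => star (fun γ => w p.2 γ) ⬝ᵥ
      (block (dressing S (M p.1) (u p.1) (v p.1) p.2) a b *ᵥ fun γ => ψ p.2 γ) := by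
    simp only [dotProduct, Matrix.mulVec, Pi.star_apply]
    refine Finset.measurable_sum _ fun γ _ => Measurable.mul ?_ ?_
    · exact continuous_star.measurable.comp (hc w γ)
    · exact Finset.measurable_sum _ fun δ _ => (hB γ δ).1.mul (hc ψ δ)
  have h2 : (fun χ => ⟪w, defectOp hS (M χ) (u χ) (v χ) n a b ψ⟫_ℂ) = fun χ =>
      ∫ x, star (fun γ => w x γ) ⬝ᵥ
        (block (dressing S (M χ) (u χ) (v χ) x) a b *ᵥ fun γ => ψ x γ) := funext fun χ =>
    inner_eq_integral w _ (isRep_self w)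
      (implements_defectOp hS (M χ) (u χ) (v χ) n a b ψ _ (isRep_self ψ))
  rw [h2]
  exact (StronglyMeasurable.integral_prod_right (f := fun (χ : ℝ) (x : Fin n → ℝ) =>
    star (fun γ => w x γ) ⬝ᵥ
      (block (dressing S (M χ) (u χ) (v χ) x) a b *ᵥ fun γ => ψ x γ))
    h1.stronglyMeasurable).measurable

/-- The transmission operators on the tensor powers. -/
def transOp (_ : IsAdmissiblePair S R T) (n : ℕ) (a b : ι) (χ : ℝ) :
    TensorPower ι n →L[ℂ] TensorPower ι n := defectOp hS (T χ) χ χ n a b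

/-- The reflection operators on the tensor powers. -/
def reflOp (_ : IsAdmissiblePair S R T) (n : ℕ) (a b : ι) (χ : ℝ) :
    TensorPower ι n →L[ℂ] TensorPower ι n := defectOp hS (R χ) χ (-χ) n a b

theorem measurable_inner_transOp (a b : ι) (w ψ : TensorPower ι n) :
    Measurable fun χ => ⟪w, transOp hS hRT n a b χ ψ⟫_ℂ :=
  measurable_inner_defectOp hS (hRT.isBoundedMeasurable_T measurable_id) measurable_id
    measurable_id a b w ψ

theorem measurable_inner_reflOp (a b : ι) (w ψ : TensorPower ι n) :
    Measurable fun χ => ⟪w, reflOp hS hRT n a b χ ψ⟫_ℂ :=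
  measurable_inner_defectOp hS (hRT.isBoundedMeasurable_R measurable_id) measurable_id
    measurable_neg a b w ψ

theorem inner_transOp (a b : ι) (χ : ℝ) (ψ ψ' : TensorPower ι n) :
    ⟪transOp hS hRT n a b χ ψ, ψ'⟫_ℂ = ⟪ψ, transOp hS hRT n b a χ ψ'⟫_ℂ := by
  rw [transOp, inner_defectOp, hRT.hermitian_T, transOp]

theorem inner_reflOp (a b : ι) (χ : ℝ) (ψ ψ' : TensorPower ι n) :
    ⟪reflOp hS hRT n a b χ ψ, ψ'⟫_ℂ = ⟪ψ, reflOp hS hRT n b a (-χ) ψ'⟫_ℂ := by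
  rw [reflOp, inner_defectOp, hRT.hermitian_R, reflOp, neg_neg]

theorem transOp_unitarity (n : ℕ) (a b : ι) (χ : ℝ) :
    (∑ c, transOp hS hRT n a c χ * transOp hS hRT n c b χ) +
      (∑ c, reflOp hS hRT n a c χ * reflOp hS hRT n c b (-χ)) = if a = b then 1 else 0 := by
  simp only [transOp, reflOp, neg_neg]
  rw [sum_defectOp_mul, sum_defectOp_mul, defectOp_add, hRT.unitarity_one, defectOp_one]

theorem transOp_reflOp (n : ℕ) (a b : ι) (χ : ℝ) :
    (∑ c, transOp hS hRT n a c χ * reflOp hS hRT n c b χ) +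
      (∑ c, reflOp hS hRT n a c χ * transOp hS hRT n c b (-χ)) = 0 := by
  simp only [transOp, reflOp]
  rw [sum_defectOp_mul, sum_defectOp_mul, defectOp_add, hRT.unitarity_zero, defectOp_zero]

/-- By unitarity and Hermitian analyticity the squared norms add up to the squared norm of `ψ`. -/
theorem sum_norm_sq_transOp_reflOp (b : ι) (χ : ℝ) (ψ : TensorPower ι n) :
    (∑ c, ‖transOp hS hRT n c b χ ψ‖ ^ 2) + (∑ c, ‖reflOp hS hRT n c b (-χ) ψ‖ ^ 2) =
      ‖ψ‖ ^ 2 := by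
  have h := congrArg (fun A => ⟪ψ, A ψ⟫_ℂ) (transOp_unitarity hS hRT n b b χ)
  simp only [if_true, _root_.add_apply, _root_.sum_apply, mul_apply_eq_comp, inner_add_right,
    inner_sum, one_apply_eq_self] at h
  have e1 : ∀ c, ⟪ψ, transOp hS hRT n b c χ (transOp hS hRT n c b χ ψ)⟫_ℂ =
      ((‖transOp hS hRT n c b χ ψ‖ ^ 2 : ℝ) : ℂ) := fun c => by
    rw [← inner_transOp, inner_self_eq_norm_sq_to_K]; norm_cast
  have e2 : ∀ c, ⟪ψ, reflOp hS hRT n b c χ (reflOp hS hRT n c b (-χ) ψ)⟫_ℂ =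
      ((‖reflOp hS hRT n c b (-χ) ψ‖ ^ 2 : ℝ) : ℂ) := fun c => by
    have := inner_reflOp hS hRT c b (-χ) ψ (reflOp hS hRT n c b (-χ) ψ)
    rw [neg_neg] at this
    rw [← this, inner_self_eq_norm_sq_to_K]; norm_cast
  simp only [e1, e2] at h
  have e3 : ⟪ψ, ψ⟫_ℂ = ((‖ψ‖ ^ 2 : ℝ) : ℂ) := by
    rw [inner_self_eq_norm_sq_to_K]; norm_cast
  rw [e3] at h
  exact_mod_cast h

theorem norm_transOp_le (a b : ι) (χ : ℝ) (ψ : TensorPower ι n) :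
    ‖transOp hS hRT n a b χ ψ‖ ≤ ‖ψ‖ := by
  have h := sum_norm_sq_transOp_reflOp hS hRT b χ ψ
  have h1 := Finset.single_le_sum (f := fun c => ‖transOp hS hRT n c b χ ψ‖ ^ 2)
    (fun c _ => sq_nonneg _) (Finset.mem_univ a)
  have h2 : 0 ≤ ∑ c, ‖reflOp hS hRT n c b (-χ) ψ‖ ^ 2 := Finset.sum_nonneg fun c _ => sq_nonneg _
  exact pow_le_pow_iff_left₀ (norm_nonneg _) (norm_nonneg _) two_ne_zero |>.1 (by linarith)

theorem norm_reflOp_le (a b : ι) (χ : ℝ) (ψ : TensorPower ι n) :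
    ‖reflOp hS hRT n a b χ ψ‖ ≤ ‖ψ‖ := by
  have h := sum_norm_sq_transOp_reflOp hS hRT b (-χ) ψ
  rw [neg_neg] at h
  have h1 := Finset.single_le_sum (f := fun c => ‖reflOp hS hRT n c b χ ψ‖ ^ 2)
    (fun c _ => sq_nonneg _) (Finset.mem_univ a)
  have h2 : 0 ≤ ∑ c, ‖transOp hS hRT n c b (-χ) ψ‖ ^ 2 := Finset.sum_nonneg fun c _ => sq_nonneg _
  exact pow_le_pow_iff_left₀ (norm_nonneg _) (norm_nonneg _) two_ne_zero |>.1 (by linarith)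

theorem integrable_mul_mul_bounded (f g : L2One) {b : ℝ → ℂ} (hb : Measurable b) {C : ℝ}
    (hC : ∀ χ, ‖b χ‖ ≤ C) : Integrable fun χ => f χ * g χ * b χ :=
  ((Lp.memLp f).integrable_mul (Lp.memLp g)).mul_bdd hb.aestronglyMeasurable
    (Filter.Eventually.of_forall hC)

theorem implements_flipWord (n : ℕ) :
    Implements (weylOp hS hRT (n + 1) (flipWord n (weylGen (n + 1))))
      (flipWord n (sWave S R T (n + 1))) := by
  rw [map_flipWord]
  have key : ∀ (k m : ℕ) (A : Fin (k + 1) → TensorPower ι m →L[ℂ] TensorPower ι m)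
      (B : Fin (k + 1) → Module.End ℂ (Wave ι m)), (∀ i, Implements (A i) (B i)) →
      Implements (flipWord k A) (flipWord k B) := by
    intro k m A B h
    induction k with
    | zero => exact h 0
    | succ k ih => exact ((h 0).mul (ih _ _ fun i => h i.succ)).mul (h 0)
  exact key n (n + 1) _ _ fun i => implements_weylOp hS hRT (n + 1) i

theorem norm_inner_transOp_le (a b : ι) (w ψ : TensorPower ι n) (χ : ℝ) :
    ‖⟪w, transOp hS hRT n a b χ ψ⟫_ℂ‖ ≤ ‖w‖ * ‖ψ‖ :=
  (norm_inner_le_norm _ _).trans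
    (mul_le_mul_of_nonneg_left (norm_transOp_le hS hRT a b χ ψ) (norm_nonneg _))

theorem norm_inner_reflOp_le (a b : ι) (w ψ : TensorPower ι n) (χ : ℝ) :
    ‖⟪w, reflOp hS hRT n a b χ ψ⟫_ℂ‖ ≤ ‖w‖ * ‖ψ‖ :=
  (norm_inner_le_norm _ _).trans
    (mul_le_mul_of_nonneg_left (norm_reflOp_le hS hRT a b χ ψ) (norm_nonneg _))

theorem integrable_transOp (f g : L2One) (a b : ι) (w ψ : TensorPower ι n) :
    Integrable fun χ => f χ * g χ * ⟪w, transOp hS hRT n a b χ ψ⟫_ℂ :=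
  integrable_mul_mul_bounded f g (measurable_inner_transOp hS hRT a b w ψ)
    (norm_inner_transOp_le hS hRT a b w ψ)

theorem integrable_reflOp (f g : L2One) (a b : ι) (w ψ : TensorPower ι n) :
    Integrable fun χ => f χ * g (-χ) * ⟪w, reflOp hS hRT n a b χ ψ⟫_ℂ := by
  have hneg := Measure.measurePreserving_neg (volume : Measure ℝ)
  refine (integrable_mul_mul_bounded f (compL Neg.neg hneg g)
    (measurable_inner_reflOp hS hRT a b w ψ) (norm_inner_reflOp_le hS hRT a b w ψ)).congr ?_
  filter_upwards [coeFn_compL Neg.neg hneg g] with χ hχ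
  rw [hχ]

/-- Annihilation after the sign change of the spectral parameter of the created particle: the origin of the
defect operators in the exchange relation of annihilation and creation. -/
theorem inner_annihOp_flip_createOp (a b : ι) (f g : L2One) (w ψ : TensorPower ι n) :
    ⟪w, annihOp n a f (weylOp hS hRT (n + 1) (flipWord n (weylGen (n + 1)))
      (createOp n b g ψ))⟫_ℂ =
      (∫ χ, f χ * g χ * ⟪w, transOp hS hRT n a b χ ψ⟫_ℂ) +
        ∫ χ, f χ * g (-χ) * ⟪w, reflOp hS hRT n a b χ ψ⟫_ℂ := by
  have hrep := implements_flipWord hS hRT n _ _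
    (implements_createOp b (Filter.EventuallyEq.refl _ g) _ _ (isRep_self ψ))
  rw [inner_annihOp_eq_integral a f w hrep,
    ← integral_add (integrable_transOp hS hRT f g a b w ψ) (integrable_reflOp hS hRT f g a b w ψ)]
  refine integral_congr_ae (Filter.Eventually.of_forall fun z => ?_)
  dsimp only
  have h1 : IsRep (g z • transOp hS hRT n a b z ψ + g (-z) • reflOp hS hRT n a b z ψ)
      (slice z a (flipWord n (sWave S R T (n + 1)) (createWave n b g fun x α => ψ x α))) := by
    rw [slice_flipWord_sWave, Finset.sum_eq_single b (fun c _ hc => by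
      simp only [slice_createWave, if_neg hc, zero_smul, map_zero, add_zero])
      (fun h => absurd (Finset.mem_univ _) h)]
    simp only [slice_createWave, if_true, map_smul]
    exact ((implements_defectOp hS (T z) z z n a b _ _ (isRep_self ψ)).smul _).add
      ((implements_defectOp hS (R z) z (-z) n a b _ _ (isRep_self ψ)).smul _)
  rw [sum_integral_eq_inner w h1, inner_add_right, inner_smul_right, inner_smul_right]
  ring

theorem inner_annihOp_createOp (a b : ι) (f g : L2One) (w ψ : TensorPower ι n) :
    ⟪w, annihOp n a f (createOp n b g ψ)⟫_ℂ =
      (∫ χ, f χ * g χ * (if a = b then ⟪w, ψ⟫_ℂ else 0)) := by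
  rw [inner_annihOp_eq_integral a f w
    (implements_createOp b (Filter.EventuallyEq.refl _ g) _ _ (isRep_self ψ))]
  refine integral_congr_ae (Filter.Eventually.of_forall fun z => ?_)
  dsimp only
  rw [slice_createWave]
  have h1 : IsRep ((if a = b then g z else 0) • ψ) ((if a = b then g z else 0) •
      fun (x : Fin n → ℝ) (α : Fin n → ι) => ψ x α) := (isRep_self ψ).smul _
  rw [sum_integral_eq_inner w h1, inner_smul_right]
  split_ifs <;> ring

end Defect

/-! ### The projection onto the invariants of the Weyl group -/

section Projection

variable {ι : Type*} [Fintype ι] [DecidableEq ι] {n m : ℕ}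
  {S : ℝ → ℝ → Matrix (ι × ι) (ι × ι) ℂ} {R T : ℝ → Matrix ι ι ℂ}
  (hS : IsExchangeFactor S) (hRT : IsAdmissiblePair S R T)

/-- The projection onto the invariants of the Weyl group. -/
abbrev fockProj (n : ℕ) : TensorPower ι n →L[ℂ] TensorPower ι n :=
  fockProjection (weylOp hS hRT) n

theorem two_pow_mul_factorial_ne_zero (n : ℕ) : (2 ^ n * n.factorial : ℂ) ≠ 0 :=
  mul_ne_zero (pow_ne_zero _ two_ne_zero) (Nat.cast_ne_zero.2 n.factorial_ne_zero)

theorem card_univ_weylGroupB (n : ℕ) [Fintype (weylGroupB n)] :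
    ((Finset.univ : Finset (weylGroupB n)).card : ℂ) = 2 ^ n * n.factorial := by
  rw [Finset.card_univ, ← Nat.card_eq_fintype_card, card_weylGroupB]
  push_cast
  rfl

theorem fockProj_apply [Fintype (weylGroupB n)] (ψ : TensorPower ι n) :
    fockProj hS hRT n ψ = (2 ^ n * n.factorial : ℂ)⁻¹ • ∑ g, weylOp hS hRT n g ψ := by
  rw [fockProj, fockProjection, finsum_eq_sum_of_fintype, _root_.smul_apply, _root_.sum_apply]

theorem fockProj_of_invariant {ψ : TensorPower ι n} (h : ∀ g, weylOp hS hRT n g ψ = ψ) :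
    fockProj hS hRT n ψ = ψ := by
  have := Fintype.ofFinite (weylGroupB n)
  rw [fockProj_apply]
  simp only [h]
  rw [Finset.sum_const, ← Nat.cast_smul_eq_nsmul ℂ, card_univ_weylGroupB, smul_smul,
    inv_mul_cancel₀ (two_pow_mul_factorial_ne_zero n), one_smul]

theorem weylOp_fockProj (g : weylGroupB n) (ψ : TensorPower ι n) :
    weylOp hS hRT n g (fockProj hS hRT n ψ) = fockProj hS hRT n ψ := by
  have := Fintype.ofFinite (weylGroupB n)
  rw [fockProj_apply, map_smul, map_sum]
  congr 1
  refine Fintype.sum_equiv (Equiv.mulLeft g) _ _ fun g' => ?_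
  rw [Equiv.coe_mulLeft, map_mul, mul_apply_eq_comp]

theorem fockProj_weylOp (g : weylGroupB n) (ψ : TensorPower ι n) :
    fockProj hS hRT n (weylOp hS hRT n g ψ) = fockProj hS hRT n ψ := by
  have := Fintype.ofFinite (weylGroupB n)
  rw [fockProj_apply, fockProj_apply]
  congr 1
  refine Fintype.sum_equiv (Equiv.mulRight g) _ _ fun g' => ?_
  rw [Equiv.coe_mulRight, map_mul, mul_apply_eq_comp]

theorem fockProj_fockProj (ψ : TensorPower ι n) :
    fockProj hS hRT n (fockProj hS hRT n ψ) = fockProj hS hRT n ψ :=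
  fockProj_of_invariant hS hRT fun g => weylOp_fockProj hS hRT g ψ

theorem inner_fockProj (ψ ψ' : TensorPower ι n) :
    ⟪fockProj hS hRT n ψ, ψ'⟫_ℂ = ⟪ψ, fockProj hS hRT n ψ'⟫_ℂ := by
  have := Fintype.ofFinite (weylGroupB n)
  rw [fockProj_apply, fockProj_apply, inner_smul_left, inner_smul_right, sum_inner, inner_sum]
  congr 1
  · rw [map_inv₀]
    congr 1
    norm_cast
    exact Complex.conj_natCast _
  · refine Fintype.sum_equiv (Equiv.inv _) _ _ fun g => ?_
    rw [inner_weylOp, Equiv.inv_apply]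

theorem isStarProjection_fockProj (n : ℕ) : IsStarProjection (fockProj hS hRT n) where
  isIdempotentElem := ContinuousLinearMap.ext fun ψ => fockProj_fockProj hS hRT ψ
  isSelfAdjoint := ContinuousLinearMap.isSelfAdjoint_iff_isSymmetric.2 fun ψ ψ' =>
    inner_fockProj hS hRT ψ ψ'

theorem mem_particleSpace {ψ : TensorPower ι n} :
    ψ ∈ particleSpace (weylOp hS hRT) n ↔ fockProj hS hRT n ψ = ψ := by
  constructor
  · rintro ⟨φ, rfl⟩
    exact fockProj_fockProj hS hRT φ
  · exact fun h => ⟨ψ, h⟩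

theorem weylOp_of_fockProj {ψ : TensorPower ι n} (h : fockProj hS hRT n ψ = ψ)
    (g : weylGroupB n) : weylOp hS hRT n g ψ = ψ := by
  rw [← h, weylOp_fockProj]

/-- Projecting the other particles first is redundant, as their Weyl group is a subgroup of the
full one. -/
theorem fockProj_createOp_fockProj (a : ι) (h : L2One) (ψ : TensorPower ι n) :
    fockProj hS hRT (n + 1) (createOp n a h (fockProj hS hRT n ψ)) =
      fockProj hS hRT (n + 1) (createOp n a h ψ) := by
  have := Fintype.ofFinite (weylGroupB n)
  rw [fockProj_apply hS hRT ψ, map_smul, map_sum, map_smul, map_sum]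
  simp only [← weylOp_shift_createOp, fockProj_weylOp]
  rw [Finset.sum_const, ← Nat.cast_smul_eq_nsmul ℂ, card_univ_weylGroupB, smul_smul,
    inv_mul_cancel₀ (two_pow_mul_factorial_ne_zero n), one_smul]

theorem fockProj_annihOp (a : ι) (h : L2One) {ψ : TensorPower ι (n + 1)}
    (hψ : fockProj hS hRT (n + 1) ψ = ψ) :
    fockProj hS hRT n (annihOp n a h ψ) = annihOp n a h ψ :=
  fockProj_of_invariant hS hRT fun g => by
    rw [← annihOp_weylOp_shift, weylOp_of_fockProj hS hRT hψ]

theorem fockProj_defectOp {χ χ' : ℝ} {M : Matrix ι ι ℂ} (hM : IsDefectCompatible S R T χ χ' M)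
    (a b : ι) (ψ : TensorPower ι n) :
    fockProj hS hRT n (defectOp hS M χ χ' n a b ψ) =
      defectOp hS M χ χ' n a b (fockProj hS hRT n ψ) := by
  have := Fintype.ofFinite (weylGroupB n)
  rw [fockProj_apply, fockProj_apply, map_smul, map_sum]
  congr 1
  exact Finset.sum_congr rfl fun g _ =>
    DFunLike.congr_fun (commute_weylOp_defectOp hS hRT hM g a b) ψ

theorem fockProj_transOp (a b : ι) (χ : ℝ) (ψ : TensorPower ι n) :
    fockProj hS hRT n (transOp hS hRT n a b χ ψ) =
      transOp hS hRT n a b χ (fockProj hS hRT n ψ) :=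
  fockProj_defectOp hS hRT (hRT.compatible_T χ) a b ψ

theorem fockProj_reflOp (a b : ι) (χ : ℝ) (ψ : TensorPower ι n) :
    fockProj hS hRT n (reflOp hS hRT n a b χ ψ) =
      reflOp hS hRT n a b χ (fockProj hS hRT n ψ) :=
  fockProj_defectOp hS hRT (hRT.compatible_R hS χ) a b ψ

/-- On the invariants of the subgroup that fixes the first basis vector, the projection is the
average over the coset representatives. -/
theorem sum_weylRep_of_invariant {ψ : TensorPower ι (n + 1)}
    (h : ∀ g, weylOp hS hRT (n + 1) (weylShift n g) ψ = ψ) :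
    ∑ p, weylOp hS hRT (n + 1) (weylRep (n + 1) p) ψ =
      (2 * (n + 1) : ℂ) • fockProj hS hRT (n + 1) ψ := by
  have := Fintype.ofFinite (weylGroupB n)
  have := Fintype.ofFinite (weylGroupB (n + 1))
  have h1 : ∑ g, weylOp hS hRT (n + 1) g ψ =
      (2 ^ n * n.factorial : ℂ) • ∑ p, weylOp hS hRT (n + 1) (weylRep (n + 1) p) ψ := by
    rw [← Fintype.sum_bijective _ (weylRep_mul_bijective n)
      (fun q => weylOp hS hRT (n + 1) (weylRep (n + 1) q.1) ψ) _ fun q => by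
        rw [map_mul, mul_apply_eq_comp, h], Fintype.sum_prod_type]
    simp only [Finset.sum_const]
    rw [← Finset.smul_sum, ← Nat.cast_smul_eq_nsmul ℂ, card_univ_weylGroupB]
  rw [fockProj_apply, h1, smul_smul, smul_smul, Nat.factorial_succ]
  have h2 := two_pow_mul_factorial_ne_zero n
  have h3 : (n + 1 : ℂ) ≠ 0 := Nat.cast_add_one_ne_zero n
  have h4 : (2 * (n + 1) : ℂ) * (2 ^ (n + 1) * ((n + 1) * n.factorial : ℕ) : ℂ)⁻¹ *
      (2 ^ n * n.factorial) = 1 := by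
    push_cast
    rw [mul_ne_zero_iff] at h2
    have h4 := h2.1
    have h5 := h2.2
    field_simp
    ring
  rw [h4, one_smul]

/-- The three kinds of coset representatives: the identity, the sign change of the first basis vector,
and products with the exchange of the first two basis vectors. -/
theorem sum_weylRep_succ (F : weylGroupB (n + 1) → TensorPower ι n) :
    ∑ p, F (weylRep (n + 1) p) = F 1 + F (flipWord n (weylGen (n + 1))) +
      ∑ p, F (weylShift n (weylRep n p) * weylGen (n + 1) 0) := by
  rw [Fintype.sum_prod_type, Fin.sum_univ_succ, Fintype.sum_prod_type]
  simp only [weylRep_succ]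
  refine congrArg₂ (· + ·) ?_ rfl
  rw [UnitsInt.univ, Finset.sum_pair (by decide)]
  exact congrArg₂ (fun g g' => F g + F g') (cosetRep_zero_one _) (cosetRep_zero_neg _)

/-- The exchange relation of annihilation and creation when there is no other particle. -/
theorem annihOp_fockProj_createOp_zero (a b : ι) (f g : L2One) {ψ : TensorPower ι 0}
    (hψ : fockProj hS hRT 0 ψ = ψ) :
    (2 : ℂ) • annihOp 0 a f (fockProj hS hRT 1 (createOp 0 b g ψ)) =
      annihOp 0 a f (createOp 0 b g ψ) +
      annihOp 0 a f (weylOp hS hRT 1 (flipWord 0 (weylGen 1)) (createOp 0 b g ψ)) := by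
  have h1 := sum_weylRep_of_invariant hS hRT (ψ := createOp 0 b g ψ) fun g' => by
    rw [weylOp_shift_createOp, weylOp_of_fockProj hS hRT hψ]
  have h2 := congrArg (annihOp 0 a f) h1
  rw [map_sum, map_smul, sum_weylRep_succ fun g' =>
    annihOp 0 a f (weylOp hS hRT 1 g' (createOp 0 b g ψ)), Fintype.sum_empty, add_zero, map_one,
    one_apply_eq_self] at h2
  rw [h2]
  norm_num

/-- The exchange relation of annihilation and creation: the cosets of the identity, of the sign
change of the first basis vector, and the other ones give the three terms. -/
theorem annihOp_fockProj_createOp_succ (a b : ι) (f g : L2One) {ψ : TensorPower ι (n + 1)}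
    (hψ : fockProj hS hRT (n + 1) ψ = ψ) (k : ι → ι → L2Two)
    (hk : ∀ c d, k c d =ᵐ[volume] fun p => S p.2 p.1 (a, c) (b, d) * (f p.2 * g p.1)) :
    (2 * ((n + 1 : ℕ) + 1) : ℂ) •
        annihOp (n + 1) a f (fockProj hS hRT (n + 2) (createOp (n + 1) b g ψ)) =
      annihOp (n + 1) a f (createOp (n + 1) b g ψ) +
      annihOp (n + 1) a f (weylOp hS hRT (n + 2) (flipWord (n + 1) (weylGen (n + 2)))
        (createOp (n + 1) b g ψ)) +
      (2 * (n + 1) : ℂ) • fockProj hS hRT (n + 1) (∑ d, ∑ c, kernelOp n c d (k c d) ψ) := by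
  have h1 := sum_weylRep_of_invariant hS hRT (ψ := createOp (n + 1) b g ψ) fun g' => by
    rw [weylOp_shift_createOp, weylOp_of_fockProj hS hRT hψ]
  have h2 := congrArg (annihOp (n + 1) a f) h1
  rw [map_sum, map_smul, sum_weylRep_succ fun g' =>
    annihOp (n + 1) a f (weylOp hS hRT (n + 2) g' (createOp (n + 1) b g ψ)), map_one,
    one_apply_eq_self] at h2
  rw [← h2]
  congr 1
  have hX := annihOp_weylOp_zero_createOp hS hRT a b f g k hk ψ
  have h3 := sum_weylRep_of_invariant hS hRT
    (ψ := annihOp (n + 1) a f (weylOp hS hRT (n + 2) (weylGen (n + 2) 0)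
      (createOp (n + 1) b g ψ))) fun g' => by
    rw [← annihOp_weylOp_shift, ← mul_apply_eq_comp, ← map_mul]
    have hc : Commute (weylShift (n + 1) (weylShift n g')) (weylGen (n + 2) 0) := by
      induction g' using weylGroupB_induction with
      | one => simp
      | mul i g'' ih =>
        rw [map_mul, map_mul, weylShift_weylGen, weylShift_weylGen]
        refine Commute.mul_left ?_ ih
        exact ((isCoxeterB_weylGen (n + 2)).comm 0 i.succ.succ (by simp)).symm
    rw [hc.eq, map_mul, mul_apply_eq_comp, weylOp_shift_createOp, weylOp_of_fockProj hS hRT hψ]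
  rw [← hX, ← h3]
  refine Finset.sum_congr rfl fun p _ => ?_
  rw [map_mul, mul_apply_eq_comp, annihOp_weylOp_shift]

end Projection

/-! ### Operators on the finite particle space -/

section Fock

variable {ι : Type*} [Fintype ι] [DecidableEq ι]
  {S : ℝ → ℝ → Matrix (ι × ι) (ι × ι) ℂ} {R T : ℝ → Matrix ι ι ℂ}
  (hS : IsExchangeFactor S) (hRT : IsAdmissiblePair S R T)

/-- The finite particle space of the Weyl group representations `weylOp`. -/
abbrev FockDomain : Submodule ℂ (FockSpace (weylOp hS hRT)) := finiteParticle (weylOp hS hRT)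

instance (n : ℕ) : CompleteSpace (particleSpace (weylOp hS hRT) n) := by
  have h : (particleSpace (weylOp hS hRT) n : Set (TensorPower ι n)) =
      {ψ | fockProj hS hRT n ψ = ψ} := Set.ext fun ψ => mem_particleSpace hS hRT
  exact (h ▸ isClosed_eq (fockProj hS hRT n).continuous continuous_id :
    IsClosed (particleSpace (weylOp hS hRT) n : Set (TensorPower ι n))).completeSpace_coe

variable {hS hRT}

theorem fockProj_component (v : FockDomain hS hRT) (n : ℕ) :
    fockProj hS hRT n (component v n) = component v n :=
  (mem_particleSpace hS hRT).1 (Subtype.property _)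

theorem domain_ext {v w : FockDomain hS hRT} (h : ∀ n, component v n = component w n) : v = w :=
  Subtype.ext (lp.ext (funext fun n => Subtype.ext (h n)))

theorem component_add (v w : FockDomain hS hRT) (n : ℕ) :
    component (v + w) n = component v n + component w n := rfl

theorem component_smul (c : ℂ) (v : FockDomain hS hRT) (n : ℕ) :
    component (c • v) n = c • component v n := rfl

theorem component_zero (n : ℕ) : component (0 : FockDomain hS hRT) n = 0 := rfl

theorem component_sub (v w : FockDomain hS hRT) (n : ℕ) :
    component (v - w) n = component v n - component w n := rfl

theorem component_sum {κ : Type*} (s : Finset κ) (v : κ → FockDomain hS hRT) (n : ℕ) :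
    component (∑ i ∈ s, v i) n = ∑ i ∈ s, component (v i) n := by
  classical
  induction s using Finset.induction_on with
  | empty => simp [component_zero]
  | insert i s hi ih => rw [Finset.sum_insert hi, Finset.sum_insert hi, component_add, ih]

theorem exists_component_eq_zero (v : FockDomain hS hRT) :
    ∃ N, ∀ n, N ≤ n → component v n = 0 := by
  obtain ⟨N, hN⟩ := v.2
  exact ⟨N, fun n hn => congrArg Subtype.val (hN n hn)⟩

theorem inner_eq_sum (w : FockSpace (weylOp hS hRT)) (v : FockDomain hS hRT) {N : ℕ}
    (hN : ∀ n, N ≤ n → component v n = 0) :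
    ⟪w, (v : FockSpace (weylOp hS hRT))⟫_ℂ =
      ∑ n ∈ Finset.range N, ⟪((w n : particleSpace (weylOp hS hRT) n) : TensorPower ι n),
        component v n⟫_ℂ := by
  rw [lp.inner_eq_tsum, tsum_eq_sum (s := Finset.range N)]
  · rfl
  · intro n hn
    have : (v : FockSpace (weylOp hS hRT)) n = 0 :=
      Subtype.ext (hN n (not_lt.1 fun h => hn (Finset.mem_range.2 h)))
    rw [this, inner_zero_right]

theorem inner_domain_eq_sum (w v : FockDomain hS hRT) {N : ℕ}
    (hN : ∀ n, N ≤ n → component v n = 0) :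
    ⟪(w : FockSpace (weylOp hS hRT)), (v : FockSpace (weylOp hS hRT))⟫_ℂ =
      ∑ n ∈ Finset.range N, ⟪component w n, component v n⟫_ℂ :=
  inner_eq_sum _ v hN

theorem end_ext_inner {A B : Module.End ℂ (FockDomain hS hRT)}
    (h : ∀ v w : FockDomain hS hRT, ⟪(w : FockSpace (weylOp hS hRT)), (A v : _)⟫_ℂ =
      ⟪(w : FockSpace (weylOp hS hRT)), (B v : _)⟫_ℂ) : A = B := by
  refine LinearMap.ext fun v => sub_eq_zero.1 (Subtype.ext ?_)
  have h1 := h v (A v - B v)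
  rw [← sub_eq_zero, ← inner_sub_right] at h1
  exact inner_self_eq_zero.1 h1

variable (hS hRT) in
/-- The vector of the finite particle space whose components are the projections of the vectors
`c n`, of which only finitely many do not vanish. -/
def ofComponents (c : ∀ n, TensorPower ι n) (hc : ∃ N, ∀ n, N ≤ n → c n = 0) :
    FockDomain hS hRT :=
  ⟨⟨fun n => ⟨fockProj hS hRT n (c n), ⟨c n, rfl⟩⟩, by
    obtain ⟨N, hN⟩ := hc
    refine (memℓp_zero ?_).of_exponent_ge (zero_le (a := (2 : ℝ≥0∞)))
    refine (Set.finite_lt_nat N).subset fun n hn => show n < N from not_le.1 fun h => hn ?_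
    rw [hN n h]
    exact Subtype.ext (map_zero _)⟩, by
    obtain ⟨N, hN⟩ := hc
    refine ⟨N, fun n hn => Subtype.ext ?_⟩
    change fockProj hS hRT n (c n) = 0
    rw [hN n hn, map_zero]⟩

theorem component_ofComponents (c : ∀ n, TensorPower ι n) (hc : ∃ N, ∀ n, N ≤ n → c n = 0)
    (n : ℕ) : component (ofComponents hS hRT c hc) n = fockProj hS hRT n (c n) := rfl

section Builder

variable {V : Type*} [NormedAddCommGroup V] [NormedSpace ℂ V] (s : ℕ → ℕ) (hs : ∀ n, n ≤ s n + 2)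

variable (hS hRT) in
/-- The operator on the finite particle space whose `n`-particle component is obtained from the
`s n`-particle one with the operator `B n` and the projection. The bound on `s` ensures that only
finitely many components of the result do not vanish. -/
def fockEnd (B : ∀ n, TensorPower ι (s n) →L[ℂ] TensorPower ι n) :
    Module.End ℂ (FockDomain hS hRT) where
  toFun v := ofComponents hS hRT (fun n => B n (component v (s n))) (by
    obtain ⟨N, hN⟩ := exists_component_eq_zero v
    refine ⟨N + 2, fun n hn => ?_⟩
    rw [hN (s n) (by have := hs n; omega), map_zero])
  map_add' v w := domain_ext fun n => by
    simp only [component_ofComponents, component_add, map_add]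
  map_smul' c v := domain_ext fun n => by
    simp only [component_ofComponents, component_smul, map_smul, RingHom.id_apply]

theorem component_fockEnd (B : ∀ n, TensorPower ι (s n) →L[ℂ] TensorPower ι n)
    (v : FockDomain hS hRT) (n : ℕ) :
    component (fockEnd hS hRT s hs B v) n = fockProj hS hRT n (B n (component v (s n))) := rfl

variable (hS hRT) in
/-- The operators `fockEnd` with a linear dependence on a parameter. -/
def fockMap (B : ∀ n, V →L[ℂ] TensorPower ι (s n) →L[ℂ] TensorPower ι n) :
    V →ₗ[ℂ] Module.End ℂ (FockDomain hS hRT) where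
  toFun k := fockEnd hS hRT s hs fun n => B n k
  map_add' k l := LinearMap.ext fun v => domain_ext fun n => by
    simp only [component_fockEnd, map_add, LinearMap.add_apply, component_add, _root_.add_apply]
  map_smul' c k := LinearMap.ext fun v => domain_ext fun n => by
    simp only [component_fockEnd, map_smul, LinearMap.smul_apply, component_smul,
      _root_.smul_apply, RingHom.id_apply]

theorem continuous_fockMap (B : ∀ n, V →L[ℂ] TensorPower ι (s n) →L[ℂ] TensorPower ι n)
    (v : FockDomain hS hRT) :
    Continuous fun k => (fockMap hS hRT s hs B k v : FockSpace (weylOp hS hRT)) := by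
  obtain ⟨N, hN⟩ := exists_component_eq_zero v
  let p : ∀ n, V → particleSpace (weylOp hS hRT) n := fun n k =>
    ⟨fockProj hS hRT n (B n k (component v (s n))), ⟨_, rfl⟩⟩
  have hp : ∀ n, Continuous (p n) := fun n => Continuous.subtype_mk
    ((fockProj hS hRT n).continuous.comp
      ((ContinuousLinearMap.apply ℂ _ (component v (s n))).continuous.comp (B n).continuous)) _
  have h1 : (fun k => (fockMap hS hRT s hs B k v : FockSpace (weylOp hS hRT))) =
      fun k => ∑ n ∈ Finset.range (N + 2), lp.single 2 n (p n k) := by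
    funext k
    refine lp.ext (funext fun n => ?_)
    rw [lp.coeFn_sum, Finset.sum_apply]
    simp only [lp.coeFn_single, Finset.sum_pi_single]
    change p n k = _
    split_ifs with h
    · rfl
    · have h2 : component v (s n) = 0 :=
        hN (s n) (by have := hs n; rw [Finset.mem_range] at h; omega)
      refine Subtype.ext ?_
      change fockProj hS hRT n (B n k (component v (s n))) = 0
      rw [h2, map_zero, map_zero]
  rw [h1]
  refine continuous_finsetSum _ fun n _ => ?_
  exact (lp.isometry_single n).continuous.comp (hp n)

end Builder

/-! ### The generators -/

variable (hS hRT)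

/-- Smeared creation operators. The value `Nat.pred 0 = 0` plays no role, as the zero-particle
component of the result is set to zero. -/
def fockCreate (α : ι) : L2One →ₗ[ℂ] Module.End ℂ (FockDomain hS hRT) :=
  fockMap hS hRT Nat.pred (fun n => by have := Nat.pred_eq_sub_one (n := n); omega) fun
    | 0 => 0
    | n + 1 => (Real.sqrt (n + 1) : ℂ) • createOp n α

/-- Smeared annihilation operators. -/
def fockAnnih (α : ι) : L2One →ₗ[ℂ] Module.End ℂ (FockDomain hS hRT) :=
  fockMap hS hRT (fun n => n + 1) (fun n => by omega) fun n =>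
    (Real.sqrt (n + 1) : ℂ) • annihOp n α

/-- Reflection operators. -/
def fockRefl (α β : ι) (χ : ℝ) : Module.End ℂ (FockDomain hS hRT) :=
  fockEnd hS hRT (fun n => n) (fun n => by omega) fun n => reflOp hS hRT n α β χ

/-- Transmission operators. -/
def fockTrans (α β : ι) (χ : ℝ) : Module.End ℂ (FockDomain hS hRT) :=
  fockEnd hS hRT (fun n => n) (fun n => by omega) fun n => transOp hS hRT n α β χ

/-- The products of two creation operators, smeared with a function of two variables. -/
def fockCreatePair (α β : ι) : L2Two →ₗ[ℂ] Module.End ℂ (FockDomain hS hRT) :=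
  fockMap hS hRT (fun n => n - 2) (fun n => by omega) fun
    | 0 => 0
    | 1 => 0
    | n + 2 => ((Real.sqrt ((n + 1 : ℕ) + 1) : ℂ) * (Real.sqrt (n + 1) : ℂ)) • createPairOp n α β

theorem measurePreserving_swap_volume :
    MeasurePreserving (Prod.swap : ℝ × ℝ → ℝ × ℝ) volume volume :=
  Measure.measurePreserving_swap

/-- The products of two annihilation operators, smeared with a function of two variables. The right
factor, with index `β`, acts first and annihilates the particle in the first slot; hence the order
of the indices and of the variables is reversed. -/
def fockAnnihPair (α β : ι) : L2Two →ₗ[ℂ] Module.End ℂ (FockDomain hS hRT) :=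
  fockMap hS hRT (fun n => n + 2) (fun n => by omega) fun n =>
    ((Real.sqrt ((n + 1 : ℕ) + 1) : ℂ) * (Real.sqrt (n + 1) : ℂ)) •
      (annihPairOp n β α ∘L compL Prod.swap measurePreserving_swap_volume)

/-- The products of a creation and an annihilation operator, smeared with a function of two
variables, which act as an integral kernel on the first slot. -/
def fockCreateAnnih (α β : ι) : L2Two →ₗ[ℂ] Module.End ℂ (FockDomain hS hRT) :=
  fockMap hS hRT (fun n => n) (fun n => by omega) fun
    | 0 => 0
    | n + 1 => (n + 1 : ℂ) • kernelOp n α β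

/-- The generators of the reflection-transmission algebra on the Fock space. -/
def fockGenerators : Generators ι (FockDomain hS hRT) where
  a := fockAnnih hS hRT
  adag := fockCreate hS hRT
  r := fockRefl hS hRT
  t := fockTrans hS hRT

variable {hS hRT}

theorem component_fockCreate_zero (α : ι) (h : L2One) (v : FockDomain hS hRT) :
    component (fockCreate hS hRT α h v) 0 = 0 := map_zero (fockProj hS hRT 0)

theorem component_fockCreate_succ (α : ι) (h : L2One) (v : FockDomain hS hRT) (n : ℕ) :
    component (fockCreate hS hRT α h v) (n + 1) =
      (Real.sqrt (n + 1) : ℂ) • fockProj hS hRT (n + 1) (createOp n α h (component v n)) :=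
  (fockProj hS hRT (n + 1)).map_smul _ _

theorem component_fockAnnih (α : ι) (h : L2One) (v : FockDomain hS hRT) (n : ℕ) :
    component (fockAnnih hS hRT α h v) n =
      (Real.sqrt (n + 1) : ℂ) • annihOp n α h (component v (n + 1)) := by
  have h1 : component (fockAnnih hS hRT α h v) n =
      (Real.sqrt (n + 1) : ℂ) • fockProj hS hRT n (annihOp n α h (component v (n + 1))) :=
    (fockProj hS hRT n).map_smul _ _
  rw [h1, fockProj_annihOp hS hRT α h (fockProj_component v (n + 1))]

theorem component_fockRefl (α β : ι) (χ : ℝ) (v : FockDomain hS hRT) (n : ℕ) :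
    component (fockRefl hS hRT α β χ v) n = reflOp hS hRT n α β χ (component v n) := by
  have h1 : component (fockRefl hS hRT α β χ v) n =
      fockProj hS hRT n (reflOp hS hRT n α β χ (component v n)) := rfl
  rw [h1, fockProj_reflOp, fockProj_component]

theorem component_fockTrans (α β : ι) (χ : ℝ) (v : FockDomain hS hRT) (n : ℕ) :
    component (fockTrans hS hRT α β χ v) n = transOp hS hRT n α β χ (component v n) := by
  have h1 : component (fockTrans hS hRT α β χ v) n =
      fockProj hS hRT n (transOp hS hRT n α β χ (component v n)) := rfl
  rw [h1, fockProj_transOp, fockProj_component]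

theorem component_fockCreatePair_zero (α β : ι) (k : L2Two) (v : FockDomain hS hRT) :
    component (fockCreatePair hS hRT α β k v) 0 = 0 := map_zero (fockProj hS hRT 0)

theorem component_fockCreatePair_one (α β : ι) (k : L2Two) (v : FockDomain hS hRT) :
    component (fockCreatePair hS hRT α β k v) 1 = 0 := map_zero (fockProj hS hRT 1)

theorem component_fockCreatePair_succ (α β : ι) (k : L2Two) (v : FockDomain hS hRT) (n : ℕ) :
    component (fockCreatePair hS hRT α β k v) (n + 2) =
      ((Real.sqrt ((n + 1 : ℕ) + 1) : ℂ) * (Real.sqrt (n + 1) : ℂ)) •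
        fockProj hS hRT (n + 2) (createPairOp n α β k (component v n)) :=
  (fockProj hS hRT (n + 2)).map_smul _ _

theorem component_fockAnnihPair (α β : ι) (k : L2Two) (v : FockDomain hS hRT) (n : ℕ) :
    component (fockAnnihPair hS hRT α β k v) n =
      ((Real.sqrt ((n + 1 : ℕ) + 1) : ℂ) * (Real.sqrt (n + 1) : ℂ)) •
        fockProj hS hRT n (annihPairOp n β α (compL Prod.swap measurePreserving_swap_volume k)
          (component v (n + 2))) :=
  (fockProj hS hRT n).map_smul _ _

theorem component_fockCreateAnnih_zero (α β : ι) (k : L2Two) (v : FockDomain hS hRT) :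
    component (fockCreateAnnih hS hRT α β k v) 0 = 0 := map_zero (fockProj hS hRT 0)

theorem component_fockCreateAnnih_succ (α β : ι) (k : L2Two) (v : FockDomain hS hRT) (n : ℕ) :
    component (fockCreateAnnih hS hRT α β k v) (n + 1) =
      (n + 1 : ℂ) • fockProj hS hRT (n + 1) (kernelOp n α β k (component v (n + 1))) :=
  (fockProj hS hRT (n + 1)).map_smul _ _

theorem sqrt_mul_sqrt (n : ℕ) :
    (Real.sqrt (n + 1) : ℂ) * (Real.sqrt (n + 1) : ℂ) = (n + 1 : ℂ) := by
  rw [← Complex.ofReal_mul, Real.mul_self_sqrt (by positivity)]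
  push_cast
  rfl

end Fock

/-! ### Hermitian conjugation and the defect relations -/

section Relations

variable {ι : Type*} [Fintype ι] [DecidableEq ι]
  {S : ℝ → ℝ → Matrix (ι × ι) (ι × ι) ℂ} {R T : ℝ → Matrix ι ι ℂ}
  {hS : IsExchangeFactor S} {hRT : IsAdmissiblePair S R T}

theorem inner_annihOp (n : ℕ) (a : ι) (h : L2One) (ψ : TensorPower ι (n + 1))
    (w : TensorPower ι n) : ⟪annihOp n a h ψ, w⟫_ℂ = ⟪ψ, createOp n a (star h) w⟫_ℂ := by
  rw [← inner_conj_symm, ← inner_conj_symm ψ, inner_createOp, star_star]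

theorem inner_fockAnnih (α : ι) (h : L2One) (v w : FockDomain hS hRT) :
    ⟪(fockAnnih hS hRT α h v : FockSpace (weylOp hS hRT)), (w : FockSpace (weylOp hS hRT))⟫_ℂ =
      ⟪(v : FockSpace (weylOp hS hRT)), (fockCreate hS hRT α (star h) w : _)⟫_ℂ := by
  obtain ⟨N, hN⟩ := exists_component_eq_zero w
  rw [inner_domain_eq_sum _ w hN, inner_domain_eq_sum v _ (N := N + 1) fun n hn => by
    obtain ⟨m, rfl⟩ : ∃ m, n = m + 1 := ⟨n - 1, by omega⟩
    rw [component_fockCreate_succ, hN m (by omega), map_zero, map_zero, smul_zero],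
    Finset.sum_range_succ', component_fockCreate_zero, inner_zero_right, add_zero]
  refine Finset.sum_congr rfl fun n _ => ?_
  rw [component_fockAnnih, component_fockCreate_succ, inner_smul_left, inner_smul_right,
    ← inner_fockProj, fockProj_component, inner_annihOp, Complex.conj_ofReal]

theorem inner_fockCreate (α : ι) (h : L2One) (v w : FockDomain hS hRT) :
    ⟪(fockCreate hS hRT α h v : FockSpace (weylOp hS hRT)), (w : FockSpace (weylOp hS hRT))⟫_ℂ =
      ⟪(v : FockSpace (weylOp hS hRT)), (fockAnnih hS hRT α (star h) w : _)⟫_ℂ := by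
  rw [← inner_conj_symm, ← inner_conj_symm (v : FockSpace (weylOp hS hRT)), inner_fockAnnih,
    star_star]

/-- The test function of the Hermitian conjugate of a product of two bulk generators. -/
def starSwap (k : L2Two) : L2Two := star (compL Prod.swap measurePreserving_swap_volume k)

theorem coeFn_starSwap (k : L2Two) : starSwap k =ᵐ[volume] fun p => conj (k p.swap) := by
  filter_upwards [Lp.coeFn_star (compL Prod.swap measurePreserving_swap_volume k),
    coeFn_compL Prod.swap measurePreserving_swap_volume k] with p e1 e2
  rw [starSwap, e1, Pi.star_apply, e2]
  rfl

theorem inner_fockCreatePair (α β : ι) (k : L2Two) (v w : FockDomain hS hRT) :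
    ⟪(fockCreatePair hS hRT β α (starSwap k) v : FockSpace (weylOp hS hRT)),
        (w : FockSpace (weylOp hS hRT))⟫_ℂ =
      ⟪(v : FockSpace (weylOp hS hRT)), (fockAnnihPair hS hRT α β k w : _)⟫_ℂ := by
  obtain ⟨N, hN⟩ := exists_component_eq_zero w
  rw [inner_domain_eq_sum _ w (N := N + 2) fun n hn => hN n (by omega),
    inner_domain_eq_sum v _ (N := N) fun n hn => by
      rw [component_fockAnnihPair, hN (n + 2) (by omega), map_zero, map_zero, smul_zero],
    Finset.sum_range_succ', Finset.sum_range_succ', component_fockCreatePair_zero,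
    component_fockCreatePair_one, inner_zero_left, inner_zero_left, add_zero, add_zero]
  refine Finset.sum_congr rfl fun n _ => ?_
  rw [component_fockAnnihPair, component_fockCreatePair_succ, inner_smul_left, inner_smul_right,
    inner_fockProj, fockProj_component, ← inner_fockProj, fockProj_component, inner_createPairOp,
    starSwap, star_star, map_mul, Complex.conj_ofReal, Complex.conj_ofReal]

theorem inner_fockRefl (α β : ι) (χ : ℝ) (v w : FockDomain hS hRT) :
    ⟪(fockRefl hS hRT α β χ v : FockSpace (weylOp hS hRT)), (w : FockSpace (weylOp hS hRT))⟫_ℂ =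
      ⟪(v : FockSpace (weylOp hS hRT)), (fockRefl hS hRT β α (-χ) w : _)⟫_ℂ := by
  obtain ⟨N, hN⟩ := exists_component_eq_zero w
  rw [inner_domain_eq_sum _ w hN, inner_domain_eq_sum v _ (N := N) fun n hn => by
    rw [component_fockRefl, hN n hn, map_zero]]
  refine Finset.sum_congr rfl fun n _ => ?_
  rw [component_fockRefl, component_fockRefl, inner_reflOp]

theorem inner_fockTrans (α β : ι) (χ : ℝ) (v w : FockDomain hS hRT) :
    ⟪(fockTrans hS hRT α β χ v : FockSpace (weylOp hS hRT)), (w : FockSpace (weylOp hS hRT))⟫_ℂ =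
      ⟪(v : FockSpace (weylOp hS hRT)), (fockTrans hS hRT β α χ w : _)⟫_ℂ := by
  obtain ⟨N, hN⟩ := exists_component_eq_zero w
  rw [inner_domain_eq_sum _ w hN, inner_domain_eq_sum v _ (N := N) fun n hn => by
    rw [component_fockTrans, hN n hn, map_zero]]
  refine Finset.sum_congr rfl fun n _ => ?_
  rw [component_fockTrans, component_fockTrans, inner_transOp]

variable (hS hRT) in
theorem involutionIsConjugation_fockGenerators :
    InvolutionIsConjugation (fockGenerators hS hRT) :=
  ⟨inner_fockAnnih, inner_fockRefl, inner_fockTrans⟩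

theorem norm_le_of_component {v w : FockDomain hS hRT}
    (h : ∀ n, ‖component w n‖ ≤ ‖component v n‖) :
    ‖(w : FockSpace (weylOp hS hRT))‖ ≤ ‖(v : FockSpace (weylOp hS hRT))‖ := by
  have h1 := lp.norm_rpow_eq_tsum (p := 2) (by norm_num) (w : FockSpace (weylOp hS hRT))
  have h2 := lp.norm_rpow_eq_tsum (p := 2) (by norm_num) (v : FockSpace (weylOp hS hRT))
  have h3 := (lp.memℓp (w : FockSpace (weylOp hS hRT))).summable (by norm_num)
  have h4 := (lp.memℓp (v : FockSpace (weylOp hS hRT))).summable (by norm_num)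
  refine (Real.rpow_le_rpow_iff (norm_nonneg _) (norm_nonneg _) (z := (2 : ℝ≥0∞).toReal)
    (by norm_num)).1 ?_
  rw [h1, h2]
  exact h3.tsum_le_tsum (fun n => Real.rpow_le_rpow (norm_nonneg _) (h n) (by norm_num)) h4

variable (hS hRT) in
theorem isOperatorDistribution_fockGenerators :
    IsOperatorDistribution (fockGenerators hS hRT) where
  continuous_a _ v := continuous_fockMap _ _ _ v
  continuous_adag _ v := continuous_fockMap _ _ _ v
  measurable_r α β v w := by
    obtain ⟨N, hN⟩ := exists_component_eq_zero v
    refine Measurable.aemeasurable ?_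
    have h : (fun χ => ⟪w, (fockRefl hS hRT α β χ v : FockSpace (weylOp hS hRT))⟫_ℂ) = _ :=
      funext fun χ => inner_eq_sum w _ (N := N) fun n hn => by
        rw [component_fockRefl, hN n hn, map_zero]
    refine h ▸ ?_
    refine Finset.measurable_sum _ fun n _ => ?_
    simp only [component_fockRefl]
    exact measurable_inner_reflOp hS hRT α β _ _
  measurable_t α β v w := by
    obtain ⟨N, hN⟩ := exists_component_eq_zero v
    refine Measurable.aemeasurable ?_
    have h : (fun χ => ⟪w, (fockTrans hS hRT α β χ v : FockSpace (weylOp hS hRT))⟫_ℂ) = _ :=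
      funext fun χ => inner_eq_sum w _ (N := N) fun n hn => by
        rw [component_fockTrans, hN n hn, map_zero]
    refine h ▸ ?_
    refine Finset.measurable_sum _ fun n _ => ?_
    simp only [component_fockTrans]
    exact measurable_inner_transOp hS hRT α β _ _
  bounded_r α β v := ⟨_, fun χ => norm_le_of_component (v := v) fun n => by
    change ‖component (fockRefl hS hRT α β χ v) n‖ ≤ _
    rw [component_fockRefl]
    exact norm_reflOp_le hS hRT α β χ _⟩
  bounded_t α β v := ⟨_, fun χ => norm_le_of_component (v := v) fun n => by
    change ‖component (fockTrans hS hRT α β χ v) n‖ ≤ _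
    rw [component_fockTrans]
    exact norm_transOp_le hS hRT α β χ _⟩

/-- The operator `A` acts on each component with the operators `B`. -/
def ActsBy (A : Module.End ℂ (FockDomain hS hRT))
    (B : ∀ n, TensorPower ι n →L[ℂ] TensorPower ι n) : Prop :=
  ∀ v n, component (A v) n = B n (component v n)

theorem ActsBy.mul {A A' : Module.End ℂ (FockDomain hS hRT)}
    {B B' : ∀ n, TensorPower ι n →L[ℂ] TensorPower ι n} (h : ActsBy A B) (h' : ActsBy A' B') :
    ActsBy (A * A') (fun n => B n * B' n) := fun v n => by
  rw [Module.End.mul_apply, h, h', mul_apply_eq_comp]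

theorem ActsBy.smul (c : ℂ) {A : Module.End ℂ (FockDomain hS hRT)}
    {B : ∀ n, TensorPower ι n →L[ℂ] TensorPower ι n} (h : ActsBy A B) :
    ActsBy (c • A) (fun n => c • B n) := fun v n => by
  rw [LinearMap.smul_apply, component_smul, h, _root_.smul_apply]

theorem ActsBy.add {A A' : Module.End ℂ (FockDomain hS hRT)}
    {B B' : ∀ n, TensorPower ι n →L[ℂ] TensorPower ι n} (h : ActsBy A B) (h' : ActsBy A' B') :
    ActsBy (A + A') (fun n => B n + B' n) := fun v n => by
  rw [LinearMap.add_apply, component_add, h, h', _root_.add_apply]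

theorem ActsBy.sum {κ : Type*} (s : Finset κ) {A : κ → Module.End ℂ (FockDomain hS hRT)}
    {B : κ → ∀ n, TensorPower ι n →L[ℂ] TensorPower ι n} (h : ∀ i, ActsBy (A i) (B i)) :
    ActsBy (∑ i ∈ s, A i) (fun n => ∑ i ∈ s, B i n) := fun v n => by
  rw [LinearMap.sum_apply, component_sum, _root_.sum_apply]
  exact Finset.sum_congr rfl fun i _ => h i v n

theorem ActsBy.ext {A A' : Module.End ℂ (FockDomain hS hRT)}
    {B B' : ∀ n, TensorPower ι n →L[ℂ] TensorPower ι n} (h : ActsBy A B) (h' : ActsBy A' B')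
    (e : ∀ n, B n = B' n) : A = A' :=
  LinearMap.ext fun v => domain_ext fun n => by rw [h, h', e]

theorem actsBy_fockRefl (α β : ι) (χ : ℝ) :
    ActsBy (fockRefl hS hRT α β χ) (fun n => reflOp hS hRT n α β χ) :=
  fun v n => component_fockRefl α β χ v n

theorem actsBy_fockTrans (α β : ι) (χ : ℝ) :
    ActsBy (fockTrans hS hRT α β χ) (fun n => transOp hS hRT n α β χ) :=
  fun v n => component_fockTrans α β χ v n

theorem actsBy_zero : ActsBy (0 : Module.End ℂ (FockDomain hS hRT)) (fun _ => 0) := fun _ _ => rfl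

theorem actsBy_ite (c : Prop) [Decidable c] :
    ActsBy (if c then 1 else 0 : Module.End ℂ (FockDomain hS hRT))
      (fun _ => if c then 1 else 0) := fun v n => by
  split_ifs <;> rfl

variable (hS hRT) in
theorem defectRelations_fockGenerators : DefectRelations S (fockGenerators hS hRT) where
  rel_rr α₁ α₂ β₁ β₂ x y := by
    refine ActsBy.ext
      (ActsBy.sum _ fun γ₁ => ActsBy.sum _ fun γ₂ => ActsBy.sum _ fun δ₁ => ActsBy.sum _ fun δ₂ =>
        ((actsBy_fockRefl γ₁ δ₁ x).mul (actsBy_fockRefl δ₂ β₂ y)).smul _)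
      (ActsBy.sum _ fun γ₁ => ActsBy.sum _ fun γ₂ => ActsBy.sum _ fun δ₁ => ActsBy.sum _ fun δ₂ =>
        ((actsBy_fockRefl α₂ γ₂ y).mul (actsBy_fockRefl δ₁ γ₁ x)).smul _) fun n => ?_
    exact defectOp_defectExchange hS ((hRT.compatible_R hS x).reflection y) n α₁ α₂ β₁ β₂
  rel_tt α₁ α₂ β₁ β₂ x y := by
    refine ActsBy.ext
      (ActsBy.sum _ fun γ₁ => ActsBy.sum _ fun γ₂ => ActsBy.sum _ fun δ₁ => ActsBy.sum _ fun δ₂ =>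
        ((actsBy_fockTrans γ₁ δ₁ x).mul (actsBy_fockTrans δ₂ β₂ y)).smul _)
      (ActsBy.sum _ fun γ₁ => ActsBy.sum _ fun γ₂ => ActsBy.sum _ fun δ₁ => ActsBy.sum _ fun δ₂ =>
        ((actsBy_fockTrans α₂ γ₂ y).mul (actsBy_fockTrans δ₁ γ₁ x)).smul _) fun n => ?_
    exact defectOp_defectExchange hS ((hRT.compatible_T x).transmission y) n α₁ α₂ β₁ β₂
  rel_tr α₁ α₂ β₁ β₂ x y := by
    refine ActsBy.ext
      (ActsBy.sum _ fun γ₁ => ActsBy.sum _ fun γ₂ => ActsBy.sum _ fun δ₁ => ActsBy.sum _ fun δ₂ =>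
        ((actsBy_fockTrans γ₁ δ₁ x).mul (actsBy_fockRefl δ₂ β₂ y)).smul _)
      (ActsBy.sum _ fun γ₁ => ActsBy.sum _ fun γ₂ => ActsBy.sum _ fun δ₁ => ActsBy.sum _ fun δ₂ =>
        ((actsBy_fockRefl α₂ γ₂ y).mul (actsBy_fockTrans δ₁ γ₁ x)).smul _) fun n => ?_
    exact defectOp_defectExchange hS ((hRT.compatible_T x).reflection y) n α₁ α₂ β₁ β₂

variable (hS hRT) in
theorem unitarityConstraints_fockGenerators : UnitarityConstraints (fockGenerators hS hRT) where
  unit_one α₁ α₂ χ := by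
    refine ActsBy.ext
      ((ActsBy.sum _ fun β => (actsBy_fockTrans α₁ β χ).mul (actsBy_fockTrans β α₂ χ)).add
        (ActsBy.sum _ fun β => (actsBy_fockRefl α₁ β χ).mul (actsBy_fockRefl β α₂ (-χ))))
      (actsBy_ite (α₁ = α₂)) fun n => ?_
    exact transOp_unitarity hS hRT n α₁ α₂ χ
  unit_zero α₁ α₂ χ := by
    refine ActsBy.ext
      ((ActsBy.sum _ fun β => (actsBy_fockTrans α₁ β χ).mul (actsBy_fockRefl β α₂ χ)).add
        (ActsBy.sum _ fun β => (actsBy_fockRefl α₁ β χ).mul (actsBy_fockTrans β α₂ (-χ))))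
      actsBy_zero fun n => ?_
    exact transOp_reflOp hS hRT n α₁ α₂ χ

theorem fockRefl_mul_fockCreate (α₁ α₂ β₁ : ι) (χ₁ : ℝ) (h : L2One) (h' : ι → ι → ι → L2One)
    (hh : ∀ γ₁ δ₁ δ₂, h' γ₁ δ₁ δ₂ =ᵐ[volume] fun χ₂ =>
      (∑ γ₂, S χ₁ χ₂ (α₁, δ₂) (γ₂, δ₁) * S χ₂ (-χ₁) (γ₂, γ₁) (β₁, α₂)) * h χ₂) :
    fockRefl hS hRT α₁ β₁ χ₁ * fockCreate hS hRT α₂ h =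
      ∑ γ₁, ∑ δ₁, ∑ δ₂, fockCreate hS hRT δ₂ (h' γ₁ δ₁ δ₂) * fockRefl hS hRT δ₁ γ₁ χ₁ := by
  refine LinearMap.ext fun v => domain_ext fun n => ?_
  simp only [LinearMap.sum_apply, component_sum, Module.End.mul_apply]
  cases n with
  | zero => simp only [component_fockRefl, component_fockCreate_zero, map_zero,
      Finset.sum_const_zero]
  | succ n =>
    simp only [component_fockRefl, component_fockCreate_succ, map_smul]
    rw [← fockProj_reflOp, reflOp, defectOp_createOp hS _ _ _ _ _ _ h h' hh]
    simp only [map_sum, Finset.smul_sum]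
    rfl

theorem fockTrans_mul_fockCreate (α₁ α₂ β₁ : ι) (χ₁ : ℝ) (h : L2One) (h' : ι → ι → ι → L2One)
    (hh : ∀ γ₁ δ₁ δ₂, h' γ₁ δ₁ δ₂ =ᵐ[volume] fun χ₂ =>
      (∑ γ₂, S χ₁ χ₂ (α₁, δ₂) (γ₂, δ₁) * S χ₂ χ₁ (γ₂, γ₁) (β₁, α₂)) * h χ₂) :
    fockTrans hS hRT α₁ β₁ χ₁ * fockCreate hS hRT α₂ h =
      ∑ γ₁, ∑ δ₁, ∑ δ₂, fockCreate hS hRT δ₂ (h' γ₁ δ₁ δ₂) * fockTrans hS hRT δ₁ γ₁ χ₁ := by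
  refine LinearMap.ext fun v => domain_ext fun n => ?_
  simp only [LinearMap.sum_apply, component_sum, Module.End.mul_apply]
  cases n with
  | zero => simp only [component_fockTrans, component_fockCreate_zero, map_zero,
      Finset.sum_const_zero]
  | succ n =>
    simp only [component_fockTrans, component_fockCreate_succ, map_smul]
    rw [← fockProj_transOp, transOp, defectOp_createOp hS _ _ _ _ _ _ h h' hh]
    simp only [map_sum, Finset.smul_sum]
    rfl

theorem inner_sum_domain {κ : Type*} (s : Finset κ) (w : FockDomain hS hRT)
    (v : κ → FockDomain hS hRT) :
    ⟪(w : FockSpace (weylOp hS hRT)), ((∑ i ∈ s, v i : FockDomain hS hRT) : _)⟫_ℂ =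
      ∑ i ∈ s, ⟪(w : FockSpace (weylOp hS hRT)), (v i : FockSpace (weylOp hS hRT))⟫_ℂ := by
  rw [Submodule.coe_sum, inner_sum]

theorem sum_inner_domain {κ : Type*} (s : Finset κ) (w : FockDomain hS hRT)
    (v : κ → FockDomain hS hRT) :
    ⟪((∑ i ∈ s, v i : FockDomain hS hRT) : FockSpace (weylOp hS hRT)),
      (w : FockSpace (weylOp hS hRT))⟫_ℂ =
      ∑ i ∈ s, ⟪(v i : FockSpace (weylOp hS hRT)), (w : FockSpace (weylOp hS hRT))⟫_ℂ := by
  rw [Submodule.coe_sum, sum_inner]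

theorem IsExchangeFactor.conj_apply (hS : IsExchangeFactor S) (x y : ℝ) (a b : ι × ι) :
    conj (S x y a b) = S y x b a := by
  rw [← hS.hermitian x y]
  rfl

/-- The Hermitian conjugate of `fockRefl_mul_fockCreate`. -/
theorem fockAnnih_mul_fockRefl (α₁ α₂ β₂ : ι) (χ₂ : ℝ) (h : L2One) (h' : ι → ι → ι → L2One)
    (hh : ∀ γ₂ δ₁ δ₂, h' γ₂ δ₁ δ₂ =ᵐ[volume] fun χ₁ =>
      (∑ γ₁, S χ₂ χ₁ (α₂, α₁) (γ₁, γ₂) * S χ₁ (-χ₂) (γ₁, δ₂) (β₂, δ₁)) * h χ₁) :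
    fockAnnih hS hRT α₁ h * fockRefl hS hRT α₂ β₂ χ₂ =
      ∑ γ₂, ∑ δ₁, ∑ δ₂, fockRefl hS hRT γ₂ δ₂ χ₂ * fockAnnih hS hRT δ₁ (h' γ₂ δ₁ δ₂) := by
  have key := fockRefl_mul_fockCreate (hS := hS) (hRT := hRT) β₂ α₁ α₂ (-χ₂) (star h)
    (fun γ₁ δ₁ δ₂ => star (h' γ₁ δ₂ δ₁)) fun γ₁ δ₁ δ₂ => by
      filter_upwards [Lp.coeFn_star (h' γ₁ δ₂ δ₁), Lp.coeFn_star h, hh γ₁ δ₂ δ₁] with z e1 e2 e3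
      rw [e1, e2, Pi.star_apply, Pi.star_apply, e3, RCLike.star_def, map_mul,
        map_sum, neg_neg]
      congr 1
      refine Finset.sum_congr rfl fun p _ => ?_
      rw [map_mul, hS.conj_apply, hS.conj_apply, mul_comm]
  refine end_ext_inner fun v w => ?_
  have h1 := congrArg (fun A : Module.End ℂ (FockDomain hS hRT) =>
    ⟪(A w : FockSpace (weylOp hS hRT)), (v : FockSpace (weylOp hS hRT))⟫_ℂ) key
  simp only [LinearMap.sum_apply, Module.End.mul_apply, sum_inner_domain, inner_fockRefl,
    inner_fockCreate, star_star, neg_neg] at h1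
  simp only [LinearMap.sum_apply, Module.End.mul_apply, inner_sum_domain]
  rw [h1]
  exact Finset.sum_congr rfl fun γ _ => Finset.sum_comm

/-- The Hermitian conjugate of `fockTrans_mul_fockCreate`. -/
theorem fockAnnih_mul_fockTrans (α₁ α₂ β₂ : ι) (χ₂ : ℝ) (h : L2One) (h' : ι → ι → ι → L2One)
    (hh : ∀ γ₂ δ₁ δ₂, h' γ₂ δ₁ δ₂ =ᵐ[volume] fun χ₁ =>
      (∑ γ₁, S χ₂ χ₁ (α₂, α₁) (γ₁, γ₂) * S χ₁ χ₂ (γ₁, δ₂) (β₂, δ₁)) * h χ₁) :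
    fockAnnih hS hRT α₁ h * fockTrans hS hRT α₂ β₂ χ₂ =
      ∑ γ₂, ∑ δ₁, ∑ δ₂, fockTrans hS hRT γ₂ δ₂ χ₂ * fockAnnih hS hRT δ₁ (h' γ₂ δ₁ δ₂) := by
  have key := fockTrans_mul_fockCreate (hS := hS) (hRT := hRT) β₂ α₁ α₂ χ₂ (star h)
    (fun γ₁ δ₁ δ₂ => star (h' γ₁ δ₂ δ₁)) fun γ₁ δ₁ δ₂ => by
      filter_upwards [Lp.coeFn_star (h' γ₁ δ₂ δ₁), Lp.coeFn_star h, hh γ₁ δ₂ δ₁] with z e1 e2 e3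
      rw [e1, e2, Pi.star_apply, Pi.star_apply, e3, RCLike.star_def, map_mul,
        map_sum]
      congr 1
      refine Finset.sum_congr rfl fun p _ => ?_
      rw [map_mul, hS.conj_apply, hS.conj_apply, mul_comm]
  refine end_ext_inner fun v w => ?_
  have h1 := congrArg (fun A : Module.End ℂ (FockDomain hS hRT) =>
    ⟪(A w : FockSpace (weylOp hS hRT)), (v : FockSpace (weylOp hS hRT))⟫_ℂ) key
  simp only [LinearMap.sum_apply, Module.End.mul_apply, sum_inner_domain, inner_fockTrans,
    inner_fockCreate, star_star] at h1
  simp only [LinearMap.sum_apply, Module.End.mul_apply, inner_sum_domain]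
  rw [h1]
  exact Finset.sum_congr rfl fun γ _ => Finset.sum_comm

variable (hS hRT) in
theorem mixedRelations_fockGenerators : MixedRelations S (fockGenerators hS hRT) :=
  ⟨fockAnnih_mul_fockRefl, fockRefl_mul_fockCreate, fockAnnih_mul_fockTrans,
    fockTrans_mul_fockCreate⟩

end Relations

/-! ### The bulk relations -/

section Bulk

variable {ι : Type*} [Fintype ι] [DecidableEq ι]
  {S : ℝ → ℝ → Matrix (ι × ι) (ι × ι) ℂ} {R T : ℝ → Matrix ι ι ℂ}
  {hS : IsExchangeFactor S} {hRT : IsAdmissiblePair S R T}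

theorem fockCreatePair_eq_mul (α β : ι) (f g : L2One) (k : L2Two)
    (hk : k =ᵐ[volume] fun p => f p.1 * g p.2) :
    fockCreatePair hS hRT α β k = fockCreate hS hRT α f * fockCreate hS hRT β g := by
  refine LinearMap.ext fun v => domain_ext fun n => ?_
  rw [Module.End.mul_apply]
  match n with
  | 0 => rw [component_fockCreatePair_zero, component_fockCreate_zero]
  | 1 => rw [component_fockCreatePair_one, component_fockCreate_succ, component_fockCreate_zero,
      map_zero, map_zero, smul_zero]
  | n + 2 =>
    rw [component_fockCreatePair_succ, component_fockCreate_succ, component_fockCreate_succ,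
      map_smul, map_smul, fockProj_createOp_fockProj, createOp_createOp α β f g k hk, smul_smul]

theorem fockAnnihPair_eq_mul (α β : ι) (f g : L2One) (k : L2Two)
    (hk : k =ᵐ[volume] fun p => f p.1 * g p.2) :
    fockAnnihPair hS hRT α β k = fockAnnih hS hRT α f * fockAnnih hS hRT β g := by
  refine end_ext_inner fun v w => ?_
  rw [← inner_fockCreatePair, Module.End.mul_apply]
  have h1 := inner_fockCreate (hS := hS) (hRT := hRT) α (star f) w (fockAnnih hS hRT β g v)
  have h2 := inner_fockCreate (hS := hS) (hRT := hRT) β (star g)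
    (fockCreate hS hRT α (star f) w) v
  rw [star_star] at h1 h2
  rw [← h1, ← h2, fockCreatePair_eq_mul β α (star g) (star f)]
  · rfl
  · have hk' := measurePreserving_swap_volume.quasiMeasurePreserving.ae hk
    have hf := Measure.quasiMeasurePreserving_snd (μ := (volume : Measure ℝ))
      (ν := (volume : Measure ℝ)) |>.ae (Lp.coeFn_star f)
    have hg := Measure.quasiMeasurePreserving_fst (μ := (volume : Measure ℝ))
      (ν := (volume : Measure ℝ)) |>.ae (Lp.coeFn_star g)
    filter_upwards [coeFn_starSwap k, hk', hf, hg] with p e1 e2 e3 e4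
    rw [e1, e2, e3, e4, map_mul, mul_comm]
    rfl

theorem fockCreateAnnih_eq_mul (α β : ι) (f g : L2One) (k : L2Two)
    (hk : k =ᵐ[volume] fun p => f p.1 * g p.2) :
    fockCreateAnnih hS hRT α β k = fockCreate hS hRT α f * fockAnnih hS hRT β g := by
  refine LinearMap.ext fun v => domain_ext fun n => ?_
  rw [Module.End.mul_apply]
  cases n with
  | zero => rw [component_fockCreateAnnih_zero, component_fockCreate_zero]
  | succ n =>
    rw [component_fockCreateAnnih_succ, component_fockCreate_succ, component_fockAnnih, map_smul,
      map_smul, kernelOp_eq_comp α β hk, smul_smul, sqrt_mul_sqrt]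

/-- The exchange relation of creation operators: the projection absorbs the exchange of the first two
particles. -/
theorem fockCreatePair_exchange (α₁ α₂ : ι) (k : L2Two) (k' : ι → ι → L2Two)
    (hk : ∀ β₁ β₂, k' β₁ β₂ =ᵐ[volume]
      fun p => S p.1 p.2 (β₂, β₁) (α₁, α₂) * k (p.2, p.1)) :
    fockCreatePair hS hRT α₁ α₂ k = ∑ β₁, ∑ β₂, fockCreatePair hS hRT β₂ β₁ (k' β₁ β₂) := by
  refine LinearMap.ext fun v => domain_ext fun n => ?_
  simp only [LinearMap.sum_apply, component_sum]
  match n with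
  | 0 => simp only [component_fockCreatePair_zero, Finset.sum_const_zero]
  | 1 => simp only [component_fockCreatePair_one, Finset.sum_const_zero]
  | n + 2 =>
    simp only [component_fockCreatePair_succ]
    rw [← fockProj_weylOp hS hRT (weylGen (n + 2) 0) (createPairOp n α₁ α₂ k (component v n)),
      weylOp_zero_createPairOp hS hRT α₁ α₂ k (fun c d => k' d c) fun c d => hk d c]
    simp only [map_sum, Finset.smul_sum]
    exact Finset.sum_comm

/-- The Hermitian conjugate of the exchange relation of creation operators. -/
theorem fockAnnihPair_exchange (α₁ α₂ : ι) (k : L2Two) (k' : ι → ι → L2Two)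
    (hk : ∀ β₁ β₂, k' β₁ β₂ =ᵐ[volume]
      fun p => S p.1 p.2 (α₂, α₁) (β₁, β₂) * k (p.2, p.1)) :
    fockAnnihPair hS hRT α₁ α₂ k = ∑ β₁, ∑ β₂, fockAnnihPair hS hRT β₂ β₁ (k' β₁ β₂) := by
  have key := fockCreatePair_exchange (hS := hS) (hRT := hRT) α₂ α₁ (starSwap k)
    (fun β₁ β₂ => starSwap (k' β₂ β₁)) fun β₁ β₂ => by
      have h1 := measurePreserving_swap_volume.quasiMeasurePreserving.ae (hk β₂ β₁)
      have h2 := measurePreserving_swap_volume.quasiMeasurePreserving.ae (coeFn_starSwap k)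
      filter_upwards [coeFn_starSwap (k' β₂ β₁), h1, h2] with p e1 e2 e3
      change _ = S p.1 p.2 (β₂, β₁) (α₂, α₁) * starSwap k p.swap
      rw [e1, e2, e3, map_mul, hS.conj_apply]
      rfl
  refine end_ext_inner fun v w => ?_
  have h1 := congrArg (fun A : Module.End ℂ (FockDomain hS hRT) =>
    ⟪(A w : FockSpace (weylOp hS hRT)), (v : FockSpace (weylOp hS hRT))⟫_ℂ) key
  simp only [LinearMap.sum_apply, sum_inner_domain, inner_fockCreatePair] at h1
  simp only [LinearMap.sum_apply, inner_sum_domain]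
  rw [h1]
  exact Finset.sum_comm

/-- The exchange relation of annihilation and creation for the `n`-particle components. -/
theorem inner_component_annih_create (α₁ α₂ : ι) (f g : L2One) (k' : ι → ι → L2Two)
    (hk : ∀ β₁ β₂, k' β₁ β₂ =ᵐ[volume]
      fun p => S p.2 p.1 (α₁, β₂) (α₂, β₁) * (f p.2 * g p.1)) (v : FockDomain hS hRT) (n : ℕ)
    {w : TensorPower ι n} :
    ⟪w, component ((fockAnnih hS hRT α₁ f * fockCreate hS hRT α₂ g -
        ∑ β₁, ∑ β₂, fockCreateAnnih hS hRT β₂ β₁ (k' β₁ β₂)) v) n⟫_ℂ =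
      (1 / 2 : ℂ) * ((∫ χ, f χ * g χ * (if α₁ = α₂ then ⟪w, component v n⟫_ℂ else 0)) +
        ((∫ χ, f χ * g χ * ⟪w, transOp hS hRT n α₁ α₂ χ (component v n)⟫_ℂ) +
          ∫ χ, f χ * g (-χ) * ⟪w, reflOp hS hRT n α₁ α₂ χ (component v n)⟫_ℂ)) := by
  rw [← inner_annihOp_createOp, ← inner_annihOp_flip_createOp, ← inner_add_right,
    ← inner_smul_right]
  congr 1
  simp only [LinearMap.sub_apply, component_sub, LinearMap.sum_apply, component_sum,
    Module.End.mul_apply, component_fockAnnih, component_fockCreate_succ, map_smul, smul_smul,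
    sqrt_mul_sqrt]
  cases n with
  | zero =>
    simp only [component_fockCreateAnnih_zero, Finset.sum_const_zero, sub_zero]
    rw [← annihOp_fockProj_createOp_zero hS hRT α₁ α₂ f g (fockProj_component v 0), smul_smul]
    norm_num
  | succ n =>
    simp only [component_fockCreateAnnih_succ]
    have h1 := annihOp_fockProj_createOp_succ hS hRT α₁ α₂ f g (fockProj_component v (n + 1))
      (fun c d => k' d c) fun c d => hk d c
    simp only [map_sum] at h1
    simp only [← Finset.smul_sum]
    have h2 := congrArg ((1 / 2 : ℂ) • ·) h1
    simp only [smul_add, smul_smul, ← mul_assoc] at h2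
    norm_num at h2
    rw [sub_eq_iff_eq_add, smul_add]
    norm_num
    exact h2

variable (hS hRT) in
theorem bulkRelations_fockGenerators : BulkRelations (1 / 2) S (fockGenerators hS hRT) where
  rel_aa := ⟨fockAnnihPair hS hRT, fun α β => ⟨fun v => continuous_fockMap _ _ _ v,
    fockAnnihPair_eq_mul α β⟩, fun α₁ α₂ k k' hk =>
      sub_eq_zero.2 (fockAnnihPair_exchange α₁ α₂ k k' hk)⟩
  rel_adag_adag := ⟨fockCreatePair hS hRT, fun α β => ⟨fun v => continuous_fockMap _ _ _ v,
    fockCreatePair_eq_mul α β⟩, fun α₁ α₂ k k' hk =>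
      sub_eq_zero.2 (fockCreatePair_exchange α₁ α₂ k k' hk)⟩
  rel_a_adag := by
    refine ⟨fockCreateAnnih hS hRT, fun α β => ⟨fun v => continuous_fockMap _ _ _ v,
      fockCreateAnnih_eq_mul α β⟩, fun α₁ α₂ f g k' hk v w => ?_⟩
    obtain ⟨N, hN⟩ := exists_component_eq_zero v
    change ⟪w, (((fockAnnih hS hRT α₁ f * fockCreate hS hRT α₂ g -
      ∑ β₁, ∑ β₂, fockCreateAnnih hS hRT β₂ β₁ (k' β₁ β₂)) v : FockDomain hS hRT) :
        FockSpace (weylOp hS hRT))⟫_ℂ =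
      ((1 / 2 : ℝ) : ℂ) * (∫ χ, f χ * g χ *
              ((if α₁ = α₂ then ⟪w, (v : FockSpace (weylOp hS hRT))⟫_ℂ else 0) +
                ⟪w, (fockTrans hS hRT α₁ α₂ χ v : FockSpace (weylOp hS hRT))⟫_ℂ)) +
          ((1 / 2 : ℝ) : ℂ) * (∫ χ, f χ * g (-χ) *
            ⟪w, (fockRefl hS hRT α₁ α₂ χ v : FockSpace (weylOp hS hRT))⟫_ℂ)
    have e1 := inner_eq_sum w v hN
    have e2 := fun χ => inner_eq_sum w (fockTrans hS hRT α₁ α₂ χ v) (N := N) fun n hn => by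
      rw [component_fockTrans, hN n hn, map_zero]
    have e3 := fun χ => inner_eq_sum w (fockRefl hS hRT α₁ α₂ χ v) (N := N) fun n hn => by
      rw [component_fockRefl, hN n hn, map_zero]
    rw [inner_eq_sum w _ (N := N) fun n hn => by
      have := inner_component_annih_create α₁ α₂ f g k' hk v n
        (w := component ((fockAnnih hS hRT α₁ f * fockCreate hS hRT α₂ g -
          ∑ β₁, ∑ β₂, fockCreateAnnih hS hRT β₂ β₁ (k' β₁ β₂)) v) n)
      rw [hN n hn] at this
      simp only [map_zero, inner_zero_right, ite_self, mul_zero, integral_zero, add_zero] at this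
      exact inner_self_eq_zero.1 this]
    simp only [inner_component_annih_create α₁ α₂ f g k' hk, e1, e2, e3, component_fockTrans,
      component_fockRefl, mul_add, Finset.mul_sum]
    have i1 : ∀ c : ℂ, Integrable fun χ => f χ * g χ * c := fun c =>
      integrable_mul_mul_bounded f g measurable_const fun _ => le_rfl
    have i2 : Integrable fun χ => f χ * g χ * (if α₁ = α₂ then ∑ n ∈ Finset.range N,
        ⟪((w n : particleSpace (weylOp hS hRT) n) : TensorPower ι n), component v n⟫_ℂ else 0) :=
      i1 _
    rw [integral_add i2 (integrable_finsetSum _ fun n _ =>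
        integrable_transOp hS hRT f g α₁ α₂ _ _),
      integral_finsetSum _ fun n _ => integrable_transOp hS hRT f g α₁ α₂ _ _,
      integral_finsetSum _ fun n _ => integrable_reflOp hS hRT f g α₁ α₂ _ _,
      mul_add, Finset.mul_sum, Finset.mul_sum, Finset.sum_add_distrib, Finset.sum_add_distrib,
      ← add_assoc]
    push_cast
    congr 2
    rw [← Finset.mul_sum, ← integral_finsetSum _ fun n _ => i1 _]
    congr 2
    funext χ
    rw [← Finset.mul_sum]
    split_ifs
    · rfl
    · simp

end Bulk

/-! ### The vacuum -/

section Vacuum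

variable {ι : Type*} [Fintype ι] [DecidableEq ι]
  {S : ℝ → ℝ → Matrix (ι × ι) (ι × ι) ℂ} {R T : ℝ → Matrix ι ι ℂ}
  (hS : IsExchangeFactor S) (hRT : IsAdmissiblePair S R T)

instance : IsProbabilityMeasure (volume : Measure (Fin 0 → ℝ)) := by
  rw [volume_pi, Measure.pi_of_empty _ default]
  infer_instance

/-- The constant function one, the generator of the tensor power of order zero. -/
def vacuumVector (ι : Type*) [Fintype ι] [DecidableEq ι] : TensorPower ι 0 :=
  embOp default ((memLp_const (1 : ℂ)).toLp (fun _ => 1))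

theorem isRep_vacuumVector : IsRep (vacuumVector ι) (fun _ _ => 1) := by
  filter_upwards [isRep_embOp (ι := ι) default
    (MemLp.coeFn_toLp (memLp_const (p := 2) (μ := (volume : Measure (Fin 0 → ℝ))) (1 : ℂ)))]
    with x hx α
  rw [vacuumVector, hx, if_pos (Subsingleton.elim _ _)]

theorem inner_vacuumVector : ⟪vacuumVector ι, vacuumVector ι⟫_ℂ = 1 := by
  rw [inner_eq_integral _ _ isRep_vacuumVector isRep_vacuumVector]
  simp [dotProduct]

theorem eq_smul_vacuumVector (ψ : TensorPower ι 0) :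
    ψ = ψ default default • vacuumVector ι := by
  refine (isRep_self ψ).ext ?_
  filter_upwards [(isRep_vacuumVector (ι := ι)).smul (ψ default default)] with x hx α
  rw [hx, Subsingleton.elim x default, Subsingleton.elim α default, Pi.smul_apply, Pi.smul_apply,
    smul_eq_mul, mul_one]

theorem fockProj_zero (ψ : TensorPower ι 0) : fockProj hS hRT 0 ψ = ψ :=
  fockProj_of_invariant hS hRT fun g => by
    induction g using weylGroupB_induction with
    | one => rw [map_one, one_apply_eq_self]
    | mul i => exact i.elim0

/-- The vacuum, with the constant function one as its zero-particle component. -/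
def vacuum : FockDomain hS hRT :=
  ofComponents hS hRT (fun | 0 => vacuumVector ι | _ + 1 => 0) ⟨1, fun n hn => by
    obtain ⟨m, rfl⟩ : ∃ m, n = m + 1 := ⟨n - 1, by omega⟩
    rfl⟩

theorem component_vacuum_zero : component (vacuum hS hRT) 0 = vacuumVector ι :=
  fockProj_zero hS hRT _

theorem component_vacuum_succ (n : ℕ) : component (vacuum hS hRT) (n + 1) = 0 :=
  map_zero (fockProj hS hRT (n + 1))

theorem defectOp_vacuumVector (M : Matrix ι ι ℂ) (χ χ' : ℝ) (a b : ι) :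
    defectOp hS M χ χ' 0 a b (vacuumVector ι) = M a b • vacuumVector ι := by
  refine (implements_defectOp hS M χ χ' 0 a b _ _ isRep_vacuumVector).ext ?_
  filter_upwards [(isRep_vacuumVector (ι := ι)).smul (M a b)] with x hx α
  rw [hx, defectWave, genWave_apply, Matrix.mulVec, dotProduct, Fintype.sum_unique, mul_one,
    dressing_zero, block_apply, onSlot, if_pos (fun k hk => absurd (Fin.fin_one_eq_zero k) hk),
    Fin.cons_zero, Fin.cons_zero, Pi.smul_apply, Pi.smul_apply, smul_eq_mul, mul_one]

theorem fockRefl_vacuum (α β : ι) (χ : ℝ) :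
    fockRefl hS hRT α β χ (vacuum hS hRT) = R χ α β • vacuum hS hRT := by
  refine domain_ext fun n => ?_
  rw [component_fockRefl, component_smul]
  cases n with
  | zero => rw [component_vacuum_zero, reflOp, defectOp_vacuumVector]
  | succ n => rw [component_vacuum_succ, map_zero, smul_zero]

theorem fockTrans_vacuum (α β : ι) (χ : ℝ) :
    fockTrans hS hRT α β χ (vacuum hS hRT) = T χ α β • vacuum hS hRT := by
  refine domain_ext fun n => ?_
  rw [component_fockTrans, component_smul]
  cases n with
  | zero => rw [component_vacuum_zero, transOp, defectOp_vacuumVector]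
  | succ n => rw [component_vacuum_succ, map_zero, smul_zero]

theorem inner_vacuum_vacuum : ⟪(vacuum hS hRT : FockSpace (weylOp hS hRT)),
    (vacuum hS hRT : FockSpace (weylOp hS hRT))⟫_ℂ = 1 := by
  rw [inner_domain_eq_sum _ _ (N := 1) fun n hn => by
    obtain ⟨m, rfl⟩ : ∃ m, n = m + 1 := ⟨n - 1, by omega⟩
    exact component_vacuum_succ hS hRT m, Finset.sum_range_one, component_vacuum_zero,
    inner_vacuumVector]

theorem fockAnnih_vacuum (α : ι) (h : L2One) : fockAnnih hS hRT α h (vacuum hS hRT) = 0 := by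
  refine domain_ext fun n => ?_
  rw [component_fockAnnih, component_vacuum_succ, map_zero, smul_zero, component_zero]

/-- The result of applying a product of creation operators to the vacuum. -/
def created (l : List (ι × L2One)) : FockDomain hS hRT :=
  (l.map fun p => fockCreate hS hRT p.1 p.2).prod (vacuum hS hRT)

theorem created_cons (p : ι × L2One) (l : List (ι × L2One)) :
    created hS hRT (p :: l) = fockCreate hS hRT p.1 p.2 (created hS hRT l) := by
  rw [created, List.map_cons, List.prod_cons, Module.End.mul_apply, created]

theorem component_created_ne (l : List (ι × L2One)) :
    ∀ n, n ≠ l.length → component (created hS hRT l) n = 0 := by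
  induction l with
  | nil =>
    intro n hn
    obtain ⟨m, rfl⟩ : ∃ m, n = m + 1 := ⟨n - 1, by simp at hn; omega⟩
    exact component_vacuum_succ hS hRT m
  | cons p l ih =>
    intro n hn
    rw [created_cons]
    cases n with
    | zero => exact component_fockCreate_zero _ _ _
    | succ n =>
      rw [component_fockCreate_succ, ih n (by simpa using hn), map_zero, map_zero, smul_zero]

/-- The vectors created from the vacuum are total in each particle space: a vector orthogonal to
them is annihilated by all annihilation operators, hence orthogonal to all products. -/
theorem eq_zero_of_inner_created (n : ℕ) : ∀ ψ : TensorPower ι n, fockProj hS hRT n ψ = ψ →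
    (∀ l : List (ι × L2One), l.length = n → ⟪component (created hS hRT l) n, ψ⟫_ℂ = 0) →
      ψ = 0 := by
  induction n with
  | zero =>
    intro ψ _ h
    have h1 := h [] rfl
    rw [eq_smul_vacuumVector ψ, inner_smul_right] at h1
    change _ * ⟪component (vacuum hS hRT) 0, _⟫_ℂ = 0 at h1
    rw [component_vacuum_zero, inner_vacuumVector, mul_one] at h1
    rw [eq_smul_vacuumVector ψ, h1, zero_smul]
  | succ n ih =>
    intro ψ hψ h
    refine eq_zero_of_inner_createOp fun a f w => ?_
    rw [inner_createOp, ih (annihOp n a (star f) ψ) (fockProj_annihOp hS hRT a _ hψ),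
      inner_zero_right]
    intro l hl
    have h1 := h ((a, f) :: l) (by simp [hl])
    rw [created_cons, component_fockCreate_succ, inner_smul_left, inner_fockProj, hψ,
      inner_createOp] at h1
    refine (mul_eq_zero.1 h1).resolve_left ?_
    rw [Complex.conj_ofReal]
    exact Complex.ofReal_ne_zero.2 (by positivity)

theorem dense_span_created : Dense (Submodule.span ℂ (Set.range fun l : List (ι × L2One) =>
    (created hS hRT l : FockSpace (weylOp hS hRT))) : Set (FockSpace (weylOp hS hRT))) := by
  rw [Submodule.dense_iff_topologicalClosure_eq_top, Submodule.topologicalClosure_eq_top_iff,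
    Submodule.eq_bot_iff]
  intro w hw
  refine lp.ext (funext fun n => Subtype.ext ?_)
  refine eq_zero_of_inner_created hS hRT n _
    ((mem_particleSpace hS hRT).1 (Subtype.property _)) fun l hl => ?_
  have h1 := (Submodule.mem_orthogonal' _ _).1 hw _ (Submodule.subset_span ⟨l, rfl⟩)
  rw [inner_eq_sum w (created hS hRT l) (N := n + 1) fun m hm =>
    component_created_ne hS hRT l m (by omega), Finset.sum_eq_single n
      (fun m _ hm => by rw [component_created_ne hS hRT l m (by omega), inner_zero_right])
      (fun h => absurd (Finset.mem_range.2 (Nat.lt_succ_self n)) h)] at h1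
  rw [← inner_conj_symm, h1, map_zero]

theorem isFockRepresentation_fockGenerators :
    IsFockRepresentation (1 / 2) S (fockGenerators hS hRT) (vacuum hS hRT) where
  complete := inferInstance
  dense := (dense_span_created hS hRT).mono (Submodule.span_le.2 (by
    rintro _ ⟨l, rfl⟩
    exact (created hS hRT l).2))
  distribution := isOperatorDistribution_fockGenerators hS hRT
  bulk := bulkRelations_fockGenerators hS hRT
  defect := defectRelations_fockGenerators hS hRT
  mixed := mixedRelations_fockGenerators hS hRT
  unitarity := unitarityConstraints_fockGenerators hS hRT
  involution := involutionIsConjugation_fockGenerators hS hRT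
  vacuum_norm := inner_vacuum_vacuum hS hRT
  vacuum_annih := fockAnnih_vacuum hS hRT
  vacuum_cyclic := dense_span_created hS hRT

theorem isWeylRepresentation_weylOp : IsWeylRepresentation S R T (weylOp hS hRT) where
  sigma n i h ψ := by
    have := implements_weylOp hS hRT n i ψ _ (isRep_self ψ)
    rw [sWave_of_lt _ _ _ i h] at this
    exact this
  tau n i h ψ := by
    have := implements_weylOp hS hRT n i ψ _ (isRep_self ψ)
    rw [sWave_of_eq _ _ _ i h] at this
    exact this

theorem defectOp_apply_ae (M : Matrix ι ι ℂ) (χ χ' : ℝ) {n : ℕ} (a b : ι) (ψ : TensorPower ι n) :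
    ∀ᵐ x, ∀ γ : Fin n → ι, defectOp hS M χ χ' n a b ψ x γ =
      ∑ δ : Fin n → ι, dressing S M χ χ' x (Fin.cons a γ : Fin (n + 1) → ι)
        (Fin.cons b δ : Fin (n + 1) → ι) * ψ x δ := by
  have h := implements_defectOp hS M χ χ' n a b ψ _ (isRep_self ψ)
  filter_upwards [h] with x hx γ
  rw [hx, defectWave, genWave_apply]
  rfl

theorem isFockAction_fockGenerators :
    IsFockAction S R T (weylOp hS hRT) (fockGenerators hS hRT) (vacuum hS hRT) where
  vacuum_zero := by
    rw [component_vacuum_zero]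
    exact isRep_vacuumVector
  vacuum_succ := component_vacuum_succ hS hRT
  annih f v n := by
    have h1 := fun α => annihOp_apply_ae (n := n) α (Lp.coeFn_star (f α))
      (isRep_self (component v (n + 1)))
    have h2 : component ((fockGenerators hS hRT).annih f v) n =
        (Real.sqrt (n + 1) : ℂ) • ∑ α, annihOp n α (star (f α)) (component v (n + 1)) := by
      rw [Generators.annih, LinearMap.sum_apply, component_sum, Finset.smul_sum]
      exact Finset.sum_congr rfl fun α _ => component_fockAnnih α (star (f α)) v n
    have h3 := (isRep_sum_apply fun α => isRep_self
      (annihOp n α (star (f α)) (component v (n + 1)))).smul (Real.sqrt (n + 1) : ℂ)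
    rw [← h2] at h3
    filter_upwards [ae_all_iff.2 h1, h3] with x e1 e3 γ
    refine (e3 γ).trans (congrArg ((Real.sqrt (n + 1) : ℂ) * ·) ?_)
    refine (Finset.sum_congr rfl fun α _ => (e1 α γ).2).trans ?_
    exact (integral_finsetSum _ fun α _ => (e1 α γ).1).symm
  creat_zero f v := by
    rw [Generators.creat, LinearMap.sum_apply, component_sum]
    exact Finset.sum_eq_zero fun α _ => component_fockCreate_zero α (f α) v
  creat_succ f v n := by
    refine ⟨∑ α, createOp n α (f α) (component v n), ?_, ?_⟩
    · have h1 := isRep_sum_apply fun α => implements_createOp (n := n) α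
        (Filter.EventuallyEq.refl _ (f α)) _ _ (isRep_self (component v n))
      filter_upwards [h1] with x e1 α
      rw [e1]
      change (∑ i, (if α 0 = i then f i (x 0) else 0) * _) = _
      simp only [ite_mul, zero_mul, Finset.sum_ite_eq, Finset.mem_univ, if_true]
    · rw [Generators.creat, LinearMap.sum_apply, component_sum, map_sum, Finset.smul_sum]
      exact Finset.sum_congr rfl fun α _ => component_fockCreate_succ α (f α) v n
  reflection α β χ v n := by
    have h1 : component ((fockGenerators hS hRT).r α β χ v) n =
        reflOp hS hRT n α β χ (component v n) := component_fockRefl α β χ v n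
    rw [h1]
    exact defectOp_apply_ae hS (R χ) χ (-χ) α β (component v n)
  transmission α β χ v n := by
    have h1 : component ((fockGenerators hS hRT).t α β χ v) n =
        transOp hS hRT n α β χ (component v n) := component_fockTrans α β χ v n
    rw [h1]
    exact defectOp_apply_ae hS (T χ) χ χ α β (component v n)

end Vacuum

/-! ### Rescaling the bulk generators -/

section Scale

variable {ι : Type*} [Fintype ι] [DecidableEq ι]
  {H : Type*} [NormedAddCommGroup H] [InnerProductSpace ℂ H] {D : Submodule ℂ H}
  {S : ℝ → ℝ → Matrix (ι × ι) (ι × ι) ℂ} {G : Generators ι D} {Ω : D}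

theorem IsSmearedProduct.smul {A B : L2One →ₗ[ℂ] Module.End ℂ D}
    {Q : L2Two →ₗ[ℂ] Module.End ℂ D} (h : IsSmearedProduct A B Q) (c : ℂ) :
    IsSmearedProduct (c • A) (c • B) ((c * c) • Q) where
  continuous v := (h.continuous v).const_smul (c * c)
  product f g k hk := by
    rw [LinearMap.smul_apply, LinearMap.smul_apply, LinearMap.smul_apply, h.product f g k hk,
      smul_mul_smul_comm]

theorem BulkRelations.scale {κ : ℝ} (h : BulkRelations κ S G) (c : ℝ) :
    BulkRelations (c * c * κ) S (G.scale c) where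
  rel_aa := by
    obtain ⟨Q, hQ, h'⟩ := h.rel_aa
    refine ⟨fun α β => ((c : ℂ) * c) • Q α β, fun α β => (hQ α β).smul c, fun α₁ α₂ k k' hk => ?_⟩
    simp only [LinearMap.smul_apply, ← Finset.smul_sum, ← smul_sub]
    rw [h' α₁ α₂ k k' hk, smul_zero]
  rel_adag_adag := by
    obtain ⟨Q, hQ, h'⟩ := h.rel_adag_adag
    refine ⟨fun α β => ((c : ℂ) * c) • Q α β, fun α β => (hQ α β).smul c, fun α₁ α₂ k k' hk => ?_⟩
    simp only [LinearMap.smul_apply, ← Finset.smul_sum, ← smul_sub]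
    rw [h' α₁ α₂ k k' hk, smul_zero]
  rel_a_adag := by
    obtain ⟨Q, hQ, h'⟩ := h.rel_a_adag
    refine ⟨fun α β => ((c : ℂ) * c) • Q α β, fun α β => (hQ α β).smul c,
      fun α₁ α₂ f g k' hk v w => ?_⟩
    have e : (G.scale c).a α₁ f * (G.scale c).adag α₂ g -
        ∑ β₁, ∑ β₂, (((c : ℂ) * c) • Q β₂ β₁) (k' β₁ β₂) =
        ((c : ℂ) * c) • (G.a α₁ f * G.adag α₂ g - ∑ β₁, ∑ β₂, Q β₂ β₁ (k' β₁ β₂)) := by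
      simp only [LinearMap.smul_apply, ← Finset.smul_sum, smul_sub]
      congr 1
      exact smul_mul_smul_comm (c : ℂ) (G.a α₁ f) (c : ℂ) (G.adag α₂ g)
    rw [e, LinearMap.smul_apply, Submodule.coe_smul, inner_smul_right, h' α₁ α₂ f g k' hk v w]
    push_cast
    simp only [Generators.scale]
    ring

theorem MixedRelations.scale (h : MixedRelations S G) (c : ℂ) : MixedRelations S (G.scale c) where
  rel_ar α₁ α₂ β₂ χ₂ f f' hf := by
    have := congrArg (c • ·) (h.rel_ar α₁ α₂ β₂ χ₂ f f' hf)
    simpa only [Generators.scale, LinearMap.smul_apply, smul_mul_assoc, mul_smul_comm,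
      Finset.smul_sum] using this
  rel_r_adag α₁ α₂ β₁ χ₁ f f' hf := by
    have := congrArg (c • ·) (h.rel_r_adag α₁ α₂ β₁ χ₁ f f' hf)
    simpa only [Generators.scale, LinearMap.smul_apply, smul_mul_assoc, mul_smul_comm,
      Finset.smul_sum] using this
  rel_at α₁ α₂ β₂ χ₂ f f' hf := by
    have := congrArg (c • ·) (h.rel_at α₁ α₂ β₂ χ₂ f f' hf)
    simpa only [Generators.scale, LinearMap.smul_apply, smul_mul_assoc, mul_smul_comm,
      Finset.smul_sum] using this
  rel_t_adag α₁ α₂ β₁ χ₁ f f' hf := by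
    have := congrArg (c • ·) (h.rel_t_adag α₁ α₂ β₁ χ₁ f f' hf)
    simpa only [Generators.scale, LinearMap.smul_apply, smul_mul_assoc, mul_smul_comm,
      Finset.smul_sum] using this

theorem Generators.prod_scale (G : Generators ι D) (c : ℂ) (l : List (ι × L2One)) :
    (l.map fun p => (G.scale c).adag p.1 p.2).prod =
      c ^ l.length • (l.map fun p => G.adag p.1 p.2).prod := by
  induction l with
  | nil => simp
  | cons p l ih =>
    rw [List.map_cons, List.prod_cons, ih, List.map_cons, List.prod_cons, List.length_cons,
      pow_succ', ← smul_mul_smul_comm]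
    rfl

/-- Multiplying the bulk generators with a real number multiplies the delta functions with its
square. -/
theorem IsFockRepresentation.scale {κ : ℝ} (h : IsFockRepresentation κ S G Ω) {c : ℝ}
    (hc : c ≠ 0) : IsFockRepresentation (c * c * κ) S (G.scale c) Ω where
  complete := h.complete
  dense := h.dense
  distribution :=
    { continuous_a := fun α v => (h.distribution.continuous_a α v).const_smul (c : ℂ)
      continuous_adag := fun α v => (h.distribution.continuous_adag α v).const_smul (c : ℂ)
      measurable_r := h.distribution.measurable_r
      measurable_t := h.distribution.measurable_t
      bounded_r := h.distribution.bounded_r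
      bounded_t := h.distribution.bounded_t }
  bulk := h.bulk.scale c
  defect := ⟨h.defect.rel_rr, h.defect.rel_tt, h.defect.rel_tr⟩
  mixed := h.mixed.scale c
  unitarity := ⟨h.unitarity.unit_one, h.unitarity.unit_zero⟩
  involution :=
    { conj_a := fun α f v w => by
        change ⟪(c : ℂ) • (G.a α f v : H), (w : H)⟫_ℂ =
          ⟪(v : H), (c : ℂ) • (G.adag α (star f) w : H)⟫_ℂ
        rw [inner_smul_left, inner_smul_right, Complex.conj_ofReal, h.involution.conj_a]
      conj_r := h.involution.conj_r
      conj_t := h.involution.conj_t }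
  vacuum_norm := h.vacuum_norm
  vacuum_annih α f := by
    change (c : ℂ) • G.a α f Ω = 0
    rw [h.vacuum_annih, smul_zero]
  vacuum_cyclic := by
    refine h.vacuum_cyclic.mono (Submodule.span_le.2 ?_)
    rintro _ ⟨l, rfl⟩
    have hc' : ((c : ℂ) ^ l.length) ≠ 0 := pow_ne_zero _ (Complex.ofReal_ne_zero.2 hc)
    have h1 : (((l.map fun p => G.adag p.1 p.2).prod Ω : D) : H) = ((c : ℂ) ^ l.length)⁻¹ •
        (((l.map fun p => (G.scale c).adag p.1 p.2).prod Ω : D) : H) := by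
      rw [Generators.prod_scale, LinearMap.smul_apply, Submodule.coe_smul, smul_smul,
        inv_mul_cancel₀ hc', one_smul]
    dsimp only
    rw [h1]
    exact Submodule.smul_mem _ _ (Submodule.subset_span ⟨l, rfl⟩)

end Scale

end

end RTAlgebra

theorem proposition3p5 {ι : Type*} [Fintype ι] [DecidableEq ι]
    (S : ℝ → ℝ → Matrix (ι × ι) (ι × ι) ℂ) (R T : ℝ → Matrix ι ι ℂ)
    (hS : RTAlgebra.IsExchangeFactor S) (hRT : RTAlgebra.IsAdmissiblePair S R T) :
    ∃ ρ : (n : ℕ) → RTAlgebra.weylGroupB n →*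
        (RTAlgebra.TensorPower ι n →L[ℂ] RTAlgebra.TensorPower ι n),
      RTAlgebra.IsWeylRepresentation S R T ρ ∧
      (∀ n, IsStarProjection (RTAlgebra.fockProjection ρ n)) ∧
      ∃ (G : RTAlgebra.Generators ι (RTAlgebra.finiteParticle ρ))
        (Ω : RTAlgebra.finiteParticle ρ),
        RTAlgebra.IsFockAction S R T ρ G Ω ∧
        RTAlgebra.IsFockRepresentation (1 / 2) S G Ω ∧
        RTAlgebra.IsFockRepresentation (2 * Real.pi) S
          (G.scale (Real.sqrt (4 * Real.pi) : ℂ)) Ω ∧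
        (∀ α β χ, G.r α β χ Ω = R χ α β • Ω) ∧
        (∀ α β χ, G.t α β χ Ω = T χ α β • Ω) := by
  have hF := RTAlgebra.isFockRepresentation_fockGenerators hS hRT
  refine ⟨RTAlgebra.weylOp hS hRT, RTAlgebra.isWeylRepresentation_weylOp hS hRT,
    RTAlgebra.isStarProjection_fockProj hS hRT, RTAlgebra.fockGenerators hS hRT,
    RTAlgebra.vacuum hS hRT, RTAlgebra.isFockAction_fockGenerators hS hRT, hF, ?_,
    RTAlgebra.fockRefl_vacuum hS hRT, RTAlgebra.fockTrans_vacuum hS hRT⟩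
  have hpos : (0 : ℝ) < 4 * Real.pi := by positivity
  have h := hF.scale (Real.sqrt_pos.2 hpos).ne'
  rw [Real.mul_self_sqrt hpos.le] at h
  convert h using 1
  ring
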